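/- A *graphon* is a symmetric measurable function $g:[0,1]^2\to[0,1]$. Its edge density, triangle density and entropy are $$\varepsilon(g)=\int g(x,y)\,dx\,dy,\qquad \tau(g)=\int g(x,y)g(y,z)g(z,x)\,dx\,dy\,dz,$$ $$S(g)=-\tfrac12\int \big(g\ln g+(1-g)\ln(1-g)\big)\,dx\,dy ,$$ with $0\ln 0=0$. The density of a finite simple graph $H$ with vertices $1,\dots,k$ is $t_H(g)=\int_{[0,1]^k}\prod_{ij\in E(H)}g(x_i,x_j)\,dx$. The cut metric is $d(f,g)=\sup_{S,T}\big|\int_{S\times T}(f-g)\big|$ over measurable $S,T\subseteq[0,1]$. Let $\delta(f,g)$ be the infimum of $d(f\circ(\varphi\times\varphi),g\circ(\psi\times\psi))$ over measure-preserving maps $\varphi,\psi$ of $[0,1]$. Graphons at $\delta$-distance $0$ are called equivalent. An *optimizer* at $(\varepsilon,\tau)$ is a graphon that maximizes $S$ among all graphons with edge density $\varepsilon$ and triangle density $\tau$. A *phase* is a nonempty connected open set $U\subset\mathbb R^2$ such that every $(\varepsilon,\tau)\in U$ has an optimizer $g_{\varepsilon,\tau}$, which is unique up to equivalence and varies analytically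 on $U$ (every $t_H(g_{\varepsilon,\tau})$ is a real-analytic function of $(\varepsilon,\tau)\in U$). Let $m\ge1$ and $r\in\{1,2\}$. Consider graphons $g$ for which $[0,1]$ can be partitioned into $r$ measurable podes of size $c/r$ each and $m$ measurable podes of size $(1-c)/m$ each, for some $0<c<1$, so that $g$ is almost everywhere constant on each product of two podes with the following values: $a_1$ on a pode of the first group, $a_2$ between two different podes of the first group, $d$ between the two groups, $b$ on a pode of the second group, and $p$ between two different podes of the second group. Such a $g$ is called a $B(m,1)$ graphon if $r=1$, and a $C(m,2)$ graphon if $r=2$, provided that no two of the $m+r$ podes have identical edge probabilities (the rows of the matrix of values are pairwise distinct) and that $g$ is not an $A(m+r,0)$ graphon, i.e. not a graphon with $m+r$ podes of size $1/(m+r)$ for which the value between two podes depends only on whether they coincide. A *$B(m,1)$ phase* (respectively *$C(m,2)$ phase*) is a phase contained in $\{\tau<\varepsilon^3\}$ all of whose optimizers are $B(m,1)$ (respectively $C(m,2)$) graphons. There is a *continuous transition* from a $B(m,1)$ phase $U$ to a $C(m,2)$ phase $V$ at $(\varepsilon_0,\tau_0)$ if $(\varepsilon_0,\tau_0)$ is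 a common boundary point of $U$ and $V$ and there is a $B(m,1)$ graphon $g_0$ such that $\delta(g_{\varepsilon,\tau},g_0)\to0$ as $(\varepsilon,\tau)\to(\varepsilon_0,\tau_0)$ within $U\cup V$. **Theorem.** For every $m\ge1$ there is a finite set $F\subset\mathbb R$ such that there is no continuous transition from a $B(m,1)$ phase to a $C(m,2)$ phase at any point $(\varepsilon_0,\tau_0)$ with $\varepsilon_0\notin F$. -/

import Mathlib

open MeasureTheory Set Filter Topology
open scoped unitInterval

noncomputable section

/-- A graphon: a symmetric measurable function on `[0,1]²` with values in `[0,1]`. -/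
structure Graphon where
  toFun : I → I → ℝ
  measurable' : Measurable (Function.uncurry toFun)
  symm' : ∀ x y, toFun x y = toFun y x
  nonneg' : ∀ x y, 0 ≤ toFun x y
  le_one' : ∀ x y, toFun x y ≤ 1

namespace Graphon

/-- The cut metric `sup_{S,T} |∫_{S×T} (f - g)|` on functions on `[0,1]²`. -/
def cutMetric (f g : I → I → ℝ) : ℝ :=
  sSup {r : ℝ | ∃ S T : Set I, MeasurableSet S ∧ MeasurableSet T ∧
    r = |∫ x in S, ∫ y in T, (f x y - g x y)|}

/-- The cut metric on reduced graphons: the infimum of the cut metric over all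
representatives `f(φ x, φ y)` and `g(ψ x, ψ y)`, with `φ`, `ψ` measure preserving
transformations of `[0,1]`. -/
def cutDist (f g : Graphon) : ℝ :=
  sInf {r : ℝ | ∃ φ ψ : I → I, MeasurePreserving φ volume volume ∧
    MeasurePreserving ψ volume volume ∧
    r = cutMetric (fun x y => f.toFun (φ x) (φ y)) (fun x y => g.toFun (ψ x) (ψ y))}

/-- Two graphons are equivalent (define the same reduced graphon) when their distance is `0`. -/
def Equivalent (f g : Graphon) : Prop := cutDist f g = 0

/-- The edge density `ε(g)`. -/
def edgeDensity (g : Graphon) : ℝ := ∫ x, ∫ y, g.toFun x y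

/-- The triangle density `τ(g)`. -/
def triangleDensity (g : Graphon) : ℝ :=
  ∫ x, ∫ y, ∫ z, g.toFun x y * g.toFun y z * g.toFun z x

open Classical in
/-- The density `t_H(g)` of a finite simple graph `H`; every edge of `H` occurs once,
as the pair `(i, j)` of its end points with `i < j`. -/
def homDensity {k : ℕ} (H : SimpleGraph (Fin k)) (g : Graphon) : ℝ :=
  ∫ x : Fin k → I,
    ∏ e ∈ Finset.univ.filter (fun e : Fin k × Fin k => e.1 < e.2 ∧ H.Adj e.1 e.2),
      g.toFun (x e.1) (x e.2)

/-- The graphon entropy `S(g)`. -/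
def entropy (g : Graphon) : ℝ :=
  -(1 / 2) * ∫ x, ∫ y, (g.toFun x y * Real.log (g.toFun x y) +
    (1 - g.toFun x y) * Real.log (1 - g.toFun x y))

/-- `g` maximizes the entropy among all graphons with edge density `x.1` and
triangle density `x.2`. -/
def IsOptimizer (g : Graphon) (x : ℝ × ℝ) : Prop :=
  g.edgeDensity = x.1 ∧ g.triangleDensity = x.2 ∧
    ∀ h : Graphon, h.edgeDensity = x.1 → h.triangleDensity = x.2 → h.entropy ≤ g.entropy

/-- `g` is multipodal: the nodes are partitioned into podes `κ ⁻¹' {i}` of sizes `w i`, and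
the value of `g` between the podes `i` and `j` is `P i j`. -/
def IsMultipodal {ι : Type} (g : Graphon) (w : ι → ℝ) (P : ι → ι → ℝ) : Prop :=
  ∃ κ : I → ι, (∀ i, MeasurableSet (κ ⁻¹' {i})) ∧
    (∀ i, (volume : Measure I).real (κ ⁻¹' {i}) = w i) ∧
    ∀ᵐ z : I × I, g.toFun z.1 z.2 = P (κ z.1) (κ z.2)

/-- An `A(n,0)` graphon: `n` podes of size `1/n`, where the value between two podes only
depends on whether they coincide. -/
def IsTypeA (n : ℕ) (g : Graphon) : Prop :=
  ∃ u v : ℝ, IsMultipodal g (fun _ : Fin n => 1 / (n : ℝ)) (fun i j => if i = j then u else v)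

/-- Sizes of the podes: `r` podes share the mass `c` equally and `m` podes share the mass
`1 - c` equally. -/
def podeSize (r m : ℕ) (c : ℝ) : Fin r ⊕ Fin m → ℝ
  | Sum.inl _ => c / r
  | Sum.inr _ => (1 - c) / m

/-- Values between podes, for `r` interchangeable podes and `m` other interchangeable podes:
`a₁` on a pode of the first group, `a₂` between two podes of the first group,
`d` between the groups, `b` on a pode of the second group,
`p` between two podes of the second group. -/
def podeValue (r m : ℕ) (a₁ a₂ d b p : ℝ) : Fin r ⊕ Fin m → Fin r ⊕ Fin m → ℝ
  | Sum.inl i, Sum.inl j => if i = j then a₁ else a₂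
  | Sum.inl _, Sum.inr _ => d
  | Sum.inr _, Sum.inl _ => d
  | Sum.inr i, Sum.inr j => if i = j then b else p

/-- `g` has `m` interchangeable podes plus another `r` interchangeable podes. Injectivity says
that no two podes have the same edge probabilities, so that `g` really has `m + r` podes, and
the last clause that the `m + r` podes are not all equivalent. -/
def HasPodalStructure (m r : ℕ) (g : Graphon) : Prop :=
  ∃ c a₁ a₂ d b p : ℝ, 0 < c ∧ c < 1 ∧
    Function.Injective (podeValue r m a₁ a₂ d b p) ∧
    IsMultipodal g (podeSize r m c) (podeValue r m a₁ a₂ d b p) ∧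
    ¬ IsTypeA (m + r) g

/-- A `B(m,1)` graphon: `m` equivalent podes plus one other. -/
def IsTypeB (m : ℕ) (g : Graphon) : Prop := HasPodalStructure m 1 g

/-- A `C(m,2)` graphon: `m` equivalent podes plus another equivalent pair of podes. -/
def IsTypeC (m : ℕ) (g : Graphon) : Prop := HasPodalStructure m 2 g

/-- A phase: a connected open set of achievable pairs (edge density, triangle density) in which
the optimizer is unique as a reduced graphon and varies analytically, that is, the
densities of all finite graphs in it are analytic functions of the pair. -/
def IsPhase (U : Set (ℝ × ℝ)) : Prop :=
  IsOpen U ∧ IsConnected U ∧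
    ∃ G : ℝ × ℝ → Graphon,
      (∀ x ∈ U, IsOptimizer (G x) x ∧ ∀ h, IsOptimizer h x → Equivalent h (G x)) ∧
      ∀ (k : ℕ) (H : SimpleGraph (Fin k)), AnalyticOnNhd ℝ (fun x => homDensity H (G x)) U

/-- A `B(m,1)` phase: a phase in the region `τ < ε³` in which the optimizers are
`B(m,1)` graphons. -/
def IsPhaseB (m : ℕ) (U : Set (ℝ × ℝ)) : Prop :=
  IsPhase U ∧ (∀ x ∈ U, x.2 < x.1 ^ 3) ∧ ∀ x ∈ U, ∀ g, IsOptimizer g x → IsTypeB m g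

/-- A `C(m,2)` phase: a phase in the region `τ < ε³` in which the optimizers are
`C(m,2)` graphons. -/
def IsPhaseC (m : ℕ) (U : Set (ℝ × ℝ)) : Prop :=
  IsPhase U ∧ (∀ x ∈ U, x.2 < x.1 ^ 3) ∧ ∀ x ∈ U, ∀ g, IsOptimizer g x → IsTypeC m g

/-- The transition between `U` and `V` at their common boundary point `x₀` is continuous with
limit state `g₀`: the optimizers on both sides converge to `g₀` in the cut metric on
reduced graphons as `x → x₀`. -/
def IsContinuousTransition (U V : Set (ℝ × ℝ)) (x₀ : ℝ × ℝ) (g₀ : Graphon) : Prop :=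
  x₀ ∈ frontier U ∧ x₀ ∈ frontier V ∧
    ∀ η > 0, ∀ᶠ x in 𝓝[U ∪ V] x₀, ∀ g, IsOptimizer g x → cutDist g g₀ < η

end Graphon

end

/-!
A `C(m,2)` graphon can only approach a `B(m,1)` graphon by the merging of two equivalent podes.
This is excluded as follows. Below the curve `τ = ε³`, interpolating towards a constant graphon
raises the triangle density at no cost in entropy. Hence, for fixed `ε`, the maximal entropy is
monotone in `τ`, so it is differentiable at almost every `τ`, and there an optimizer `g` satisfies
the Euler–Lagrange equation `S'(g(x, y)) = A + B ∫ g(x, z) g(z, y) dz` with `B ≥ 0`. Let `g` have a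
pair of podes whose inner and mutual values differ by `δ`. The left-hand sides for these two values
differ by at least a multiple of `δ`, the integrals only by a multiple of `δ²`. When the pair
merges, `δ → 0`, so `B → ∞`, and the limit is a stationary point of the triangle density alone. This
leaves a few explicit families, and in each of them the entropy can be raised without adding
triangles: moving the two values on the pair apart by `r` removes a multiple of `r³` triangles, and
this pays for averaging block values or for changing the mass of the pair.
-/

noncomputable section

open Real (binEntropy log)

/-- The amount `H ((1 - t) x + t e) - ((1 - t) H x + t H e)` by which the binary entropy `H`
exceeds its chord between `x` and `e`. -/
def binEntropyGap (x e t : ℝ) : ℝ :=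
  binEntropy ((1 - t) * x + t * e) - ((1 - t) * binEntropy x + t * binEntropy e)

theorem convexComb_mem_Icc {x e t : ℝ} (hx : x ∈ Icc (0 : ℝ) 1) (he : e ∈ Icc (0 : ℝ) 1)
    (ht : t ∈ Icc (0 : ℝ) 1) : (1 - t) * x + t * e ∈ Icc (0 : ℝ) 1 :=
  convex_Icc 0 1 hx he (sub_nonneg.2 ht.2) ht.1 (sub_add_cancel 1 t)

theorem binEntropyGap_nonneg {x e t : ℝ} (hx : x ∈ Icc (0 : ℝ) 1) (he : e ∈ Icc (0 : ℝ) 1)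
    (ht : t ∈ Icc (0 : ℝ) 1) : 0 ≤ binEntropyGap x e t :=
  sub_nonneg.2 <| Real.strictConcave_binEntropy.concaveOn.2 hx he (sub_nonneg.2 ht.2) ht.1
    (sub_add_cancel 1 t)

theorem binEntropyGap_one_sub (x e t : ℝ) :
    binEntropyGap (1 - x) (1 - e) t = binEntropyGap x e t := by
  rw [binEntropyGap, binEntropyGap, Real.binEntropy_one_sub, Real.binEntropy_one_sub,
    ← Real.binEntropy_one_sub ((1 - t) * x + t * e)]
  ring_nf

theorem eventually_mul_lt_binEntropy (C : ℝ) : ∀ᶠ x in 𝓝[>] (0 : ℝ), C * x < binEntropy x := by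
  have hlog : ∀ᶠ x in 𝓝[>] (0 : ℝ), log x < -C :=
    Real.tendsto_log_nhdsGT_zero.eventually (eventually_lt_atBot _)
  filter_upwards [hlog, Ioo_mem_nhdsGT one_pos] with x hx ⟨hx0, hx1⟩
  have hone : 0 ≤ Real.negMulLog (1 - x) := Real.negMulLog_nonneg (by linarith) (by linarith)
  have hmul : x * C < x * -log x := mul_lt_mul_of_pos_left (by linarith) hx0
  rw [Real.binEntropy_eq_negMulLog_add_negMulLog_one_sub, Real.negMulLog]
  linarith

theorem eventually_mul_lt_binEntropyGap_zero {e : ℝ} (he : 0 < e) (C : ℝ) :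
    ∀ᶠ t in 𝓝[>] (0 : ℝ), C * t < binEntropyGap 0 e t := by
  have hte : Tendsto (fun t : ℝ => t * e) (𝓝[>] 0) (𝓝[>] 0) := by
    refine tendsto_nhdsWithin_iff.2 ⟨?_, ?_⟩
    · simpa using (tendsto_id.mul_const e : Tendsto (fun t : ℝ => t * e) (𝓝 0) _).mono_left
        nhdsWithin_le_nhds
    · filter_upwards [self_mem_nhdsWithin] with t ht using mul_pos ht he
  filter_upwards [hte.eventually (eventually_mul_lt_binEntropy ((C + binEntropy e) / e))] with t ht
  have hcancel : (C + binEntropy e) / e * (t * e) = (C + binEntropy e) * t := by field_simp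
  simp only [binEntropyGap, mul_zero, zero_add, Real.binEntropy_zero]
  linarith

theorem eventually_mul_lt_binEntropyGap {x e : ℝ} (hx : x = 0 ∨ x = 1) (he : e ∈ Ioo (0 : ℝ) 1)
    (C : ℝ) : ∀ᶠ t in 𝓝[>] (0 : ℝ), C * t < binEntropyGap x e t := by
  rcases hx with rfl | rfl
  · exact eventually_mul_lt_binEntropyGap_zero he.1 C
  · simpa [← binEntropyGap_one_sub 1 e] using
      eventually_mul_lt_binEntropyGap_zero (sub_pos.2 he.2) C

/-- The parameters of a graphon with a pair of interchangeable podes of total mass `θ.1` and a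
second group of interchangeable podes of total mass `1 - θ.1`. The entries of `θ.2` are the values
on the five kinds of blocks: on a pode of the pair, between the podes of the pair, between the
groups, on a pode of the second group, and between two podes of the second group. The admissible
parameters form the box `Icc 0 1`. -/
abbrev Shape : Type := ℝ × (Fin 5 → ℝ)

namespace Shape

/-- The total mass of the pair of podes. -/
abbrev c (θ : Shape) : ℝ := θ.1

/-- The values on the five kinds of blocks. -/
abbrev val (θ : Shape) : Fin 5 → ℝ := θ.2

/-- The total measures of the five kinds of blocks, for a second group of `m` podes. -/
def weight (m : ℕ) (c : ℝ) : Fin 5 → ℝ :=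
  ![c ^ 2 / 2, c ^ 2 / 2, 2 * c * (1 - c), (1 - c) ^ 2 / m, (1 - c) ^ 2 * (m - 1) / m]

/-- The derivative of `weight` in the mass of the pair. -/
def weightDeriv (m : ℕ) (c : ℝ) : Fin 5 → ℝ :=
  ![c, c, 2 * (1 - 2 * c), -2 * (1 - c) / m, -2 * (1 - c) * (m - 1) / m]

/-- The values of `∫ g(x, z) g(z, y) dz` on the five kinds of blocks. -/
def codegree (m : ℕ) (θ : Shape) : Fin 5 → ℝ :=
  ![θ.c * (θ.val 0 ^ 2 + θ.val 1 ^ 2) / 2 + (1 - θ.c) * θ.val 2 ^ 2,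
    θ.c * θ.val 0 * θ.val 1 + (1 - θ.c) * θ.val 2 ^ 2,
    θ.val 2 * (θ.c * (θ.val 0 + θ.val 1) / 2 + (1 - θ.c) * (θ.val 3 + (m - 1) * θ.val 4) / m),
    θ.c * θ.val 2 ^ 2 + (1 - θ.c) * (θ.val 3 ^ 2 + (m - 1) * θ.val 4 ^ 2) / m,
    θ.c * θ.val 2 ^ 2 + (1 - θ.c) * (2 * θ.val 3 * θ.val 4 + (m - 2) * θ.val 4 ^ 2) / m]

/-- The edge density of the graphons with parameters `θ`. -/
def edge (m : ℕ) (θ : Shape) : ℝ := ∑ j, weight m θ.c j * θ.val j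

/-- The triangle density of the graphons with parameters `θ`, as the integral of the product of
the value and the codegree. -/
def tri (m : ℕ) (θ : Shape) : ℝ := ∑ j, weight m θ.c j * (θ.val j * θ.codegree m j)

/-- The entropy of the graphons with parameters `θ`. -/
def ent (m : ℕ) (θ : Shape) : ℝ := 1 / 2 * ∑ j, weight m θ.c j * binEntropy (θ.val j)

/-- Interpolation of all block values towards the constant `e`. -/
def mix (θ : Shape) (e t : ℝ) : Shape := (θ.c, fun j => (1 - t) * θ.val j + t * e)

variable {m : ℕ} {θ : Shape} {e t : ℝ}

theorem c_mem (hθ : θ ∈ Icc (0 : Shape) 1) : θ.c ∈ Icc (0 : ℝ) 1 := ⟨hθ.1.1, hθ.2.1⟩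

theorem val_mem (hθ : θ ∈ Icc (0 : Shape) 1) (j : Fin 5) : θ.val j ∈ Icc (0 : ℝ) 1 :=
  ⟨hθ.1.2 j, hθ.2.2 j⟩

theorem mem_Icc (hc : θ.c ∈ Icc (0 : ℝ) 1) (hv : ∀ j, θ.val j ∈ Icc (0 : ℝ) 1) :
    θ ∈ Icc (0 : Shape) 1 :=
  ⟨⟨hc.1, fun j => (hv j).1⟩, ⟨hc.2, fun j => (hv j).2⟩⟩

theorem weight_nonneg (hm : 1 ≤ m) {c : ℝ} (hc : c ∈ Icc (0 : ℝ) 1) (j : Fin 5) :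
    0 ≤ weight m c j := by
  have hc0 : 0 ≤ c := hc.1
  have hc1 : 0 ≤ 1 - c := sub_nonneg.2 hc.2
  have hm1 : (0 : ℝ) ≤ m - 1 := sub_nonneg.2 (by exact_mod_cast hm)
  fin_cases j <;> dsimp [weight] <;> positivity

theorem weight_pos (hm : 1 ≤ m) {c : ℝ} (hc : c ∈ Ioo (0 : ℝ) 1) {j : Fin 5}
    (hj : j ≠ 4 ∨ 2 ≤ m) : 0 < weight m c j := by
  have : (0 : ℝ) < m := by positivity
  have hc0 : 0 < c := hc.1
  have hc1 : 0 < 1 - c := sub_pos.2 hc.2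
  have hm1 : j = 4 → (0 : ℝ) < m - 1 := fun h =>
    sub_pos.2 (by exact_mod_cast hj.resolve_left (not_not_intro h))
  fin_cases j <;> dsimp [weight] at * <;> (try have := hm1 rfl) <;> positivity

theorem sum_weight (hm : 1 ≤ m) (c : ℝ) : ∑ j, weight m c j = 1 := by
  have : (m : ℝ) ≠ 0 := by positivity
  simp only [Fin.sum_univ_five, weight, Matrix.cons_val]
  field_simp
  ring

theorem edge_mem (hm : 1 ≤ m) (hθ : θ ∈ Icc (0 : Shape) 1) : θ.edge m ∈ Icc (0 : ℝ) 1 :=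
  (convex_Icc (0 : ℝ) 1).sum_mem (fun j _ => weight_nonneg hm (c_mem hθ) j) (sum_weight hm θ.c)
    fun j _ => val_mem hθ j

theorem codegree_nonneg (hm : 1 ≤ m) (hθ : θ ∈ Icc (0 : Shape) 1) {j : Fin 5}
    (hj : j ≠ 4 ∨ 2 ≤ m) : 0 ≤ θ.codegree m j := by
  have hc0 : 0 ≤ θ.c := (c_mem hθ).1
  have hc1 : 0 ≤ 1 - θ.c := sub_nonneg.2 (c_mem hθ).2
  have hv : ∀ i, 0 ≤ θ.val i := fun i => (val_mem hθ i).1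
  have h0 := hv 0
  have h1 := hv 1
  have h2 := hv 2
  have h3 := hv 3
  have h4 := hv 4
  have hm1 : (0 : ℝ) ≤ m - 1 := sub_nonneg.2 (by exact_mod_cast hm)
  have hm2 : j = 4 → (0 : ℝ) ≤ m - 2 := fun h =>
    sub_nonneg.2 (by exact_mod_cast hj.resolve_left (not_not_intro h))
  fin_cases j <;> dsimp [codegree] at * <;> (try have := hm2 rfl) <;> positivity

theorem tri_nonneg (hm : 1 ≤ m) (hθ : θ ∈ Icc (0 : Shape) 1) : 0 ≤ θ.tri m := by
  refine Finset.sum_nonneg fun j _ => ?_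
  by_cases hj : j ≠ 4 ∨ 2 ≤ m
  · exact mul_nonneg (weight_nonneg hm (c_mem hθ) j)
      (mul_nonneg (val_mem hθ j).1 (codegree_nonneg hm hθ hj))
  · obtain ⟨rfl, rfl⟩ : j = 4 ∧ m = 1 := ⟨not_not.1 (not_or.1 hj).1, by omega⟩
    simp [weight]

theorem ent_le_binEntropy_edge (hm : 1 ≤ m) (hθ : θ ∈ Icc (0 : Shape) 1) :
    θ.ent m ≤ binEntropy (θ.edge m) / 2 := by
  have hjensen := Real.strictConcave_binEntropy.concaveOn.le_map_sum (t := Finset.univ)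
    (fun j _ => weight_nonneg hm (c_mem hθ) j) (sum_weight hm θ.c) (fun j _ => val_mem hθ j)
  simp only [smul_eq_mul] at hjensen
  rw [ent, edge]
  linarith

theorem mix_mem (hθ : θ ∈ Icc (0 : Shape) 1) (he : e ∈ Icc (0 : ℝ) 1) (ht : t ∈ Icc (0 : ℝ) 1) :
    θ.mix e t ∈ Icc (0 : Shape) 1 :=
  mem_Icc (θ := θ.mix e t) (c_mem hθ :) fun j => convexComb_mem_Icc (val_mem hθ j) he ht

theorem mix_zero (θ : Shape) (e : ℝ) : θ.mix e 0 = θ := by simp [mix]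

theorem edge_mix (hm : 1 ≤ m) (θ : Shape) (e t : ℝ) :
    (θ.mix e t).edge m = (1 - t) * θ.edge m + t * e := by
  calc (θ.mix e t).edge m
      = (1 - t) * θ.edge m + t * e * ∑ j, weight m θ.c j := by
        simp only [edge, mix, Finset.mul_sum, ← Finset.sum_add_distrib]
        exact Finset.sum_congr rfl fun j _ => by ring
    _ = _ := by rw [sum_weight hm, mul_one]

theorem ent_mix (hm : 1 ≤ m) (θ : Shape) (e t : ℝ) :
    (θ.mix e t).ent m = (1 - t) * θ.ent m + t * (binEntropy e / 2) +
      1 / 2 * ∑ j, weight m θ.c j * binEntropyGap (θ.val j) e t := by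
  calc (θ.mix e t).ent m
      = (1 - t) * θ.ent m + t * (binEntropy e / 2) * ∑ j, weight m θ.c j +
          1 / 2 * ∑ j, weight m θ.c j * binEntropyGap (θ.val j) e t := by
        simp only [ent, mix, Finset.mul_sum, ← Finset.sum_add_distrib, binEntropyGap]
        exact Finset.sum_congr rfl fun j _ => by ring
    _ = _ := by rw [sum_weight hm, mul_one]

theorem le_ent_mix_edge (hm : 1 ≤ m) (hθ : θ ∈ Icc (0 : Shape) 1) (ht : t ∈ Icc (0 : ℝ) 1)
    (j : Fin 5) :
    θ.ent m + 1 / 2 * (weight m θ.c j * binEntropyGap (θ.val j) (θ.edge m) t) ≤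
      (θ.mix (θ.edge m) t).ent m := by
  have hgap : ∀ i, 0 ≤ weight m θ.c i * binEntropyGap (θ.val i) (θ.edge m) t := fun i =>
    mul_nonneg (weight_nonneg hm (c_mem hθ) i)
      (binEntropyGap_nonneg (val_mem hθ i) (edge_mem hm hθ) ht)
  have hsingle := Finset.single_le_sum (fun i _ => hgap i) (Finset.mem_univ j)
  have hconst := mul_nonneg ht.1 (sub_nonneg.2 (ent_le_binEntropy_edge hm hθ))
  rw [ent_mix hm]
  linarith

theorem tri_mix_one (hm : 1 ≤ m) (θ : Shape) (e : ℝ) : (θ.mix e 1).tri m = e ^ 3 := by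
  have : (m : ℝ) ≠ 0 := by positivity
  simp only [tri, mix, Fin.sum_univ_five, weight, codegree, Matrix.cons_val]
  field_simp
  ring

theorem contDiff_edge (m : ℕ) : ContDiff ℝ ⊤ (edge m) := by
  unfold edge
  simp only [Fin.sum_univ_five, weight, Matrix.cons_val, div_eq_mul_inv]
  fun_prop

theorem contDiff_tri (m : ℕ) : ContDiff ℝ ⊤ (tri m) := by
  unfold tri
  simp only [Fin.sum_univ_five, weight, codegree, Matrix.cons_val, div_eq_mul_inv]
  fun_prop

theorem continuous_ent (m : ℕ) : Continuous (ent m) := by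
  unfold ent
  simp only [Fin.sum_univ_five, weight, Matrix.cons_val, div_eq_mul_inv]
  fun_prop

theorem contDiff_mix (θ : Shape) (e : ℝ) : ContDiff ℝ ⊤ (θ.mix e) := by
  unfold mix
  fun_prop

/-- Below the curve `τ = ε³`, interpolating towards a constant graphon raises the triangle density
at no cost in entropy. -/
theorem exists_tri_eq (hm : 1 ≤ m) (hθ : θ ∈ Icc (0 : Shape) 1) {τ : ℝ} (hle : θ.tri m ≤ τ)
    (hlt : τ ≤ θ.edge m ^ 3) :
    ∃ θ' ∈ Icc (0 : Shape) 1, θ'.edge m = θ.edge m ∧ θ'.tri m = τ ∧ θ.ent m ≤ θ'.ent m := by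
  have hcont := ((contDiff_tri m).comp (contDiff_mix θ (θ.edge m))).continuous.continuousOn
    (s := Icc 0 1)
  obtain ⟨t, ht, hτ⟩ := intermediate_value_Icc zero_le_one hcont
    (show τ ∈ Icc _ _ by
      simpa only [Function.comp_apply, mix_zero, tri_mix_one hm] using ⟨hle, hlt⟩)
  refine ⟨_, mix_mem hθ (edge_mem hm hθ) ht, by rw [edge_mix hm]; ring, hτ, ?_⟩
  refine le_trans ?_ (le_ent_mix_edge hm hθ ht 0)
  exact le_add_of_nonneg_right <| mul_nonneg one_half_pos.le <|
    mul_nonneg (weight_nonneg hm (c_mem hθ) 0)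
      (binEntropyGap_nonneg (val_mem hθ 0) (edge_mem hm hθ) ht)

end Shape

/-! ### Euler–Lagrange equations -/

/-- The derivative of the binary entropy. -/
def binEntropyDeriv (v : ℝ) : ℝ := log (1 - v) - log v

theorem hasDerivAt_binEntropy {v : ℝ} (hv : v ∈ Ioo (0 : ℝ) 1) :
    HasDerivAt binEntropy (binEntropyDeriv v) v :=
  Real.hasDerivAt_binEntropy hv.1.ne' hv.2.ne

theorem exists_eq_smul_of_isLocalMinOn_level {E : Type*} [NormedAddCommGroup E] [NormedSpace ℝ E]
    [CompleteSpace E] {f φ : E → ℝ} {f' φ' : E →L[ℝ] ℝ} {x₀ : E}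
    (hmin : IsLocalMinOn φ {x | f x = f x₀} x₀) (hf : HasStrictFDerivAt f f' x₀) (hf0 : f' ≠ 0)
    (hφ : HasFDerivAt φ φ' x₀) : ∃ Λ : ℝ, φ' = Λ • f' := by
  have hsurj : f'.range = ⊤ := LinearMap.range_eq_top.2 <|
    LinearMap.surjective (f := f'.toLinearMap) fun h => hf0 (ContinuousLinearMap.coe_injective h)
  set γ := hf.implicitFunction f f' hsurj (f x₀)
  have hγ0 : γ 0 = x₀ := hf.implicitFunction_apply_image hsurj
  have hγ : HasFDerivAt γ f'.ker.subtypeL 0 := (hf.to_implicitFunction hsurj).hasFDerivAt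
  have hlevel : ∀ᶠ y in 𝓝 0, f (γ y) = f x₀ := by
    have hpair : Tendsto (fun y : f'.ker => (f x₀, y)) (𝓝 0) (𝓝 (f x₀, 0)) :=
      (Continuous.prodMk_right (f x₀)).tendsto 0
    exact hpair.eventually (hf.map_implicitFunction_eq hsurj)
  have hmin' : IsLocalMin (φ ∘ γ) 0 := by
    have htendsto : Tendsto γ (𝓝 0) (𝓝[{x | f x = f x₀}] x₀) :=
      tendsto_nhdsWithin_iff.2 ⟨by simpa only [hγ0] using hγ.continuousAt.tendsto, hlevel⟩
    simpa only [IsLocalMin, IsMinFilter, Function.comp_apply, hγ0] using htendsto.eventually hmin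
  have hker : φ'.comp f'.ker.subtypeL = 0 :=
    hmin'.hasFDerivAt_eq_zero (HasFDerivAt.comp 0 (by rwa [hγ0]) hγ)
  obtain ⟨v, hv⟩ : ∃ v, f' v = 1 := LinearMap.range_eq_top.1 hsurj 1
  refine ⟨φ' v, ContinuousLinearMap.ext fun w => ?_⟩
  have hw : w - f' w • v ∈ f'.ker := by simp [hv]
  have := DFunLike.congr_fun hker ⟨_, hw⟩
  simp only [ContinuousLinearMap.comp_apply, Submodule.subtypeL_apply, map_sub, map_smul,
    smul_eq_mul, zero_apply] at this
  simpa [mul_comm] using sub_eq_zero.1 this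

namespace Shape

variable {m : ℕ} {θ : Shape}

theorem hasDerivAt_weight (m : ℕ) (c : ℝ) (j : Fin 5) :
    HasDerivAt (fun c => weight m c j) (weightDeriv m c j) c := by
  have hc := hasDerivAt_id c
  have hc' := hc.const_sub 1
  fin_cases j
  · exact ((hc.pow 2).div_const 2).congr_deriv (by simp [weightDeriv])
  · exact ((hc.pow 2).div_const 2).congr_deriv (by simp [weightDeriv])
  · exact ((hc.const_mul 2).mul hc').congr_deriv (by simp [weightDeriv]; ring)
  · exact ((hc'.pow 2).div_const (m : ℝ)).congr_deriv (by simp [weightDeriv])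
  · exact (((hc'.pow 2).mul_const ((m : ℝ) - 1)).div_const (m : ℝ)).congr_deriv
      (by simp [weightDeriv])

theorem hasLineDerivAt_c (θ k : Shape) : HasLineDerivAt ℝ c k.c θ k := by
  simpa [HasLineDerivAt] using ((hasDerivAt_id (0 : ℝ)).mul_const k.c).const_add θ.c

theorem hasLineDerivAt_weight (m : ℕ) (θ k : Shape) (j : Fin 5) :
    HasLineDerivAt ℝ (fun θ : Shape => weight m θ.c j) (k.c * weightDeriv m θ.c j) θ k := by
  have hw : HasDerivAt (fun c => weight m c j) (weightDeriv m θ.c j) (θ + (0 : ℝ) • k).c := by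
    simpa using hasDerivAt_weight m θ.c j
  exact (hw.comp 0 (hasLineDerivAt_c θ k)).congr_deriv (mul_comm _ _)

theorem hasLineDerivAt_val (θ k : Shape) (j : Fin 5) :
    HasLineDerivAt ℝ (fun θ : Shape => θ.val j) (k.val j) θ k := by
  simpa [HasLineDerivAt] using ((hasDerivAt_id (0 : ℝ)).mul_const (k.val j)).const_add (θ.val j)

theorem hasLineDerivAt_sum_weight_mul {f : Fin 5 → Shape → ℝ} {f' : Fin 5 → ℝ} {k : Shape}
    (m : ℕ) (hf : ∀ j, HasLineDerivAt ℝ (f j) (f' j) θ k) :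
    HasLineDerivAt ℝ (fun θ : Shape => ∑ j, weight m θ.c j * f j θ)
      (k.c * ∑ j, weightDeriv m θ.c j * f j θ + ∑ j, weight m θ.c j * f' j) θ k := by
  have := HasDerivAt.fun_sum fun j (_ : j ∈ Finset.univ) =>
    HasDerivAt.fun_mul (hasLineDerivAt_weight m θ k j) (hf j)
  refine this.congr_deriv ?_
  simp only [zero_smul, add_zero, Finset.sum_add_distrib, Finset.mul_sum, mul_assoc]

theorem hasLineDerivAt_edge (m : ℕ) (θ k : Shape) :
    HasLineDerivAt ℝ (edge m)
      (k.c * ∑ j, weightDeriv m θ.c j * θ.val j + ∑ j, weight m θ.c j * k.val j) θ k :=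
  hasLineDerivAt_sum_weight_mul m (hasLineDerivAt_val θ k)

theorem hasLineDerivAt_ent (m : ℕ) (hv : ∀ j, θ.val j ∈ Ioo (0 : ℝ) 1) (k : Shape) :
    HasLineDerivAt ℝ (ent m)
      (1 / 2 * (k.c * ∑ j, weightDeriv m θ.c j * binEntropy (θ.val j) +
        ∑ j, weight m θ.c j * (binEntropyDeriv (θ.val j) * k.val j))) θ k := by
  have hH : ∀ j, HasLineDerivAt ℝ (fun θ : Shape => binEntropy (θ.val j))
      (binEntropyDeriv (θ.val j) * k.val j) θ k := fun j =>
    HasDerivAt.comp (h₂ := binEntropy) 0 (by simpa using hasDerivAt_binEntropy (hv j))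
      (hasLineDerivAt_val θ k j)
  exact HasDerivAt.const_mul (1 / 2 : ℝ) (hasLineDerivAt_sum_weight_mul m hH)

/-- The derivative of `codegree` in the direction `k`. -/
def codegreeDeriv (m : ℕ) (θ k : Shape) : Fin 5 → ℝ :=
  ![k.c * ((θ.val 0 ^ 2 + θ.val 1 ^ 2) / 2 - θ.val 2 ^ 2) +
      θ.c * (θ.val 0 * k.val 0 + θ.val 1 * k.val 1) + (1 - θ.c) * (2 * θ.val 2 * k.val 2),
    k.c * (θ.val 0 * θ.val 1 - θ.val 2 ^ 2) +
      θ.c * (k.val 0 * θ.val 1 + θ.val 0 * k.val 1) + (1 - θ.c) * (2 * θ.val 2 * k.val 2),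
    k.val 2 * (θ.c * (θ.val 0 + θ.val 1) / 2 + (1 - θ.c) * (θ.val 3 + (m - 1) * θ.val 4) / m) +
      θ.val 2 * (k.c * ((θ.val 0 + θ.val 1) / 2 - (θ.val 3 + (m - 1) * θ.val 4) / m) +
        θ.c * (k.val 0 + k.val 1) / 2 + (1 - θ.c) * (k.val 3 + (m - 1) * k.val 4) / m),
    k.c * (θ.val 2 ^ 2 - (θ.val 3 ^ 2 + (m - 1) * θ.val 4 ^ 2) / m) +
      θ.c * (2 * θ.val 2 * k.val 2) +
      (1 - θ.c) * (2 * θ.val 3 * k.val 3 + (m - 1) * (2 * θ.val 4 * k.val 4)) / m,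
    k.c * (θ.val 2 ^ 2 - (2 * θ.val 3 * θ.val 4 + (m - 2) * θ.val 4 ^ 2) / m) +
      θ.c * (2 * θ.val 2 * k.val 2) +
      (1 - θ.c) * (2 * (k.val 3 * θ.val 4 + θ.val 3 * k.val 4) +
        (m - 2) * (2 * θ.val 4 * k.val 4)) / m]

theorem hasLineDerivAt_codegree (m : ℕ) (θ k : Shape) (j : Fin 5) :
    HasLineDerivAt ℝ (fun θ : Shape => θ.codegree m j) (codegreeDeriv m θ k j) θ k := by
  have hc : HasDerivAt (fun t : ℝ => (θ + t • k).c) k.c 0 := hasLineDerivAt_c θ k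
  have hc' := hc.const_sub 1
  have hv : ∀ j, HasDerivAt (fun t : ℝ => (θ + t • k).val j) (k.val j) 0 := hasLineDerivAt_val θ k
  have hrow := (hv 3).fun_add ((hv 4).const_mul ((m : ℝ) - 1))
  fin_cases j
  · refine ((((hc.fun_mul (((hv 0).fun_pow 2).fun_add ((hv 1).fun_pow 2))).div_const 2).fun_add
      (hc'.fun_mul ((hv 2).fun_pow 2)))).congr_deriv ?_
    simp [codegreeDeriv]
    ring
  · refine (((hc.fun_mul (hv 0)).fun_mul (hv 1)).fun_add
      (hc'.fun_mul ((hv 2).fun_pow 2))).congr_deriv ?_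
    simp [codegreeDeriv]
    ring
  · refine ((hv 2).fun_mul (((hc.fun_mul ((hv 0).fun_add (hv 1))).div_const 2).fun_add
      ((hc'.fun_mul hrow).div_const (m : ℝ)))).congr_deriv ?_
    simp [codegreeDeriv, -mul_eq_mul_left_iff]
    ring
  · refine ((hc.fun_mul ((hv 2).fun_pow 2)).fun_add ((hc'.fun_mul (((hv 3).fun_pow 2).fun_add
      (((hv 4).fun_pow 2).const_mul ((m : ℝ) - 1)))).div_const (m : ℝ))).congr_deriv ?_
    simp [codegreeDeriv]
    ring
  · refine ((hc.fun_mul ((hv 2).fun_pow 2)).fun_add ((hc'.fun_mul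
      ((((hv 3).const_mul 2).fun_mul (hv 4)).fun_add
        (((hv 4).fun_pow 2).const_mul ((m : ℝ) - 2)))).div_const (m : ℝ))).congr_deriv ?_
    simp [codegreeDeriv]
    ring

theorem sum_weight_mul_codegreeDeriv (m : ℕ) (θ k : Shape) :
    ∑ j, weight m θ.c j * (θ.val j * codegreeDeriv m θ k j) =
      k.c * (1 / 2 * ∑ j, weightDeriv m θ.c j * (θ.val j * θ.codegree m j)) +
        2 * ∑ j, weight m θ.c j * (k.val j * θ.codegree m j) := by
  simp only [Fin.sum_univ_five, weight, weightDeriv, codegree, codegreeDeriv, Matrix.cons_val]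
  ring

theorem hasLineDerivAt_tri (m : ℕ) (θ k : Shape) :
    HasLineDerivAt ℝ (tri m)
      (k.c * (3 / 2 * ∑ j, weightDeriv m θ.c j * (θ.val j * θ.codegree m j)) +
        3 * ∑ j, weight m θ.c j * (k.val j * θ.codegree m j)) θ k := by
  have hprod : ∀ j, HasLineDerivAt ℝ (fun θ : Shape => θ.val j * θ.codegree m j)
      (k.val j * θ.codegree m j + θ.val j * codegreeDeriv m θ k j) θ k := fun j => by
    simpa [HasLineDerivAt] using
      HasDerivAt.fun_mul (hasLineDerivAt_val θ k j) (hasLineDerivAt_codegree m θ k j)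
  refine (hasLineDerivAt_sum_weight_mul m hprod).congr_deriv ?_
  simp only [mul_add, Finset.sum_add_distrib, sum_weight_mul_codegreeDeriv]
  ring

theorem differentiableAt_ent (m : ℕ) (hv : ∀ j, θ.val j ∈ Ioo (0 : ℝ) 1) :
    DifferentiableAt ℝ (ent m) θ := by
  have hH : ∀ j, DifferentiableAt ℝ (fun θ : Shape => binEntropy (θ.val j)) θ := fun j =>
    (hasDerivAt_binEntropy (hv j)).differentiableAt.comp (f := fun θ : Shape => θ.val j) θ
      (by fun_prop)
  have hw : ∀ j, DifferentiableAt ℝ (fun θ : Shape => weight m θ.c j) θ := fun j =>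
    (hasDerivAt_weight m θ.c j).differentiableAt.comp (f := fun θ : Shape => θ.c) θ (by fun_prop)
  exact .const_mul (.fun_sum fun j _ => (hw j).fun_mul (hH j)) _

theorem Icc_mem_nhds (hc : θ.c ∈ Ioo (0 : ℝ) 1) (hv : ∀ j, θ.val j ∈ Ioo (0 : ℝ) 1) :
    Icc (0 : Shape) 1 ∈ 𝓝 θ :=
  Icc_prod_eq (0 : Shape) 1 ▸ prod_mem_nhds (_root_.Icc_mem_nhds hc.1 hc.2)
    (pi_Icc_mem_nhds (fun j => (hv j).1) fun j => (hv j).2)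

/-- Among shapes with edge density `ε`, the entropy is at most `S` up to triangle density `τ`, and
near `τ` it is bounded by a function of the triangle density which takes the value `S` at `τ` and
is differentiable there. For the shape of an optimizer, this holds where the maximal entropy is
differentiable in the triangle density. -/
structure Extremal (m : ℕ) (ε τ S : ℝ) : Prop where
  ent_le : ∀ θ ∈ Icc (0 : Shape) 1, θ.edge m = ε → θ.tri m ≤ τ → θ.ent m ≤ S
  exists_deriv : ∃ (s : ℝ → ℝ) (β : ℝ), 0 ≤ β ∧ HasDerivAt s β τ ∧ s τ = S ∧
    ∀ᶠ t in 𝓝 τ, ∀ θ ∈ Icc (0 : Shape) 1, θ.edge m = ε → θ.tri m = t → θ.ent m ≤ s t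

theorem Extremal.exists_ent_mix_le (hm : 1 ≤ m) (hθ : θ ∈ Icc (0 : Shape) 1)
    (hE : Extremal m (θ.edge m) (θ.tri m) (θ.ent m)) :
    ∃ K, ∀ᶠ t in 𝓝[>] (0 : ℝ), (θ.mix (θ.edge m) t).ent m ≤ θ.ent m + K * t := by
  obtain ⟨s, β, -, hs, hs0, hle⟩ := hE.exists_deriv
  set τ : ℝ → ℝ := fun t => (θ.mix (θ.edge m) t).tri m
  have hτ0 : τ 0 = θ.tri m := by simp only [τ, mix_zero]
  have hτ : HasDerivAt τ (deriv τ 0) 0 :=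
    (((contDiff_tri m).comp (contDiff_mix θ _)).differentiable (by simp) 0).hasDerivAt
  have hsτ : HasDerivAt (s ∘ τ) (β * deriv τ 0) 0 := HasDerivAt.comp 0 (by rwa [hτ0]) hτ
  refine ⟨β * deriv τ 0 + 1, ?_⟩
  have hslope := hsτ.tendsto_slope_zero_right.eventually (eventually_lt_nhds (lt_add_one _))
  have hτlim : Tendsto τ (𝓝[>] 0) (𝓝 (θ.tri m)) :=
    hτ0 ▸ hτ.continuousAt.tendsto.mono_left nhdsWithin_le_nhds
  filter_upwards [hslope, hτlim.eventually hle, Ioo_mem_nhdsGT one_pos] with t hslope hle ht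
  have hent := hle _ (mix_mem hθ (edge_mem hm hθ) (Ioo_subset_Icc_self ht))
    (by rw [edge_mix hm]; ring) rfl
  simp only [zero_add, Function.comp_apply, hτ0, hs0, smul_eq_mul] at hslope
  rw [inv_mul_lt_iff₀ ht.1] at hslope
  linarith

/-- The derivative of the entropy is infinite at `0` and `1`. -/
theorem Extremal.val_mem_Ioo (hm : 1 ≤ m) (hθ : θ ∈ Icc (0 : Shape) 1)
    (hc : θ.c ∈ Ioo (0 : ℝ) 1) (hE : Extremal m (θ.edge m) (θ.tri m) (θ.ent m))
    (he : θ.edge m ∈ Ioo (0 : ℝ) 1) {j : Fin 5} (hj : j ≠ 4 ∨ 2 ≤ m) :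
    θ.val j ∈ Ioo (0 : ℝ) 1 := by
  obtain ⟨K, hK⟩ := hE.exists_ent_mix_le hm hθ
  by_contra hv
  have hv' : θ.val j = 0 ∨ θ.val j = 1 := by
    rcases (val_mem hθ j).1.eq_or_lt with h0 | h0
    · exact .inl h0.symm
    · exact .inr ((val_mem hθ j).2.eq_or_lt.resolve_right fun h1 => hv ⟨h0, h1⟩)
  have hw := weight_pos hm hc hj
  obtain ⟨t, hgap, hK, ht⟩ := ((eventually_mul_lt_binEntropyGap hv' he (2 * K / weight m θ.c j)).and
    (hK.and (Ioo_mem_nhdsGT one_pos))).exists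
  have hmix := le_ent_mix_edge hm hθ (Ioo_subset_Icc_self ht) j
  have hgap' := mul_lt_mul_of_pos_left hgap hw
  have hcancel : weight m θ.c j * (2 * K / weight m θ.c j * t) = 2 * K * t := by field_simp
  linarith

theorem isLocalMinOn_sub_ent {s : ℝ → ℝ} (hθ : Icc (0 : Shape) 1 ∈ 𝓝 θ)
    (hs0 : s (θ.tri m) = θ.ent m)
    (hle : ∀ᶠ t in 𝓝 (θ.tri m), ∀ θ' ∈ Icc (0 : Shape) 1,
      θ'.edge m = θ.edge m → θ'.tri m = t → θ'.ent m ≤ s t) :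
    IsLocalMinOn (fun θ' : Shape => s (θ'.tri m) - θ'.ent m)
      {θ' | θ'.edge m = θ.edge m} θ := by
  have htri := ((contDiff_tri m).continuous.tendsto θ).eventually hle
  filter_upwards [mem_nhdsWithin_of_mem_nhds htri, mem_nhdsWithin_of_mem_nhds hθ,
    self_mem_nhdsWithin] with θ' htri hθ' hedge
  rw [hs0, sub_self]
  exact sub_nonneg.2 (htri θ' hθ' hedge rfl)

/-- The Euler–Lagrange equations. The multipliers are those of the edge and of the triangle
constraint, the latter being six times the derivative of the maximal entropy. -/
theorem Extremal.euler_lagrange (hm : 1 ≤ m) (hE : Extremal m (θ.edge m) (θ.tri m) (θ.ent m))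
    (hc : θ.c ∈ Ioo (0 : ℝ) 1) (hv : ∀ j, θ.val j ∈ Ioo (0 : ℝ) 1) :
    ∃ A B : ℝ, 0 ≤ B ∧
      (∀ j, j ≠ 4 ∨ 2 ≤ m → binEntropyDeriv (θ.val j) = A + B * θ.codegree m j) ∧
      ∑ j, weightDeriv m θ.c j * binEntropy (θ.val j) =
        A * ∑ j, weightDeriv m θ.c j * θ.val j +
          B / 2 * ∑ j, weightDeriv m θ.c j * (θ.val j * θ.codegree m j) := by
  obtain ⟨s, β, hβ, hs, hs0, hle⟩ := hE.exists_deriv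
  have hedge := (contDiff_edge m).contDiffAt.hasStrictFDerivAt (x := θ) (by simp)
  have htri := ((contDiff_tri m).differentiable (by simp) θ).hasFDerivAt
  have hent := (differentiableAt_ent m hv).hasFDerivAt
  have hedge' := fun k => (hedge.hasFDerivAt.hasLineDerivAt k).unique (hasLineDerivAt_edge m θ k)
  have htri' := fun k => (htri.hasLineDerivAt k).unique (hasLineDerivAt_tri m θ k)
  have hent' := fun k => (hent.hasLineDerivAt k).unique (hasLineDerivAt_ent m hv k)
  have hne : fderiv ℝ (edge m) θ ≠ 0 := fun h => by
    have hw : 0 < weight m θ.c 0 := weight_pos hm hc (.inl (by decide))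
    refine hw.ne ?_
    simpa [h, c, val, Pi.single_apply] using hedge' (0, Pi.single 0 1)
  obtain ⟨Λ, hΛ⟩ := exists_eq_smul_of_isLocalMinOn_level
    (isLocalMinOn_sub_ent (Icc_mem_nhds hc hv) hs0 hle) hedge hne
    ((hs.comp_hasFDerivAt θ htri).sub hent)
  have hstat : ∀ k, β * fderiv ℝ (tri m) θ k - fderiv ℝ (ent m) θ k =
      Λ * fderiv ℝ (edge m) θ k := fun k => by simpa using DFunLike.congr_fun hΛ k
  simp only [hedge', htri', hent'] at hstat
  refine ⟨-2 * Λ, 6 * β, by positivity, fun j hj => ?_, ?_⟩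
  · have hj' := hstat (0, Pi.single j 1)
    simp only [c, val, Pi.single_apply, mul_ite, ite_mul, mul_one, one_mul, mul_zero, zero_mul,
      Finset.sum_ite_eq', Finset.mem_univ, if_true, zero_add] at hj'
    refine mul_left_cancel₀ (weight_pos hm hc hj).ne' ?_
    linear_combination -2 * hj'
  · have hc' := hstat (1, 0)
    simp only [c, val, Pi.zero_apply, mul_zero, zero_mul, Finset.sum_const_zero, add_zero,
      one_mul] at hc'
    linear_combination -2 * hc'

end Shape

/-! ### The limit in which the pair merges -/

theorem binEntropyDeriv_one_sub (v : ℝ) : binEntropyDeriv (1 - v) = -binEntropyDeriv v := by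
  simp only [binEntropyDeriv, sub_sub_cancel, neg_sub]

theorem log_le_binEntropyDeriv {v δ : ℝ} (hv : v ∈ Ioo (0 : ℝ) 1) (hδ : 0 < δ) (h : δ ≤ 1 - v) :
    log δ ≤ binEntropyDeriv v := by
  have := Real.log_le_log hδ h
  have := Real.log_nonpos hv.1.le hv.2.le
  rw [binEntropyDeriv]
  linarith

theorem binEntropyDeriv_le_neg_log {v δ : ℝ} (hv : v ∈ Ioo (0 : ℝ) 1) (hδ : 0 < δ) (h : δ ≤ v) :
    binEntropyDeriv v ≤ -log δ := by
  have := log_le_binEntropyDeriv (v := 1 - v) ⟨sub_pos.2 hv.2, sub_lt_self 1 hv.1⟩ hδ (by simpa)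
  rw [binEntropyDeriv_one_sub] at this
  linarith

theorem sub_le_log_sub_log {x y : ℝ} (hx : 0 < x) (hxy : x ≤ y) (hy : y ≤ 1) :
    y - x ≤ log y - log x := by
  have hy0 : 0 < y := hx.trans_le hxy
  have hlog := Real.log_le_sub_one_of_pos (div_pos hx hy0)
  have hdiv : y - x ≤ (y - x) / y := le_div_self (sub_nonneg.2 hxy) hy0 hy
  rw [Real.log_div hx.ne' hy0.ne'] at hlog
  rw [sub_div, div_self hy0.ne'] at hdiv
  linarith

theorem two_mul_sub_le_binEntropyDeriv_sub {x y : ℝ} (hx : x ∈ Ioo (0 : ℝ) 1)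
    (hy : y ∈ Ioo (0 : ℝ) 1) (hxy : x ≤ y) :
    2 * (y - x) ≤ binEntropyDeriv x - binEntropyDeriv y := by
  have h := sub_le_log_sub_log hx.1 hxy hy.2.le
  have h' := sub_le_log_sub_log (sub_pos.2 hy.2) (sub_le_sub_left hxy 1) (by linarith [hx.1])
  simp only [binEntropyDeriv]
  linarith

theorem lt_of_binEntropyDeriv_sub_eq {x y D : ℝ} (hx : x ∈ Ioo (0 : ℝ) 1)
    (hy : y ∈ Ioo (0 : ℝ) 1) (hxy : x ≠ y) (hD : 0 ≤ D)
    (h : binEntropyDeriv x - binEntropyDeriv y = D) : x < y := by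
  by_contra! hyx
  have := two_mul_sub_le_binEntropyDeriv_sub hy hx hyx
  have := sub_pos.2 (lt_of_le_of_ne hyx hxy.symm)
  linarith

theorem four_le_mul_sub_of_binEntropyDeriv_sub_eq {x y B c : ℝ} (hx : x ∈ Ioo (0 : ℝ) 1)
    (hy : y ∈ Ioo (0 : ℝ) 1) (hxy : x < y) (hB : 0 ≤ B) (hc : c ≤ 1)
    (h : binEntropyDeriv x - binEntropyDeriv y = B * (c / 2 * (x - y) ^ 2)) :
    4 ≤ B * (y - x) := by
  have hpos : 0 < y - x := sub_pos.2 hxy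
  have hle : 2 * (y - x) ≤ B * c / 2 * (y - x) * (y - x) := by
    linarith [two_mul_sub_le_binEntropyDeriv_sub hx hy hxy.le]
  have hle' := le_of_mul_le_mul_right hle hpos
  have hle'' : B * (y - x) * c ≤ B * (y - x) := mul_le_of_le_one_right (by positivity) hc
  linarith

section Sequences

variable {ι : Type*} {l : Filter ι}

theorem nonneg_of_tendsto_of_binEntropyDeriv_eq_mul [l.NeBot] {v B x : ι → ℝ} {v₀ x₀ : ℝ}
    (hv : ∀ n, v n ∈ Ioo (0 : ℝ) 1) (hv₀ : v₀ < 1) (hvlim : Tendsto v l (𝓝 v₀))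
    (hB : Tendsto B l atTop) (hx : Tendsto x l (𝓝 x₀))
    (h : ∀ n, binEntropyDeriv (v n) = B n * x n) : 0 ≤ x₀ := by
  have hzero : Tendsto (fun n => log ((1 - v₀) / 2) / B n) l (𝓝 0) := hB.const_div_atTop _
  refine le_of_tendsto_of_tendsto hzero hx ?_
  filter_upwards [hvlim.eventually (eventually_lt_nhds (show v₀ < (1 + v₀) / 2 by linarith)),
    hB.eventually_gt_atTop 0] with n hn hBn
  rw [div_le_iff₀' hBn, ← h n]
  exact log_le_binEntropyDeriv (hv n) (by linarith) (by linarith)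

theorem nonpos_of_tendsto_of_binEntropyDeriv_eq_mul [l.NeBot] {v B x : ι → ℝ} {v₀ x₀ : ℝ}
    (hv : ∀ n, v n ∈ Ioo (0 : ℝ) 1) (hv₀ : 0 < v₀) (hvlim : Tendsto v l (𝓝 v₀))
    (hB : Tendsto B l atTop) (hx : Tendsto x l (𝓝 x₀))
    (h : ∀ n, binEntropyDeriv (v n) = B n * x n) : x₀ ≤ 0 := by
  refine neg_nonneg.1 <| nonneg_of_tendsto_of_binEntropyDeriv_eq_mul (v := fun n => 1 - v n)
    (fun n => ⟨sub_pos.2 (hv n).2, sub_lt_self 1 (hv n).1⟩) (sub_lt_self 1 hv₀)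
    (hvlim.const_sub 1) hB hx.neg fun n => ?_
  rw [binEntropyDeriv_one_sub, h n, mul_neg]

namespace Shape

variable {m : ℕ} {θ : ι → Shape} {z : Shape}

theorem continuous_codegree (m : ℕ) (j : Fin 5) : Continuous fun θ : Shape => θ.codegree m j := by
  simp only [codegree, div_eq_mul_inv]
  fin_cases j <;> dsimp <;> fun_prop

theorem continuous_weightDeriv (m : ℕ) (j : Fin 5) : Continuous fun c => weightDeriv m c j := by
  simp only [weightDeriv, div_eq_mul_inv]
  fin_cases j <;> dsimp <;> fun_prop

theorem codegree_zero_sub_codegree_one (m : ℕ) (θ : Shape) :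
    θ.codegree m 0 - θ.codegree m 1 = θ.c / 2 * (θ.val 0 - θ.val 1) ^ 2 := by
  simp only [codegree, Matrix.cons_val]
  ring

/-- The codegrees inside and across the pair differ only to second order. -/
theorem four_le_mul_val_one_sub_val_zero {θ : Shape} {A B : ℝ} (hc : θ.c ∈ Ioo (0 : ℝ) 1)
    (hv : ∀ j, θ.val j ∈ Ioo (0 : ℝ) 1) (hne : θ.val 0 ≠ θ.val 1) (hB : 0 ≤ B)
    (h : ∀ j, j ≠ 4 ∨ 2 ≤ m → binEntropyDeriv (θ.val j) = A + B * θ.codegree m j) :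
    θ.val 0 < θ.val 1 ∧ 4 ≤ B * (θ.val 1 - θ.val 0) := by
  have hsub : binEntropyDeriv (θ.val 0) - binEntropyDeriv (θ.val 1) =
      B * (θ.c / 2 * (θ.val 0 - θ.val 1) ^ 2) := by
    rw [h 0 (.inl (by decide)), h 1 (.inl (by decide)), ← codegree_zero_sub_codegree_one m]
    ring
  have hc0 := hc.1
  have hlt := lt_of_binEntropyDeriv_sub_eq (hv 0) (hv 1) hne (by positivity) hsub
  exact ⟨hlt, four_le_mul_sub_of_binEntropyDeriv_sub_eq (hv 0) (hv 1) hlt hB hc.2.le hsub⟩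

theorem tendsto_val (hθ : Tendsto θ l (𝓝 z)) (j : Fin 5) :
    Tendsto (fun n => (θ n).val j) l (𝓝 (z.val j)) :=
  ((by fun_prop : Continuous fun θ : Shape => θ.val j).tendsto z).comp hθ

theorem tendsto_codegree (m : ℕ) (hθ : Tendsto θ l (𝓝 z)) (j : Fin 5) :
    Tendsto (fun n => (θ n).codegree m j) l (𝓝 (z.codegree m j)) :=
  ((continuous_codegree m j).tendsto z).comp hθ

theorem tendsto_weightDeriv (m : ℕ) (hθ : Tendsto θ l (𝓝 z)) (j : Fin 5) :
    Tendsto (fun n => weightDeriv m (θ n).c j) l (𝓝 (weightDeriv m z.c j)) :=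
  (((continuous_weightDeriv m j).comp continuous_fst).tendsto z).comp hθ

theorem tendsto_atTop_of_four_le_mul_val_sub (hθ : Tendsto θ l (𝓝 z)) (hz : z.val 0 = z.val 1)
    {B : ι → ℝ}
    (h : ∀ n, (θ n).val 0 < (θ n).val 1 ∧ 4 ≤ B n * ((θ n).val 1 - (θ n).val 0)) :
    Tendsto B l atTop := by
  have hdiff : Tendsto (fun n => (θ n).val 1 - (θ n).val 0) l (𝓝[>] 0) :=
    tendsto_nhdsWithin_iff.2 ⟨by simpa [hz] using (tendsto_val hθ 1).sub (tendsto_val hθ 0),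
      .of_forall fun n => sub_pos.2 (h n).1⟩
  refine tendsto_atTop_mono (fun n => ?_) (hdiff.inv_tendsto_nhdsGT_zero.const_mul_atTop
    (four_pos (α := ℝ)))
  rw [Pi.inv_apply, ← div_eq_mul_inv, div_le_iff₀ (sub_pos.2 (h n).1)]
  exact (h n).2

theorem tendsto_edge_multiplier (hθ : Tendsto θ l (𝓝 z))
    (hv : ∀ n j, (θ n).val j ∈ Ioo (0 : ℝ) 1) (hz : z.val 0 = z.val 1) {A B : ι → ℝ}
    (hB : ∀ n, 0 < B n) (hBtop : Tendsto B l atTop)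
    (hsep : ∀ n, 4 ≤ B n * ((θ n).val 1 - (θ n).val 0))
    (h : ∀ n j, j ≠ 4 ∨ 2 ≤ m → binEntropyDeriv ((θ n).val j) = A n + B n * (θ n).codegree m j) :
    Tendsto (fun n => -A n / B n) l (𝓝 (z.codegree m 0)) := by
  have hlog : Tendsto (fun n => log (B n) / B n) l (𝓝 0) :=
    Real.isLittleO_log_id_atTop.tendsto_div_nhds_zero.comp hBtop
  have h01 : z.codegree m 1 = z.codegree m 0 :=
    (sub_eq_zero.1 (by simp [codegree_zero_sub_codegree_one, hz])).symm
  have hinv : ∀ n, (B n)⁻¹ ≤ (θ n).val 1 - (θ n).val 0 := fun n => by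
    rw [inv_le_iff_one_le_mul₀ (hB n)]
    linarith [hsep n]
  refine tendsto_of_tendsto_of_tendsto_of_le_of_le
    (g := fun n => (θ n).codegree m 1 - log (B n) / B n)
    (h := fun n => (θ n).codegree m 0 + log (B n) / B n)
    (by simpa [h01] using (tendsto_codegree m hθ 1).sub hlog)
    (by simpa using (tendsto_codegree m hθ 0).add hlog) (fun n => ?_) (fun n => ?_)
  · have hle := binEntropyDeriv_le_neg_log (hv n 1) (inv_pos.2 (hB n))
      (by linarith [hinv n, (hv n 0).1])
    rw [h n 1 (.inl (by decide)), Real.log_inv, neg_neg] at hle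
    rw [sub_le_iff_le_add, ← add_div, le_div_iff₀ (hB n)]
    linarith
  · have hle := log_le_binEntropyDeriv (hv n 0) (inv_pos.2 (hB n))
      (by linarith [hinv n, (hv n 1).2])
    rw [h n 0 (.inl (by decide)), Real.log_inv] at hle
    rw [← sub_le_iff_le_add, ← sub_div, div_le_iff₀ (hB n)]
    linarith

/-- The first order conditions, with respect to the block values and the mass of the pair, for
`z` to minimize the triangle density at its edge density. The codegree of the first block plays
the role of the multiplier. -/
structure TriStationary (m : ℕ) (z : Shape) : Prop where
  val_zero_eq : z.val 0 = z.val 1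
  le_codegree : ∀ j, j ≠ 4 ∨ 2 ≤ m → z.val j < 1 → z.codegree m 0 ≤ z.codegree m j
  codegree_le : ∀ j, j ≠ 4 ∨ 2 ≤ m → 0 < z.val j → z.codegree m j ≤ z.codegree m 0
  sum_eq_zero :
    ∑ j, weightDeriv m z.c j * (z.val j * (z.codegree m j - 2 * z.codegree m 0)) = 0

/-- As two podes merge, the triangle multiplier explodes and entropy disappears from the
Euler–Lagrange equations. -/
theorem triStationary_of_tendsto [l.NeBot] (hm : 1 ≤ m) (hθ : Tendsto θ l (𝓝 z))
    (hE : ∀ n, Extremal m ((θ n).edge m) ((θ n).tri m) ((θ n).ent m))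
    (hc : ∀ n, (θ n).c ∈ Ioo (0 : ℝ) 1) (hv : ∀ n j, (θ n).val j ∈ Ioo (0 : ℝ) 1)
    (hne : ∀ n, (θ n).val 0 ≠ (θ n).val 1) (hz : z.val 0 = z.val 1) : TriStationary m z := by
  choose A B hB hval hmass using fun n => (hE n).euler_lagrange hm (hc n) (hv n)
  have hsep := fun n => four_le_mul_val_one_sub_val_zero (hc n) (hv n) (hne n) (hB n) (hval n)
  have hBpos : ∀ n, 0 < B n := fun n =>
    pos_of_mul_pos_left (four_pos.trans_le (hsep n).2) (sub_pos.2 (hsep n).1).le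
  have hBtop := tendsto_atTop_of_four_le_mul_val_sub hθ hz hsep
  have hA := tendsto_edge_multiplier hθ hv hz hBpos hBtop (fun n => (hsep n).2) hval
  have hlim := fun j => (tendsto_codegree m hθ j).sub hA
  have heq : ∀ j, j ≠ 4 ∨ 2 ≤ m → ∀ n, binEntropyDeriv ((θ n).val j) =
      B n * ((θ n).codegree m j - -A n / B n) := fun j hj n => by
    have := (hBpos n).ne'
    rw [hval n j hj]
    field_simp
    ring
  refine ⟨hz, fun j hj h1 => sub_nonneg.1 ?_, fun j hj h0 => sub_nonpos.1 ?_, ?_⟩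
  · exact nonneg_of_tendsto_of_binEntropyDeriv_eq_mul (fun n => hv n j) h1 (tendsto_val hθ j)
      hBtop (hlim j) (heq j hj)
  · exact nonpos_of_tendsto_of_binEntropyDeriv_eq_mul (fun n => hv n j) h0 (tendsto_val hθ j)
      hBtop (hlim j) (heq j hj)
  · have hleft := (tendsto_finsetSum Finset.univ fun j _ => (tendsto_weightDeriv m hθ j).mul
      ((Real.binEntropy_continuous.tendsto _).comp (tendsto_val hθ j))).div_atTop hBtop
    have hright := tendsto_finsetSum Finset.univ fun j _ => (tendsto_weightDeriv m hθ j).mul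
      ((tendsto_val hθ j).mul ((tendsto_codegree m hθ j).sub (hA.const_mul 2)))
    refine tendsto_nhds_unique (hright.congr fun n => ?_) (by simpa using hleft.const_mul 2)
    have := (hBpos n).ne'
    change _ = 2 * ((∑ j, weightDeriv m (θ n).c j * binEntropy ((θ n).val j)) / B n)
    rw [hmass n]
    simp only [Finset.mul_sum, Finset.sum_div, ← Finset.sum_add_distrib]
    refine Finset.sum_congr rfl fun j _ => ?_
    field_simp
    ring

end Shape
end Sequences

/-! ### Stationary points of the triangle density -/

namespace Shape

/-- `TriStationary` in coordinates: `c` is the mass of the merged pair, `q` that of a pode of the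
second group, `a` the value on the merged pair, and `L`, `D`, `B`, `P` are the codegrees of the
blocks with values `a`, `d`, `b`, `p`. -/
structure MergedSystem (m : ℕ) (c q a d b p L D B P : ℝ) : Prop where
  one_le : 1 ≤ m
  c_pos : 0 < c
  q_pos : 0 < q
  mass : c + m * q = 1
  a_mem : a ∈ Icc (0 : ℝ) 1
  d_mem : d ∈ Icc (0 : ℝ) 1
  b_mem : b ∈ Icc (0 : ℝ) 1
  p_mem : p ∈ Icc (0 : ℝ) 1
  L_eq : L = c * a ^ 2 + m * q * d ^ 2
  D_eq : D = d * (c * a + q * (b + (m - 1) * p))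
  B_eq : B = c * d ^ 2 + q * (b ^ 2 + (m - 1) * p ^ 2)
  P_eq : P = c * d ^ 2 + q * (2 * b * p + (m - 2) * p ^ 2)
  le_D : d < 1 → L ≤ D
  D_le : 0 < d → D ≤ L
  le_B : b < 1 → L ≤ B
  B_le : 0 < b → B ≤ L
  le_P : 2 ≤ m → p < 1 → L ≤ P
  P_le : 2 ≤ m → 0 < p → P ≤ L
  stationary : c * a * L + m * q * (d * (2 * L - D)) =
    c * (d * (2 * L - D)) + q * (b * (2 * L - B) + (m - 1) * (p * (2 * L - P)))

theorem eq_of_row_le {c s a d r : ℝ} (hc : 0 < c) (hd : 0 ≤ d)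
    (hD : d * (c * a + r) = c * a ^ 2 + s * d ^ 2) (hdeg : c * d + r ≤ c * a + s * d) :
    a = d := by
  have hrow : d * (r - s * d) ≤ d * (c * (a - d)) := mul_le_mul_of_nonneg_left (by linarith) hd
  have hsq : c * (a - d) ^ 2 ≤ 0 := by linarith
  exact sub_eq_zero.1 (pow_eq_zero_iff two_ne_zero |>.1
    ((nonpos_of_mul_nonpos_right hsq hc).antisymm (sq_nonneg _)))

theorem false_of_row_eq {k a b p : ℝ} (hk : 2 ≤ k) (hbp : b ≠ p)
    (hrow : b + (k - 1) * p = k * a) (hB : b * (b ^ 2 + (k - 1) * p ^ 2 - k * a ^ 2) = 0)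
    (hP : p * (2 * b * p + (k - 2) * p ^ 2 - k * a ^ 2) = 0) : False := by
  have hvar : k * (b ^ 2 + (k - 1) * p ^ 2 - k * a ^ 2) = (k - 1) * (b - p) ^ 2 := by
    linear_combination (b + (k - 1) * p + k * a) * hrow
  have hvar_pos : 0 < (k - 1) * (b - p) ^ 2 :=
    mul_pos (by linarith) (sq_pos_of_ne_zero (sub_ne_zero.2 hbp))
  have hb : b = 0 := (mul_eq_zero.1 hB).resolve_right fun h => by
    rw [h, mul_zero] at hvar
    exact hvar_pos.ne hvar
  subst hb
  have hp : p ^ 2 = 0 := by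
    have hP' := (mul_eq_zero.1 hP).resolve_left hbp.symm
    linear_combination -k * hP' + ((k - 1) * p + k * a) * hrow
  exact hbp (pow_eq_zero_iff two_ne_zero |>.1 hp).symm

namespace MergedSystem

variable {m : ℕ} {c q a d b p L D B P : ℝ}

theorem B_sub_P (hS : MergedSystem m c q a d b p L D B P) : B - P = q * (b - p) ^ 2 := by
  rw [hS.B_eq, hS.P_eq]
  ring

theorem P_lt_B (hS : MergedSystem m c q a d b p L D B P) (hbp : b ≠ p) : P < B := by
  have := mul_pos hS.q_pos (sq_pos_of_ne_zero (sub_ne_zero.2 hbp))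
  linarith [hS.B_sub_P]

theorem L_pos (hS : MergedSystem m c q a d b p L D B P) (hd : 0 < d) : 0 < L := by
  have hc := hS.c_pos
  have hq := hS.q_pos
  have hm := hS.one_le
  rw [hS.L_eq]
  positivity

theorem mul_L_sub_B_nonneg (hS : MergedSystem m c q a d b p L D B P) : 0 ≤ b * (L - B) := by
  rcases hS.b_mem.1.eq_or_lt with hb | hb
  · rw [← hb, zero_mul]
  · exact mul_nonneg hb.le (sub_nonneg.2 (hS.B_le hb))

theorem mul_L_sub_P_nonneg (hS : MergedSystem m c q a d b p L D B P) :
    0 ≤ (m - 1) * (p * (L - P)) := by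
  rcases hS.one_le.eq_or_lt with rfl | hm
  · simp
  · have hm1 : (0 : ℝ) ≤ m - 1 := sub_nonneg.2 (by exact_mod_cast hS.one_le)
    rcases hS.p_mem.1.eq_or_lt with hp | hp
    · rw [← hp, zero_mul, mul_zero]
    · exact mul_nonneg hm1 (mul_nonneg hp.le (sub_nonneg.2 (hS.P_le hm hp)))

theorem false_of_d_mem_Ioo (hS : MergedSystem m c q a d b p L D B P)
    (hconst : m = 1 → ¬(a = d ∧ b = d)) (hbp : 2 ≤ m → b ≠ p) (hd0 : 0 < d) (hd1 : d < 1) :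
    False := by
  have hq := hS.q_pos
  have hL := hS.L_pos hd0
  have hD : D = L := (hS.D_le hd0).antisymm (hS.le_D hd1)
  have hB := hS.mul_L_sub_B_nonneg
  have hP := hS.mul_L_sub_P_nonneg
  have hdeg : L * ((c * a + m * q * d) - (c * d + q * (b + (m - 1) * p))) =
      q * (b * (L - B) + (m - 1) * (p * (L - P))) := by
    have h := hS.stationary
    rw [hD] at h
    linear_combination h
  have hDL : d * (c * a + q * (b + (m - 1) * p)) = c * a ^ 2 + m * q * d ^ 2 := by
    rw [← hS.D_eq, hD, hS.L_eq]
  have had : a = d := by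
    refine eq_of_row_le hS.c_pos hd0.le hDL (sub_nonneg.1 (nonneg_of_mul_nonneg_right ?_ hL))
    exact hdeg ▸ mul_nonneg hq.le (add_nonneg hB hP)
  subst had
  have hrow : b + (m - 1) * p = m * a := by
    refine mul_left_cancel₀ (mul_pos hd0 hq).ne' ?_
    linear_combination hDL
  rcases hS.one_le.eq_or_lt with rfl | hm
  · exact hconst rfl ⟨rfl, by simpa using hrow⟩
  have hm2 : (2 : ℝ) ≤ m := by exact_mod_cast hm
  have hslack : q * (b * (L - B) + (m - 1) * (p * (L - P))) = 0 := by
    linear_combination -hdeg - L * q * hrow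
  obtain ⟨hB0, hP0⟩ :=
    (add_eq_zero_iff_of_nonneg hB hP).1 ((mul_eq_zero.1 hslack).resolve_left hq.ne')
  have hP0' := (mul_eq_zero.1 hP0).resolve_left (by linarith)
  rw [hS.L_eq, hS.B_eq] at hB0
  rw [hS.L_eq, hS.P_eq] at hP0'
  exact false_of_row_eq hm2 (hbp hm) hrow (mul_left_cancel₀ hq.ne' (by linear_combination -hB0))
    (mul_left_cancel₀ hq.ne' (by linear_combination -hP0'))

theorem eq_zero_of_d_eq_zero (hS : MergedSystem m c q a d b p L D B P)
    (hconst : m = 1 → ¬(a = d ∧ b = d)) (hbp : 2 ≤ m → b ≠ p) (hd : d = 0) :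
    m = 2 ∧ a = 0 ∧ b = 0 ∧ 0 < p := by
  subst hd
  have hc := hS.c_pos
  have hq := hS.q_pos
  have hLD := hS.le_D one_pos
  have ha : a = 0 := by
    by_contra h
    have : 0 < c * a ^ 2 := by positivity
    linarith [hS.L_eq, hS.D_eq]
  have hL : L = 0 := by simp [hS.L_eq, ha]
  have hm1 : (0 : ℝ) ≤ m - 1 := sub_nonneg.2 (by exact_mod_cast hS.one_le)
  have hb : b = 0 := by
    by_contra h
    have hb0 := hS.b_mem.1.lt_of_ne (Ne.symm h)
    have : 0 < q * (b ^ 2 + (m - 1) * p ^ 2) := by positivity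
    linarith [hS.B_le hb0, hS.B_eq]
  rcases hS.one_le.eq_or_lt with rfl | hm
  · exact absurd ⟨ha, hb⟩ (hconst rfl)
  have hp : 0 < p := hS.p_mem.1.lt_of_ne (hb ▸ hbp hm)
  refine ⟨?_, ha, hb, hp⟩
  have hP : q * p ^ 2 * (m - 2 : ℝ) ≤ q * p ^ 2 * 0 := by
    have := hS.P_le hm hp
    rw [hS.P_eq, hL, hb] at this
    linarith
  have hm2 : (m : ℝ) ≤ 2 := by linarith [le_of_mul_le_mul_left hP (by positivity)]
  exact le_antisymm (by exact_mod_cast hm2) hm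

theorem b_lt_one (hS : MergedSystem m c q a 1 b p L D B P)
    (hconst : m = 1 → ¬(a = 1 ∧ b = 1)) (hbp : 2 ≤ m → b ≠ p) : b < 1 := by
  refine hS.b_mem.2.lt_of_ne fun hb => ?_
  have hBL := hS.B_le (hb ▸ one_pos)
  rcases hS.one_le.eq_or_lt with rfl | hm
  · rw [hS.B_eq, hS.L_eq, hb] at hBL
    have ha : 1 ≤ a ^ 2 := le_of_mul_le_mul_left (by push_cast at hBL; linarith) hS.c_pos
    exact hconst rfl ⟨hS.a_mem.2.antisymm ((one_le_sq_iff₀ hS.a_mem.1).1 ha), hb⟩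
  · have hp := hS.p_mem.2.lt_of_ne (hb ▸ (hbp hm).symm)
    linarith [hS.P_lt_B (hbp hm), hS.le_P hm hp]

theorem eq_zero_or_p_eq_one (hS : MergedSystem m c q a d b p L D B P) (hm : 2 ≤ m)
    (hbp : b ≠ p) : b = 0 ∨ p = 1 := by
  by_contra! h
  have hp := hS.le_P hm (hS.p_mem.2.lt_of_ne h.2)
  have hb := hS.B_le (hS.b_mem.1.lt_of_ne h.1.symm)
  linarith [hS.P_lt_B hbp]

theorem a_lt_one (hS : MergedSystem m c q a 1 b p L D B P)
    (hconst : m = 1 → ¬(a = 1 ∧ b = 1)) (hbp : 2 ≤ m → b ≠ p) : a < 1 := by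
  refine hS.a_mem.2.lt_of_ne fun ha => ?_
  subst ha
  have hb := hS.b_lt_one hconst hbp
  have hq := hS.q_pos
  have hm1 : (0 : ℝ) ≤ m - 1 := sub_nonneg.2 (by exact_mod_cast hS.one_le)
  have hLB := hS.le_B hb
  rw [hS.L_eq, hS.B_eq] at hLB
  have hb2 : q * b ^ 2 < q * 1 :=
    mul_lt_mul_of_pos_left ((sq_lt_one_iff₀ hS.b_mem.1).2 hb) hq
  have hp2 : q * (m - 1) * p ^ 2 ≤ q * (m - 1) * 1 := mul_le_mul_of_nonneg_left
    (pow_le_one₀ hS.p_mem.1 hS.p_mem.2) (by positivity)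
  linarith

theorem b_eq_zero_of_d_eq_one (hS : MergedSystem m c q a 1 b p L D B P)
    (hconst : m = 1 → ¬(a = 1 ∧ b = 1)) (hbp : 2 ≤ m → b ≠ p)
    (hfree : 0 < a → a < 1 → B = L → b = a)
    (hA : ¬(c = q ∧ a = b ∧ (2 ≤ m → 1 = p))) : b = 0 := by
  by_contra hb
  have hb0 := hS.b_mem.1.lt_of_ne (Ne.symm hb)
  have hb1 := hS.b_lt_one hconst hbp
  have hp : 2 ≤ m → p = 1 := fun hm => (hS.eq_zero_or_p_eq_one hm (hbp hm)).resolve_left hb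
  have hBL := (hS.B_le hb0).antisymm (hS.le_B hb1)
  have hcq : c * (1 - a ^ 2) = q * (1 - b ^ 2) := by
    rcases hS.one_le.eq_or_lt with rfl | hm
    · linear_combination hBL - hS.B_eq + hS.L_eq
    · rw [hS.B_eq, hS.L_eq, hp hm] at hBL
      linear_combination hBL
  rcases hS.a_mem.1.eq_or_lt with rfl | ha
  · have hV : q ^ 2 * (b * (1 - b) ^ 2) = 0 := by
      have hc : c = q * (1 - b ^ 2) := by linear_combination hcq
      have hV := hS.stationary
      rw [hBL, hS.D_eq, hS.P_eq, hS.L_eq, hc] at hV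
      rcases hS.one_le.eq_or_lt with rfl | hm
      · linear_combination -hV
      · rw [hp hm] at hV
        linear_combination -hV
    have := hS.q_pos
    have := sub_pos.2 hb1
    have : 0 < q ^ 2 * (b * (1 - b) ^ 2) := by positivity
    linarith
  · have hba := hfree ha (hS.a_lt_one hconst hbp) hBL
    subst hba
    have hb2 : 1 - b ^ 2 ≠ 0 := (sub_pos.2 ((sq_lt_one_iff₀ hS.b_mem.1).2 hb1)).ne'
    exact hA ⟨mul_right_cancel₀ hb2 hcq, rfl, fun hm => (hp hm).symm⟩

theorem a_pos (hS : MergedSystem m c q a 1 0 p L D B P) (hbp : 2 ≤ m → 0 ≠ p)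
    (hA : ¬(c = q ∧ a = 0 ∧ (2 ≤ m → 1 = p))) : 0 < a := by
  refine hS.a_mem.1.lt_of_ne fun ha => ?_
  subst ha
  have hq := hS.q_pos
  have hV := hS.stationary
  rw [hS.D_eq, hS.P_eq, hS.L_eq] at hV
  rcases hS.one_le.eq_or_lt with rfl | hm
  · have hqc : 2 * q * (q - c) = 0 := by linear_combination hV
    exact hA ⟨(sub_eq_zero.1 ((mul_eq_zero.1 hqc).resolve_left (by positivity))).symm, rfl,
      fun h => absurd h (by norm_num)⟩
  have hm2 : (2 : ℝ) ≤ m := by exact_mod_cast hm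
  have hp0 : 0 < p := hS.p_mem.1.lt_of_ne (hbp hm)
  rcases hS.p_mem.2.eq_or_lt with rfl | hp1
  · have hqc : 2 * q * (q - c) = 0 := by linear_combination hV
    exact hA ⟨(sub_eq_zero.1 ((mul_eq_zero.1 hqc).resolve_left (by positivity))).symm, rfl,
      fun _ => rfl⟩
  · have hc : c = m * q - q * (m - 2) * p ^ 2 := by
      linear_combination (hS.P_le hm hp0).antisymm (hS.le_P hm hp1) + hS.L_eq - hS.P_eq
    have hzero : q ^ 2 * p * (m * (m - 1) - (m - 2) * p * (2 * m - (m - 1) * p)) = 0 := by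
      rw [hc] at hV
      linear_combination -hV
    have hrest : 0 ≤ (m - 2) * ((1 - p) * (2 + (m - 1) * (1 - p))) := by
      have := sub_nonneg.2 hm2
      have : (0 : ℝ) ≤ m - 1 := by linarith
      have := sub_pos.2 hp1
      positivity
    have hpos : 0 < (m * (m - 1) - (m - 2) * p * (2 * m - (m - 1) * p) : ℝ) := by linarith
    have : 0 < q ^ 2 * p * (m * (m - 1) - (m - 2) * p * (2 * m - (m - 1) * p)) := by positivity
    linarith

theorem q_lt_c (hS : MergedSystem m c q a 1 0 p L D B P) (ha : 0 < a) (hp : m = 1 ∨ p = 1) :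
    q < c := by
  have hca : 0 < c * a ^ 2 := mul_pos hS.c_pos (pow_pos ha 2)
  have hLB := hS.le_B one_pos
  rw [hS.L_eq, hS.B_eq] at hLB
  rcases hp with rfl | rfl
  · push_cast at hLB
    linarith
  · linarith

theorem mul_q_le_c (hS : MergedSystem m c q a 1 0 a L D B P) (ha : 0 < a) (ha1 : a < 1)
    (hm : 2 ≤ m) : m * q ≤ c := by
  have hPL := (hS.P_le hm ha).antisymm (hS.le_P hm ha1)
  rw [hS.P_eq, hS.L_eq] at hPL
  have hdiff : (c - m * q) * (1 - a ^ 2) = 2 * q * a ^ 2 := by linear_combination hPL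
  have hsq : 0 < 1 - a ^ 2 := sub_pos.2 ((sq_lt_one_iff₀ ha.le).2 ha1)
  have hq := hS.q_pos
  exact sub_nonneg.1 (nonneg_of_mul_nonneg_left (hdiff ▸ by positivity) hsq)

theorem classification (hS : MergedSystem m c q a d b p L D B P)
    (hconst : m = 1 → ¬(a = d ∧ b = d)) (hbp : 2 ≤ m → b ≠ p)
    (hfree : 0 < a → a < 1 → (B = L → b = a) ∧ (2 ≤ m → P = L → p = a))
    (hA : ¬(c = q ∧ a = b ∧ (2 ≤ m → d = p))) :
    (m = 2 ∧ a = 0 ∧ d = 0 ∧ b = 0 ∧ 0 < p) ∨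
      (0 < a ∧ a < 1 ∧ d = 1 ∧ b = 0 ∧
        ((m = 1 ∨ p = 1) ∧ q < c ∨ 2 ≤ m ∧ p = a ∧ m * q ≤ c)) := by
  rcases hS.d_mem.1.eq_or_lt with hd | hd0
  · obtain ⟨hm, ha, hb, hp⟩ := hS.eq_zero_of_d_eq_zero hconst hbp hd.symm
    exact .inl ⟨hm, ha, hd.symm, hb, hp⟩
  rcases hS.d_mem.2.lt_or_eq with hd1 | rfl
  · exact (hS.false_of_d_mem_Ioo hconst hbp hd0 hd1).elim
  have hb := hS.b_eq_zero_of_d_eq_one hconst hbp (fun h0 h1 => (hfree h0 h1).1) hA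
  subst hb
  have ha := hS.a_pos hbp hA
  have ha1 := hS.a_lt_one hconst hbp
  refine .inr ⟨ha, ha1, rfl, rfl, ?_⟩
  by_cases hp : m = 1 ∨ p = 1
  · exact .inl ⟨hp, hS.q_lt_c ha hp⟩
  push Not at hp
  have hm : 2 ≤ m := by have := hS.one_le; omega
  have hPL := (hS.P_le hm (hS.p_mem.1.lt_of_ne (hbp hm))).antisymm
    (hS.le_P hm (hS.p_mem.2.lt_of_ne hp.2))
  have hpa := (hfree ha ha1).2 hm hPL
  subst hpa
  exact .inr ⟨hm, rfl, hS.mul_q_le_c ha ha1 hm⟩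

end MergedSystem

theorem TriStationary.mergedSystem {m : ℕ} {z : Shape} (hz : TriStationary m z) (hm : 1 ≤ m)
    (hmem : z ∈ Icc (0 : Shape) 1) (hc : z.c ∈ Ioo (0 : ℝ) 1) :
    MergedSystem m z.c ((1 - z.c) / m) (z.val 0) (z.val 2) (z.val 3) (z.val 4)
      (z.codegree m 0) (z.codegree m 2) (z.codegree m 3) (z.codegree m 4) where
  one_le := hm
  c_pos := hc.1
  q_pos := div_pos (sub_pos.2 hc.2) (by positivity)
  mass := by
    have : (m : ℝ) ≠ 0 := by positivity
    field_simp
    ring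
  a_mem := val_mem hmem 0
  d_mem := val_mem hmem 2
  b_mem := val_mem hmem 3
  p_mem := val_mem hmem 4
  L_eq := by
    have : (m : ℝ) ≠ 0 := by positivity
    simp only [codegree, Matrix.cons_val, ← hz.val_zero_eq]
    field_simp
    ring
  D_eq := by
    simp only [codegree, Matrix.cons_val, ← hz.val_zero_eq]
    ring
  B_eq := by
    simp only [codegree, Matrix.cons_val]
    ring
  P_eq := by
    simp only [codegree, Matrix.cons_val]
    ring
  le_D := hz.le_codegree 2 (.inl (by decide))
  D_le := hz.codegree_le 2 (.inl (by decide))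
  le_B := hz.le_codegree 3 (.inl (by decide))
  B_le := hz.codegree_le 3 (.inl (by decide))
  le_P hm2 := hz.le_codegree 4 (.inr hm2)
  P_le hm2 := hz.codegree_le 4 (.inr hm2)
  stationary := by
    have hcodegree : z.codegree m 1 = z.codegree m 0 :=
      (sub_eq_zero.1 (by simp [codegree_zero_sub_codegree_one, hz.val_zero_eq])).symm
    have hmq : (m : ℝ) * ((1 - z.c) / m) = 1 - z.c := mul_div_cancel₀ _ (by positivity)
    have hsum := hz.sum_eq_zero
    simp only [Fin.sum_univ_five, weightDeriv, Matrix.cons_val, hcodegree,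
      ← hz.val_zero_eq] at hsum
    rw [hmq]
    linear_combination -hsum / 2

end Shape

/-! ### Gaining entropy without adding triangles -/

theorem neg_two_mul_sq_mul_inv_le_negMulLog {x r : ℝ} (hr : 0 ≤ r) (hx : r < x) :
    -(2 * r ^ 2 * x⁻¹) ≤
      Real.negMulLog (x - r) + Real.negMulLog (x + r) - 2 * Real.negMulLog x := by
  have hx0 : 0 < x := by linarith
  have hplus := Real.log_le_sub_one_of_pos (div_pos (by linarith : 0 < x + r) hx0)
  have hminus := Real.log_le_sub_one_of_pos (div_pos (by linarith : 0 < x - r) hx0)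
  rw [Real.log_div (by linarith) hx0.ne'] at hplus hminus
  have hplus' := mul_le_mul_of_nonneg_left hplus (by linarith : 0 ≤ x + r)
  have hminus' := mul_le_mul_of_nonneg_left hminus (by linarith : 0 ≤ x - r)
  have hsum : (x + r) * ((x + r) / x - 1) + (x - r) * ((x - r) / x - 1) = 2 * r ^ 2 * x⁻¹ := by
    field_simp
    ring
  simp only [Real.negMulLog]
  linarith

theorem neg_two_mul_sq_mul_inv_le_binEntropy {x r : ℝ} (hr : 0 ≤ r) (h0 : 0 < x - r)
    (h1 : x + r < 1) :
    -(2 * r ^ 2 * (x⁻¹ + (1 - x)⁻¹)) ≤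
      binEntropy (x - r) + binEntropy (x + r) - 2 * binEntropy x := by
  have hleft := neg_two_mul_sq_mul_inv_le_negMulLog hr (sub_pos.1 h0)
  have hright := neg_two_mul_sq_mul_inv_le_negMulLog hr (show r < 1 - x by linarith)
  rw [show 1 - x - r = 1 - (x + r) by ring, show 1 - x + r = 1 - (x - r) by ring] at hright
  simp only [Real.binEntropy_eq_negMulLog_add_negMulLog_one_sub]
  linarith

theorem exists_eventually_le_add_mul_sq {f : ℝ → ℝ} (hf : ContDiffAt ℝ 2 f 0)
    (h0 : HasDerivAt f 0 0) : ∃ C, ∀ᶠ t in 𝓝[>] (0 : ℝ), f t ≤ f 0 + C * t ^ 2 := by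
  obtain ⟨u, hu, hfu⟩ := hf.contDiffOn (m := 2) le_rfl (by simp)
  obtain ⟨δ, hδ, hδu⟩ := (nhds_basis_Icc_pos (0 : ℝ)).mem_iff.1 hu
  have hsub : Icc 0 δ ⊆ u := fun t ht => hδu ⟨by linarith [ht.1], by linarith [ht.2]⟩
  obtain ⟨C, hC⟩ := exists_taylor_mean_remainder_bound (n := 1) hδ.le
    (by norm_num; exact hfu.mono hsub)
  refine ⟨C, ?_⟩
  filter_upwards [Ioo_mem_nhdsGT hδ] with t ht
  have hderiv : derivWithin f (Icc 0 δ) 0 = 0 :=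
    h0.hasDerivWithinAt.derivWithin (uniqueDiffOn_Icc hδ 0 (left_mem_Icc.2 hδ.le))
  have hbound := hC t ⟨ht.1.le, ht.2.le⟩
  simp only [taylorWithinEval_succ, taylor_within_zero_eval, zero_add, iteratedDerivWithin_one,
    hderiv, smul_zero, add_zero, sub_zero, Nat.reduceAdd] at hbound
  linarith [(Real.le_norm_self _).trans hbound]

namespace Shape

/-- No shape with the same edge density and fewer triangles has more entropy. Only shapes that can
be perturbed through the value of the first block are compared. -/
def WeakExtremal (m : ℕ) (θ : Shape) : Prop :=
  ∀ θ' ∈ Icc (0 : Shape) 1, 0 < θ'.c → θ'.val 0 ∈ Ioo (0 : ℝ) 1 →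
    θ'.edge m = θ.edge m → θ'.tri m < θ.tri m → θ'.ent m ≤ θ.ent m

theorem edge_update_zero (m : ℕ) (θ : Shape) (x : ℝ) :
    edge m (θ.c, Function.update θ.val 0 x) = θ.edge m + θ.c ^ 2 / 2 * (x - θ.val 0) := by
  simp only [edge, c, val, Fin.sum_univ_five, weight, Matrix.cons_val, Function.update_self,
    Function.update_of_ne, ne_eq, Fin.reduceEq, not_false_eq_true]
  ring

theorem weakExtremal_of_tendsto {ι : Type*} {l : Filter ι} [l.NeBot] {m : ℕ} {θ : ι → Shape}
    {z : Shape} (hθ : Tendsto θ l (𝓝 z))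
    (hE : ∀ n, Extremal m ((θ n).edge m) ((θ n).tri m) ((θ n).ent m)) : WeakExtremal m z := by
  intro θ' hmem hc ha hedge htri
  set a : ι → ℝ := fun n => θ'.val 0 + 2 * ((θ n).edge m - z.edge m) / θ'.c ^ 2
  set η : ι → Shape := fun n => (θ'.c, Function.update θ'.val 0 (a n))
  have ha' : Tendsto a l (𝓝 (θ'.val 0)) := by
    have := ((contDiff_edge m).continuous.tendsto z).comp hθ
    simpa [a] using (((this.sub_const (z.edge m)).const_mul 2).div_const
      (θ'.c ^ 2)).const_add (θ'.val 0)
  have hη : Tendsto η l (𝓝 θ') := by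
    have := (tendsto_const_nhds (x := θ'.c)).prodMk_nhds
      ((tendsto_const_nhds (x := θ'.val)).update 0 ha')
    rwa [Function.update_eq_self] at this
  refine le_of_tendsto_of_tendsto (((continuous_ent m).tendsto θ').comp hη)
    (((continuous_ent m).tendsto z).comp hθ) ?_
  have htri' := (((contDiff_tri m).continuous.tendsto θ').comp hη).eventually_lt
    (((contDiff_tri m).continuous.tendsto z).comp hθ) htri
  filter_upwards [htri', ha'.eventually_mem (_root_.Icc_mem_nhds ha.1 ha.2)] with n htn han
  refine (hE n).ent_le _ (mem_Icc (show θ'.c ∈ _ from c_mem hmem) fun j => ?_) ?_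
    htn.le
  · rcases eq_or_ne j 0 with rfl | hj
    · simpa [η, val] using han
    · simpa [η, val, hj] using val_mem hmem j
  · rw [edge_update_zero, hedge]
    simp only [a]
    field_simp
    ring

/-- The shape obtained by moving the two values on the pair apart. -/
def split (θ : Shape) (r : ℝ) : Shape :=
  (θ.c, ![θ.val 0 - r, θ.val 1 + r, θ.val 2, θ.val 3, θ.val 4])

variable {m : ℕ} {θ : Shape} {r : ℝ}

theorem split_mem (hθ : θ ∈ Icc (0 : Shape) 1) (hr : 0 ≤ r) (h0 : 0 < θ.val 0 - r)
    (h1 : θ.val 1 + r < 1) : θ.split r ∈ Icc (0 : Shape) 1 := by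
  have hv := val_mem hθ
  refine mem_Icc (show θ.c ∈ _ from c_mem hθ) fun j => ?_
  fin_cases j
  exacts [⟨h0.le, (sub_le_self _ hr).trans (hv 0).2⟩,
    ⟨add_nonneg (hv 1).1 hr, h1.le⟩, hv 2, hv 3, hv 4]

theorem edge_split (m : ℕ) (θ : Shape) (r : ℝ) : (θ.split r).edge m = θ.edge m := by
  simp only [edge, split, c, val, Fin.sum_univ_five, weight, Matrix.cons_val]
  ring

theorem tri_split (m : ℕ) (h : θ.val 0 = θ.val 1) (r : ℝ) :
    (θ.split r).tri m = θ.tri m - θ.c ^ 3 * r ^ 3 := by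
  simp only [tri, split, c, val, Fin.sum_univ_five, weight, codegree, Matrix.cons_val]
  rw [show θ.2 0 = θ.2 1 from h]
  ring

theorem sub_sq_mul_le_ent_split (m : ℕ) (hθ : θ ∈ Icc (0 : Shape) 1) (h : θ.val 0 = θ.val 1)
    (hr : 0 ≤ r) (h0 : 0 < θ.val 0 - r) (h1 : θ.val 1 + r < 1) :
    θ.ent m - r ^ 2 * ((θ.val 0)⁻¹ + (1 - θ.val 0)⁻¹) ≤ (θ.split r).ent m := by
  have hsplit : (θ.split r).ent m = θ.ent m + θ.c ^ 2 / 4 *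
      (binEntropy (θ.val 0 - r) + binEntropy (θ.val 0 + r) - 2 * binEntropy (θ.val 0)) := by
    simp only [ent, split, c, val, Fin.sum_univ_five, weight, Matrix.cons_val]
    rw [← show θ.2 0 = θ.2 1 from h]
    ring
  have hX : 0 ≤ (θ.val 0)⁻¹ + (1 - θ.val 0)⁻¹ :=
    add_nonneg (inv_nonneg.2 (val_mem hθ 0).1) (inv_nonneg.2 (sub_nonneg.2 (val_mem hθ 0).2))
  have hc : θ.c ^ 2 ≤ 1 := pow_le_one₀ (c_mem hθ).1 (c_mem hθ).2
  have hdiff := mul_le_mul_of_nonneg_left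
    (neg_two_mul_sq_mul_inv_le_binEntropy hr h0 (h ▸ h1)) (by positivity : 0 ≤ θ.c ^ 2 / 4)
  have hcost := mul_le_mul_of_nonneg_right hc (mul_nonneg (sq_nonneg r) hX)
  nlinarith [mul_nonneg (sq_nonneg r) hX]

end Shape

theorem exists_pos_mul_sq_lt (C : ℝ) {b : ℝ} (hb : 0 < b) : ∃ κ > 0, C * κ ^ 2 < b := by
  have hlim : Tendsto (fun κ : ℝ => C * κ ^ 2) (𝓝[>] 0) (𝓝 0) :=
    tendsto_nhdsWithin_of_tendsto_nhds <| by
      simpa using (by fun_prop : Continuous fun κ : ℝ => C * κ ^ 2).tendsto 0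
  obtain ⟨κ, hκb, hκ⟩ := ((hlim.eventually_lt_const hb).and self_mem_nhdsWithin).exists
  exact ⟨κ, hκ, hκb⟩

namespace Shape

variable {m : ℕ} {θ : Shape}

theorem WeakExtremal.le_of_split (hW : WeakExtremal m θ) {η : Shape} (hη : η ∈ Icc (0 : Shape) 1)
    (hc : 0 < η.c) (h : η.val 0 = η.val 1) {r : ℝ} (hr : 0 ≤ r) (h0 : 0 < η.val 0 - r)
    (h1 : η.val 0 + r < 1) (hedge : η.edge m = θ.edge m)
    (htri : η.tri m < θ.tri m + η.c ^ 3 * r ^ 3) :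
    η.ent m ≤ θ.ent m + r ^ 2 * ((η.val 0)⁻¹ + (1 - η.val 0)⁻¹) := by
  have hsplit := hW (η.split r) (split_mem hη hr h0 (h ▸ h1)) hc
    ⟨h0, (sub_le_self _ hr).trans_lt ((le_add_of_nonneg_right hr).trans_lt h1)⟩
    ((edge_split m η r).trans hedge) (by rw [tri_split m h]; linarith)
  linarith [sub_sq_mul_le_ent_split m hη h hr h0 (h ▸ h1)]

/-- Along such a curve `t ↦ γ t`, split by `r²` at `t = κ r³`: triangles change by
`O(κ² r⁶) - c³ r⁶`, while the entropy gain `s κ r³` outweighs the splitting cost `O(r⁴)`. -/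
theorem WeakExtremal.false_of_curve (hW : WeakExtremal m θ) (hc : 0 < θ.c)
    (ha : θ.val 0 ∈ Ioo (0 : ℝ) 1) {γ : ℝ → Shape} (h0 : γ 0 = θ) (hγ : ContDiffAt ℝ 2 γ 0)
    (hsymm : ∀ t, (γ t).val 0 = (γ t).val 1) (hmem : ∀ᶠ t in 𝓝[>] 0, γ t ∈ Icc (0 : Shape) 1)
    (hedge : ∀ᶠ t in 𝓝[>] 0, (γ t).edge m = θ.edge m)
    (htri : HasDerivAt (fun t => (γ t).tri m) 0 0) {s : ℝ} (hs : 0 < s)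
    (hent : ∀ᶠ t in 𝓝[>] 0, θ.ent m + s * t ≤ (γ t).ent m) : False := by
  obtain ⟨C, hC⟩ := exists_eventually_le_add_mul_sq
    (((contDiff_tri m).of_le le_top).contDiffAt.comp 0 hγ) htri
  simp only [Function.comp_apply, h0] at hC
  obtain ⟨κ, hκ, hκC⟩ := exists_pos_mul_sq_lt C (pow_pos hc 3)
  have hpoly : ∀ k ≠ 0, Tendsto (fun r : ℝ => r ^ k) (𝓝[>] 0) (𝓝 0) := fun k hk =>
    tendsto_nhdsWithin_of_tendsto_nhds <| by simpa [hk] using (continuous_pow k).tendsto (0 : ℝ)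
  have ht : Tendsto (fun r : ℝ => κ * r ^ 3) (𝓝[>] 0) (𝓝[>] 0) :=
    tendsto_nhdsWithin_iff.2 ⟨by simpa using (hpoly 3 (by simp)).const_mul κ,
      eventually_mem_nhdsWithin.mono fun r (hr : 0 < r) => mem_Ioi.2 (by positivity)⟩
  have hlim : Tendsto (fun r => γ (κ * r ^ 3)) (𝓝[>] 0) (𝓝 θ) :=
    (h0 ▸ hγ.continuousAt.tendsto).comp (ht.mono_right nhdsWithin_le_nhds)
  have hclim : Tendsto (fun r => (γ (κ * r ^ 3)).c) (𝓝[>] 0) (𝓝 θ.c) :=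
    (continuous_fst.tendsto θ).comp hlim
  have halim := tendsto_val hlim 0
  have hlow := halim.sub (hpoly 2 two_ne_zero)
  have hupp := halim.add (hpoly 2 two_ne_zero)
  have hcost := (hpoly 1 one_ne_zero).mul
    ((halim.inv₀ ha.1.ne').add ((halim.const_sub 1).inv₀ (sub_pos.2 ha.2).ne'))
  rw [sub_zero] at hlow
  rw [add_zero] at hupp
  rw [zero_mul] at hcost
  obtain ⟨r, hr, hmem, hedge, hC, hent, hc', hκC, hlow, hupp, hcost⟩ :=
    (eventually_mem_nhdsWithin.and <| (ht.eventually hmem).and <| (ht.eventually hedge).and <|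
      (ht.eventually hC).and <| (ht.eventually hent).and <| (hclim.eventually_const_lt hc).and <|
      ((hclim.pow 3).eventually_const_lt hκC).and <| (hlow.eventually_const_lt ha.1).and <|
      (hupp.eventually_lt_const ha.2).and <| hcost.eventually_lt_const (mul_pos hs hκ)).exists
  have hr : 0 < r := hr
  have hsplit := hW.le_of_split hmem hc' (hsymm _) (sq_nonneg r) hlow hupp hedge
    (hC.trans_lt (by nlinarith [mul_lt_mul_of_pos_right hκC (pow_pos hr 6)]))
  nlinarith [mul_lt_mul_of_pos_right hcost (pow_pos hr 3)]

theorem le_ent_add_smul_sub (hm : 1 ≤ m) {θ' : Shape} (hθ : θ ∈ Icc (0 : Shape) 1)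
    (hθ' : θ' ∈ Icc (0 : Shape) 1) (hc : θ'.c = θ.c) {t : ℝ} (ht : t ∈ Icc (0 : ℝ) 1) :
    (1 - t) * θ.ent m + t * θ'.ent m ≤ (θ + t • (θ' - θ)).ent m := by
  have hterm : ∀ j, (1 - t) * (weight m θ.c j * binEntropy (θ.val j)) +
      t * (weight m θ.c j * binEntropy (θ'.val j)) ≤
      weight m θ.c j * binEntropy (θ.val j + t * (θ'.val j - θ.val j)) := fun j => by
    have hconc := Real.strictConcave_binEntropy.concaveOn.2 (val_mem hθ j) (val_mem hθ' j)
      (sub_nonneg.2 ht.2) ht.1 (sub_add_cancel 1 t)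
    simp only [smul_eq_mul] at hconc
    rw [show θ.val j + t * (θ'.val j - θ.val j) = (1 - t) * θ.val j + t * θ'.val j by ring]
    linarith [mul_le_mul_of_nonneg_left hconc (weight_nonneg hm (c_mem hθ) j)]
  have hsum := Finset.sum_le_sum fun j (_ : j ∈ Finset.univ) => hterm j
  rw [Finset.sum_add_distrib, ← Finset.mul_sum, ← Finset.mul_sum] at hsum
  have hc' : (θ + t • (θ' - θ)).c = θ.c := by simp [c, show θ'.1 = θ.1 from hc]
  simp only [ent, hc, hc']
  simp only [val, Prod.snd_add, Prod.smul_snd, Prod.snd_sub, Pi.add_apply, Pi.smul_apply,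
    Pi.sub_apply, smul_eq_mul] at hsum ⊢
  linarith

theorem WeakExtremal.ent_le_of_sum_eq (hm : 1 ≤ m) (hW : WeakExtremal m θ)
    (hθ : θ ∈ Icc (0 : Shape) 1) (hc : 0 < θ.c) (ha : θ.val 0 ∈ Ioo (0 : ℝ) 1)
    (h01 : θ.val 0 = θ.val 1) {θ' : Shape} (hθ' : θ' ∈ Icc (0 : Shape) 1) (hc' : θ'.c = θ.c)
    (h01' : θ'.val 0 = θ'.val 1)
    (hedge : ∑ j, weight m θ.c j * (θ'.val j - θ.val j) = 0)
    (htri : ∑ j, weight m θ.c j * ((θ'.val j - θ.val j) * θ.codegree m j) = 0) :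
    θ'.ent m ≤ θ.ent m := by
  by_contra! hlt
  set γ : ℝ → Shape := fun t => θ + t • (θ' - θ)
  have hk : (θ' - θ).c = 0 := sub_eq_zero.2 hc'
  have hIcc : ∀ᶠ t in 𝓝[>] (0 : ℝ), t ∈ Icc (0 : ℝ) 1 :=
    mem_of_superset (Ioo_mem_nhdsGT one_pos) Ioo_subset_Icc_self
  refine hW.false_of_curve hc ha (γ := γ) (by simp [γ]) (by fun_prop) (fun t => ?_) ?_ ?_ ?_
    (sub_pos.2 hlt) ?_
  · simp only [γ, val] at *
    simp [h01, h01']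
  · filter_upwards [hIcc] with t ht using (convex_Icc (0 : Shape) 1).add_smul_sub_mem hθ hθ' ht
  · refine Eventually.of_forall fun t => ?_
    have hγc : (γ t).c = θ.c := by simp [γ, c, show θ'.1 = θ.1 from hc']
    simp only [edge, hγc]
    calc ∑ j, weight m θ.c j * (γ t).val j
        = ∑ j, weight m θ.c j * θ.val j + t * ∑ j, weight m θ.c j * (θ'.val j - θ.val j) := by
          rw [Finset.mul_sum, ← Finset.sum_add_distrib]
          refine Finset.sum_congr rfl fun j _ => ?_
          simp only [γ, val, Prod.snd_add, Prod.smul_snd, Prod.snd_sub, Pi.add_apply,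
            Pi.smul_apply, Pi.sub_apply, smul_eq_mul]
          ring
      _ = _ := by rw [hedge, mul_zero, add_zero]
  · refine (hasLineDerivAt_tri m θ (θ' - θ)).congr_deriv ?_
    rw [hk, zero_mul, zero_add]
    exact mul_eq_zero_of_right _ htri
  · filter_upwards [hIcc] with t ht
    linarith [le_ent_add_smul_sub hm hθ hθ' hc' ht]

end Shape

theorem eq_of_sum_mul_centerMass_le {ι : Type*} {D : Set ℝ} {f : ℝ → ℝ}
    (hf : StrictConcaveOn ℝ D f) {s : Finset ι} {w v : ι → ℝ} (hw : ∀ i ∈ s, 0 < w i)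
    (hv : ∀ i ∈ s, v i ∈ D)
    (h : (∑ i ∈ s, w i) * f (s.centerMass w v) ≤ ∑ i ∈ s, w i * f (v i)) {i j : ι} (hi : i ∈ s)
    (hj : j ∈ s) : v i = v j := by
  have hW : 0 < ∑ i ∈ s, w i := Finset.sum_pos hw ⟨i, hi⟩
  refine hf.eq_of_map_sum_eq (w := fun i => (∑ i ∈ s, w i)⁻¹ * w i)
    (fun i hi => mul_pos (inv_pos.2 hW) (hw i hi))
    (by rw [← Finset.mul_sum, inv_mul_cancel₀ hW.ne']) hv ?_ hi hj
  simp only [smul_eq_mul, mul_assoc, ← Finset.mul_sum]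
  exact (le_inv_mul_iff₀ hW).2 h

namespace Shape

variable {m : ℕ} {θ : Shape}

theorem codegree_one_eq_codegree_zero (m : ℕ) (h : θ.val 0 = θ.val 1) :
    θ.codegree m 1 = θ.codegree m 0 := by
  have := codegree_zero_sub_codegree_one m θ
  rw [h, sub_self] at this
  linarith

/-- Otherwise averaging the values over all blocks with this codegree would gain entropy without
changing the triangle density to first order. -/
theorem WeakExtremal.val_eq (hm : 1 ≤ m) (hW : WeakExtremal m θ) (hθ : θ ∈ Icc (0 : Shape) 1)
    (hc : 0 < θ.c) (ha : θ.val 0 ∈ Ioo (0 : ℝ) 1) (h01 : θ.val 0 = θ.val 1) {j : Fin 5}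
    (hw : 0 < weight m θ.c j) (hj : θ.codegree m j = θ.codegree m 0) : θ.val j = θ.val 0 := by
  set w := weight m θ.c
  set s : Finset (Fin 5) := {i | 0 < w i ∧ θ.codegree m i = θ.codegree m 0}
  have hs : ∀ {i}, i ∈ s ↔ 0 < w i ∧ θ.codegree m i = θ.codegree m 0 := by simp [s]
  have hw0 : 0 < w 0 := div_pos (pow_pos hc 2) two_pos
  have hmem0 : 0 ∈ s := hs.2 ⟨hw0, rfl⟩
  have hmem1 : 1 ∈ s := hs.2 ⟨hw0, codegree_one_eq_codegree_zero m h01⟩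
  have hW0 : 0 < ∑ i ∈ s, w i := Finset.sum_pos (fun i hi => (hs.1 hi).1) ⟨0, hmem0⟩
  set μ := s.centerMass w θ.val
  have hμ : (∑ i ∈ s, w i) * μ = ∑ i ∈ s, w i * θ.val i := mul_inv_cancel_left₀ hW0.ne' _
  set θ' : Shape := (θ.c, fun i => if i ∈ s then μ else θ.val i)
  have hsum : ∀ f : Fin 5 → ℝ → ℝ,
      ∑ i, f i (θ'.val i) - ∑ i, f i (θ.val i) = ∑ i ∈ s, (f i μ - f i (θ.val i)) := fun f => by
    rw [← Finset.sum_sub_distrib, ← Finset.sum_subset (Finset.subset_univ s) fun i _ hi => by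
      simp [θ', val, hi]]
    exact Finset.sum_congr rfl fun i hi => by simp [θ', val, hi]
  have hedge : ∑ i ∈ s, (w i * μ - w i * θ.val i) = 0 := by
    rw [Finset.sum_sub_distrib, ← Finset.sum_mul, hμ, sub_self]
  have hθ' : θ' ∈ Icc (0 : Shape) 1 := mem_Icc (show θ.c ∈ _ from c_mem hθ) fun i => by
    by_cases hi : i ∈ s
    · simpa [θ', val, hi] using (convex_Icc (0 : ℝ) 1).centerMass_mem
        (fun i hi => (hs.1 hi).1.le) hW0 fun i _ => val_mem hθ i
    · simpa [θ', val, hi] using val_mem hθ i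
  have hent := hW.ent_le_of_sum_eq hm hθ hc ha h01 hθ' rfl (by simp [θ', val, hmem0, hmem1])
    (by simpa only [mul_sub, Finset.sum_sub_distrib] using
      (hsum fun i x => w i * x).trans hedge)
    (by
      simp only [sub_mul, mul_sub, Finset.sum_sub_distrib]
      refine (hsum fun i x => w i * (x * θ.codegree m i)).trans ?_
      rw [← zero_mul (θ.codegree m 0), ← hedge, Finset.sum_mul]
      exact Finset.sum_congr rfl fun i hi => by rw [(hs.1 hi).2]; ring)
  have hjensen : (∑ i ∈ s, w i) * binEntropy μ ≤ ∑ i ∈ s, w i * binEntropy (θ.val i) := by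
    have := hsum fun i x => w i * binEntropy x
    rw [Finset.sum_sub_distrib, ← Finset.sum_mul] at this
    simp only [ent] at hent
    linarith
  exact eq_of_sum_mul_centerMass_le Real.strictConcave_binEntropy (fun i hi => (hs.1 hi).1)
    (fun i _ => val_mem hθ i) hjensen (hs.2 ⟨hw, hj⟩) hmem0

/-- The amount by which the two values on the pair change when the pair gains mass `t` while the
edge density stays fixed. -/
def growShift (m : ℕ) (θ : Shape) (t : ℝ) : ℝ :=
  (θ.edge m - edge m (θ.c + t, θ.val)) / (θ.c + t) ^ 2

/-- The shape obtained by letting the pair gain mass `t`, the edge density being kept fixed by the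
values on the pair. -/
def grow (m : ℕ) (θ : Shape) (t : ℝ) : Shape :=
  (θ.c + t, fun j => θ.val j + if j < 2 then θ.growShift m t else 0)

theorem grow_zero (m : ℕ) (θ : Shape) : θ.grow m 0 = θ := by
  simp [grow, growShift]

theorem edge_grow (m : ℕ) {t : ℝ} (ht : θ.c + t ≠ 0) : (θ.grow m t).edge m = θ.edge m := by
  have hshift : (θ.c + t) ^ 2 * θ.growShift m t = θ.edge m - edge m (θ.c + t, θ.val) :=
    mul_div_cancel₀ _ (pow_ne_zero 2 ht)
  have : (θ.grow m t).edge m = edge m (θ.c + t, θ.val) + (θ.c + t) ^ 2 * θ.growShift m t := by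
    simp [edge, grow, c, val, Fin.sum_univ_five, weight, Matrix.cons_val]
    ring
  rw [this, hshift]
  ring

theorem contDiffAt_growShift (m : ℕ) (hc : θ.c ≠ 0) : ContDiffAt ℝ 2 (θ.growShift m) 0 := by
  have hedge : ContDiff ℝ 2 fun t => edge m (θ.c + t, θ.val) :=
    ((contDiff_edge m).of_le le_top).comp (by fun_prop)
  exact (contDiffAt_const.sub hedge.contDiffAt).div (by fun_prop) (by simpa using hc)

theorem contDiffAt_grow (m : ℕ) (hc : θ.c ≠ 0) : ContDiffAt ℝ 2 (θ.grow m) 0 := by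
  have hshift := contDiffAt_growShift m hc
  refine ContDiffAt.prodMk (by fun_prop) (contDiffAt_pi.2 fun j => ?_)
  split_ifs
  exacts [contDiffAt_const.add hshift, contDiffAt_const]

theorem hasDerivAt_growShift (m : ℕ) (hc : θ.c ≠ 0) :
    HasDerivAt (θ.growShift m) (-(∑ j, weightDeriv m θ.c j * θ.val j) / θ.c ^ 2) 0 := by
  have hline : ∀ t : ℝ, θ + t • ((1, 0) : Shape) = (θ.c + t, θ.val) := fun t => by
    simp [c, val, Prod.ext_iff]
  have hnum : HasDerivAt (fun t => θ.edge m - edge m (θ.c + t, θ.val))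
      (-(∑ j, weightDeriv m θ.c j * θ.val j)) 0 := by
    have := HasDerivAt.const_sub (θ.edge m) (hasLineDerivAt_edge m θ (1, 0))
    simpa only [hline, c, val, one_mul, Pi.zero_apply, mul_zero, Finset.sum_const_zero,
      add_zero] using this
  have hden : HasDerivAt (fun t => (θ.c + t) ^ 2) (2 * θ.c) 0 := by
    simpa using ((hasDerivAt_id (0 : ℝ)).const_add θ.c).fun_pow 2
  refine (hnum.fun_div hden (by simpa using hc)).congr_deriv ?_
  simp only [add_zero, sub_self, zero_mul, sub_zero]
  field_simp

theorem hasDerivAt_grow (m : ℕ) (hc : θ.c ≠ 0) :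
    HasDerivAt (θ.grow m) ((1, fun j => if j < 2 then
      -(∑ j, weightDeriv m θ.c j * θ.val j) / θ.c ^ 2 else 0) : Shape) 0 := by
  refine HasDerivAt.prodMk ((hasDerivAt_id 0).const_add θ.c) (hasDerivAt_pi.2 fun j => ?_)
  split_ifs
  exacts [(hasDerivAt_growShift m hc).const_add (θ.val j), by simpa using hasDerivAt_const _ _]

theorem TriStationary.hasDerivAt_tri_grow (hz : TriStationary m θ) (hc : θ.c ≠ 0) :
    HasDerivAt (fun t => (θ.grow m t).tri m) 0 0 := by
  have hdiff := ((contDiff_tri m).differentiable (by simp)) θ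
  have hdiff' : HasFDerivAt (tri m) (fderiv ℝ (tri m) θ) (θ.grow m 0) := by
    simpa only [grow_zero] using hdiff.hasFDerivAt
  refine (hdiff'.comp_hasDerivAt 0 (hasDerivAt_grow m hc)).congr_deriv ?_
  rw [← hdiff.lineDeriv_eq_fderiv, (hasLineDerivAt_tri m θ _).lineDeriv]
  have hpair : ∀ s : ℝ, ∑ j, weight m θ.c j * ((if j < 2 then s / θ.c ^ 2 else 0) *
      θ.codegree m j) = s * θ.codegree m 0 := fun s => by
    simp only [Fin.sum_univ_five, weight, Matrix.cons_val, Fin.reduceLT, if_true, if_false,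
      codegree_one_eq_codegree_zero m hz.val_zero_eq]
    field_simp
    ring
  have hsum : ∑ j, weightDeriv m θ.c j * (θ.val j * θ.codegree m j) =
      2 * ((∑ j, weightDeriv m θ.c j * θ.val j) * θ.codegree m 0) := by
    rw [← sub_eq_zero, ← hz.sum_eq_zero, Finset.sum_mul, Finset.mul_sum,
      ← Finset.sum_sub_distrib]
    exact Finset.sum_congr rfl fun j _ => by ring
  simp only [val, hpair]
  simp only [val] at hsum
  linarith

theorem sum_weight_mul_ite (m : ℕ) (c x : ℝ) :
    ∑ j : Fin 5, weight m c j * (if j < 2 then x else 0) = c ^ 2 * x := by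
  simp only [Fin.sum_univ_five, weight, Matrix.cons_val, Fin.reduceLT, if_true, if_false]
  ring

theorem hasDerivAt_ent_grow (m : ℕ) (hc : θ.c ≠ 0) (ha : θ.val 0 ∈ Ioo (0 : ℝ) 1)
    (h : θ.val 0 = θ.val 1) :
    HasDerivAt (fun t => (θ.grow m t).ent m) (1 / 2 * ∑ j, weightDeriv m θ.c j *
      (binEntropy (θ.val j) - binEntropyDeriv (θ.val 0) * θ.val j)) 0 := by
  set s := -(∑ j, weightDeriv m θ.c j * θ.val j) / θ.c ^ 2 with hs
  have hshift0 : θ.growShift m 0 = 0 := by simp [growShift]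
  have hw : ∀ j, HasDerivAt (fun t => weight m (θ.c + t) j) (weightDeriv m θ.c j) 0 := fun j => by
    have := hasDerivAt_weight m (θ.c + 0) j
    simpa using this.comp_const_add θ.c 0
  have hH : ∀ j, HasDerivAt (fun t => binEntropy ((θ.grow m t).val j))
      (if j < 2 then binEntropyDeriv (θ.val 0) * s else 0) 0 := fun j => by
    by_cases hj : j < 2
    · have hval : θ.val j = θ.val 0 := by
        fin_cases j <;> simp_all
      simp only [grow, val, hj, if_true] at hval ⊢
      rw [hval]
      refine HasDerivAt.comp (h₂ := binEntropy) 0 ?_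
        ((hasDerivAt_growShift m hc).const_add (θ.val 0))
      simpa only [hshift0, add_zero] using hasDerivAt_binEntropy ha
    · simpa [grow, val, hj] using hasDerivAt_const (0 : ℝ) (binEntropy (θ.2 j))
  refine ((HasDerivAt.fun_sum fun j (_ : j ∈ Finset.univ) =>
    (hw j).fun_mul (hH j)).const_mul (1 / 2 : ℝ)).congr_deriv ?_
  simp only [add_zero, grow_zero]
  have hpair : θ.c ^ 2 * (binEntropyDeriv (θ.val 0) * s) =
      -(binEntropyDeriv (θ.val 0) * ∑ j, weightDeriv m θ.c j * θ.val j) := by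
    rw [hs]
    field_simp
  rw [Finset.sum_add_distrib, sum_weight_mul_ite, hpair, ← sub_eq_add_neg, Finset.mul_sum,
    ← Finset.sum_sub_distrib]
  exact congrArg _ (Finset.sum_congr rfl fun j _ => by ring)

theorem eventually_grow_mem (hθ : θ ∈ Icc (0 : Shape) 1) (hc : θ.c ∈ Ioo (0 : ℝ) 1)
    (ha : θ.val 0 ∈ Ioo (0 : ℝ) 1) (h : θ.val 0 = θ.val 1) (m : ℕ) :
    ∀ᶠ t in 𝓝 (0 : ℝ), θ.grow m t ∈ Icc (0 : Shape) 1 := by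
  have hlim : Tendsto (θ.grow m) (𝓝 0) (𝓝 θ) := by
    simpa only [grow_zero] using (contDiffAt_grow m hc.1.ne').continuousAt.tendsto
  have hclim : Tendsto (fun t => (θ.grow m t).c) (𝓝 0) (𝓝 θ.c) :=
    (continuous_fst.tendsto θ).comp hlim
  filter_upwards [hclim.eventually_mem (_root_.Icc_mem_nhds hc.1 hc.2),
    (tendsto_val hlim 0).eventually_mem (_root_.Icc_mem_nhds ha.1 ha.2),
    (tendsto_val hlim 1).eventually_mem (h ▸ _root_.Icc_mem_nhds ha.1 ha.2)] with t hct h0 h1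
  refine mem_Icc hct fun j => ?_
  by_cases hj : j < 2
  · fin_cases j <;> simp_all
  · simpa [grow, val, hj] using val_mem hθ j

theorem WeakExtremal.sum_weightDeriv_mul_nonpos (hW : WeakExtremal m θ)
    (hz : TriStationary m θ) (hθ : θ ∈ Icc (0 : Shape) 1) (hc : θ.c ∈ Ioo (0 : ℝ) 1)
    (ha : θ.val 0 ∈ Ioo (0 : ℝ) 1) :
    ∑ j, weightDeriv m θ.c j * (binEntropy (θ.val j) - binEntropyDeriv (θ.val 0) * θ.val j) ≤
      0 := by
  have hc0 := hc.1.ne'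
  by_contra! hpos
  have hlim : Tendsto (fun t => θ.c + t) (𝓝[>] 0) (𝓝 θ.c) :=
    tendsto_nhdsWithin_of_tendsto_nhds <| by simpa using (continuous_const_add θ.c).tendsto 0
  refine hW.false_of_curve hc.1 ha (grow_zero m θ) (contDiffAt_grow m hc0) (fun t => ?_)
    (nhdsWithin_le_nhds (eventually_grow_mem hθ hc ha hz.val_zero_eq m))
    ((hlim.eventually_ne hc0).mono fun t => edge_grow m) (hz.hasDerivAt_tri_grow hc0)
    (half_pos (mul_pos one_half_pos hpos)) ?_
  · simpa [grow, val] using hz.val_zero_eq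
  · have hslope := (hasDerivAt_ent_grow m hc0 ha hz.val_zero_eq).tendsto_slope_zero_right
    filter_upwards [hslope.eventually_const_lt (half_lt_self (mul_pos one_half_pos hpos)),
      self_mem_nhdsWithin] with t ht ht0
    simp only [zero_add, grow_zero, smul_eq_mul] at ht
    rw [lt_inv_mul_iff₀ ht0] at ht
    linarith

/-- Otherwise letting the pair gain mass would gain entropy. -/
theorem WeakExtremal.false_of_joined (hm : 1 ≤ m) (hW : WeakExtremal m θ)
    (hz : TriStationary m θ) (hθ : θ ∈ Icc (0 : Shape) 1) (hc : θ.c ∈ Ioo (0 : ℝ) 1)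
    (ha : θ.val 0 ∈ Ioo (0 : ℝ) 1) (hd : θ.val 2 = 1) (hb : θ.val 3 = 0)
    (hp : (m = 1 ∨ θ.val 4 = 1) ∧ (1 - θ.c) / m < θ.c ∨
      θ.val 4 = θ.val 0 ∧ m * ((1 - θ.c) / m) ≤ θ.c) : False := by
  have hle := hW.sum_weightDeriv_mul_nonpos hz hθ hc ha
  set q := (1 - θ.c) / m
  have hm0 : (0 : ℝ) < m := by positivity
  have hmq : m * q = 1 - θ.c := mul_div_cancel₀ _ hm0.ne'
  have hq0 : 0 < q := div_pos (sub_pos.2 hc.2) hm0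
  have hlog : 0 < -log (1 - θ.val 0) :=
    neg_pos.2 (Real.log_neg (sub_pos.2 ha.2) (sub_lt_self 1 ha.1))
  have hlog' : 0 < -log (θ.val 0) := neg_pos.2 (Real.log_neg ha.1 ha.2)
  have hH : binEntropy (θ.val 0) - binEntropyDeriv (θ.val 0) * θ.val 0 = -log (1 - θ.val 0) := by
    rw [Real.binEntropy_eq_negMulLog_add_negMulLog_one_sub, Real.negMulLog, Real.negMulLog,
      binEntropyDeriv]
    ring
  have hw4 : -2 * (1 - θ.c) * (m - 1) / m = -2 * (1 - θ.c - q) := by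
    rw [← hmq]
    field_simp
  simp only [Fin.sum_univ_five, weightDeriv, Matrix.cons_val, ← hz.val_zero_eq, hH, hd, hb, hw4,
    Real.binEntropy_one, Real.binEntropy_zero, mul_zero, sub_zero, add_zero] at hle
  rcases hp with ⟨hm1 | hp, hlt⟩ | ⟨hp, hle'⟩
  · have hqc : q = 1 - θ.c := by rw [← hmq, hm1, Nat.cast_one, one_mul]
    have := mul_pos (hqc ▸ hq0) hlog
    have := mul_pos (sub_pos.2 (hqc ▸ hlt)) hlog'
    rw [hqc, sub_self, binEntropyDeriv] at hle
    linarith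
  · have := mul_pos hq0 hlog
    have := mul_pos (sub_pos.2 hlt) hlog'
    rw [hp, Real.binEntropy_one, binEntropyDeriv] at hle
    linarith
  · have := mul_pos hq0 hlog
    have := mul_nonneg (sub_nonneg.2 (hmq ▸ hle')) hlog'.le
    rw [hp, hH, binEntropyDeriv] at hle
    linarith

/-- Compare with the bipartite graphon of value `2 * ε`, which has no triangles. -/
theorem Extremal.binEntropy_two_mul_div_four_le {ε τ S : ℝ} (hE : Extremal m ε τ S)
    (hε : 0 ≤ ε) (hε' : 2 * ε ≤ 1) (hτ : 0 ≤ τ) : binEntropy (2 * ε) / 4 ≤ S := by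
  set η : Shape := (1, ![0, 2 * ε, 0, 0, 0])
  have hη : η ∈ Icc (0 : Shape) 1 := mem_Icc ⟨zero_le_one, le_rfl⟩ fun j => by
    fin_cases j <;> simp [η, val, hε, hε']
  have hedge : η.edge m = ε := by
    simp only [η, edge, c, val, Fin.sum_univ_five, weight, Matrix.cons_val]
    ring
  have htri : η.tri m = 0 := by
    simp only [η, tri, c, val, Fin.sum_univ_five, weight, codegree, Matrix.cons_val]
    ring
  have hent : η.ent m = binEntropy (2 * ε) / 4 := by
    simp only [η, ent, c, val, Fin.sum_univ_five, weight, Matrix.cons_val, Real.binEntropy_zero]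
    ring
  exact hent ▸ hE.ent_le η hη hedge (htri.trans_le hτ)

theorem false_of_isolated {ι : Type*} {l : Filter ι} [l.NeBot] {θ : ι → Shape} {z : Shape}
    (hθ : ∀ n, θ n ∈ Icc (0 : Shape) 1)
    (hE : ∀ n, Extremal 2 ((θ n).edge 2) ((θ n).tri 2) ((θ n).ent 2)) (hlim : Tendsto θ l (𝓝 z))
    (hc : z.c ∈ Ioo (0 : ℝ) 1) (hz : ∀ j ≠ 4, z.val j = 0) (hp : z.val 4 ∈ Ioc (0 : ℝ) 1) :
    False := by
  set w := (1 - z.c) ^ 2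
  have hw : w ∈ Ioo (0 : ℝ) 1 := ⟨pow_pos (sub_pos.2 hc.2) 2,
    pow_lt_one₀ (sub_nonneg.2 hc.2.le) (sub_lt_self 1 hc.1) two_ne_zero⟩
  have hz0 := hz 0 (by decide)
  have hz1 := hz 1 (by decide)
  have hz2 := hz 2 (by decide)
  have hz3 := hz 3 (by decide)
  have hedge : 2 * z.edge 2 = w * z.val 4 := by
    simp only [edge, Fin.sum_univ_five, weight, Matrix.cons_val, hz0, hz1, hz2, hz3, w]
    push_cast
    ring
  have hent : z.ent 2 = w * binEntropy (z.val 4) / 4 := by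
    simp only [ent, Fin.sum_univ_five, weight, Matrix.cons_val, hz0, hz1, hz2, hz3,
      Real.binEntropy_zero, w]
    push_cast
    ring
  have hconc : w * binEntropy (z.val 4) < binEntropy (w * z.val 4) := by
    simpa using Real.strictConcave_binEntropy.2 ⟨hp.1.le, hp.2⟩
      (left_mem_Icc.2 (zero_le_one (α := ℝ))) hp.1.ne' hw.1 (sub_pos.2 hw.2)
      (add_sub_cancel w 1)
  have hlim_edge : Tendsto (fun n => 2 * (θ n).edge 2) l (𝓝 (w * z.val 4)) :=
    hedge ▸ (((contDiff_edge 2).continuous.tendsto z).comp hlim).const_mul 2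
  have hlim_ent := ((continuous_ent 2).tendsto z).comp hlim
  have hlim_bip := ((Real.binEntropy_continuous.tendsto _).comp hlim_edge).div_const 4
  obtain ⟨n, hlt, hle⟩ := ((hlim_ent.eventually_lt hlim_bip (by rw [hent]; linarith)).and
    (hlim_edge.eventually_lt_const (mul_lt_one_of_nonneg_of_lt_one_left hw.1.le hw.2 hp.2))).exists
  exact hlt.not_ge <| (hE n).binEntropy_two_mul_div_four_le (edge_mem one_le_two (hθ n)).1 hle.le
    (tri_nonneg one_le_two (hθ n))

theorem false_of_merging {ι : Type*} {l : Filter ι} [l.NeBot] (hm : 1 ≤ m) {θ : ι → Shape}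
    {z : Shape} (hlim : Tendsto θ l (𝓝 z)) (hc : ∀ n, (θ n).c ∈ Ioo (0 : ℝ) 1)
    (hv : ∀ n j, (θ n).val j ∈ Ioo (0 : ℝ) 1) (hne : ∀ n, (θ n).val 0 ≠ (θ n).val 1)
    (hE : ∀ n, Extremal m ((θ n).edge m) ((θ n).tri m) ((θ n).ent m))
    (hzc : z.c ∈ Ioo (0 : ℝ) 1) (h01 : z.val 0 = z.val 1) (hbp : 2 ≤ m → z.val 3 ≠ z.val 4)
    (hconst : m = 1 → ¬(z.val 0 = z.val 2 ∧ z.val 3 = z.val 2))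
    (hA : ¬(z.c = (1 - z.c) / m ∧ z.val 0 = z.val 3 ∧ (2 ≤ m → z.val 2 = z.val 4))) : False := by
  have hmem : ∀ n, θ n ∈ Icc (0 : Shape) 1 := fun n =>
    mem_Icc (Ioo_subset_Icc_self (hc n)) fun j => Ioo_subset_Icc_self (hv n j)
  have hz : z ∈ Icc (0 : Shape) 1 := isClosed_Icc.mem_of_tendsto hlim (.of_forall hmem)
  have hstat := triStationary_of_tendsto hm hlim hE hc hv hne h01
  have hW := weakExtremal_of_tendsto hlim hE
  have hfree : 0 < z.val 0 → z.val 0 < 1 →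
      (z.codegree m 3 = z.codegree m 0 → z.val 3 = z.val 0) ∧
        (2 ≤ m → z.codegree m 4 = z.codegree m 0 → z.val 4 = z.val 0) := fun h0 h1 =>
    ⟨hW.val_eq hm hz hzc.1 ⟨h0, h1⟩ h01 (weight_pos hm hzc (.inl (by decide))),
      fun h2 => hW.val_eq hm hz hzc.1 ⟨h0, h1⟩ h01 (weight_pos hm hzc (.inr h2))⟩
  rcases (hstat.mergedSystem hm hz hzc).classification hconst hbp hfree hA with
    ⟨rfl, ha, hd, hb, hp⟩ | ⟨ha0, ha1, hd, hb, hp⟩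
  · refine false_of_isolated hmem hE hlim hzc (fun j hj => ?_) ⟨hp, (val_mem hz 4).2⟩
    have ha' := h01 ▸ ha
    fin_cases j
    exacts [ha, ha', hd, hb, absurd rfl hj]
  · exact hW.false_of_joined hm hstat hz hzc ⟨ha0, ha1⟩ hd hb (hp.imp_right And.right)

end Shape

/-! ### Multipodal graphons -/

namespace Graphon

section Integrals

variable {ι : Type} [Fintype ι] {κ : I → ι}

theorem integral_comp_pode (hκ : ∀ i, MeasurableSet (κ ⁻¹' {i})) (f : ι → ℝ) :
    ∫ x, f (κ x) = ∑ i, (volume : Measure I).real (κ ⁻¹' {i}) * f i := by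
  let _ : MeasurableSpace ι := ⊤
  have hκm : Measurable κ := measurable_to_countable' hκ
  rw [← integral_map hκm.aemeasurable measurable_from_top.aestronglyMeasurable,
    integral_fintype Integrable.of_finite]
  exact Finset.sum_congr rfl fun i _ => by
    rw [map_measureReal_apply hκm (MeasurableSet.singleton i), smul_eq_mul]

theorem IsMultipodal.integral_comp_eq {g : Graphon} {w : ι → ℝ} {P : ι → ι → ℝ}
    (h : IsMultipodal g w P) (f : ℝ → ℝ) :
    ∫ x, ∫ y, f (g.toFun x y) = ∑ i, ∑ j, w i * w j * f (P i j) := by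
  obtain ⟨κ, hκ, hw, hP⟩ := h
  have inner : ∀ᵐ x : I, ∫ y, f (g.toFun x y) = ∑ j, w j * f (P (κ x) j) := by
    filter_upwards [Measure.ae_ae_of_ae_prod hP] with x hx
    simp only [← hw, ← integral_comp_pode hκ fun j => f (P (κ x) j)]
    exact integral_congr_ae (hx.mono fun y hy => by simp only [hy])
  rw [integral_congr_ae inner, integral_comp_pode hκ fun i => ∑ j, w j * f (P i j)]
  simp only [hw, Finset.mul_sum, mul_assoc]

variable {g : Graphon} {w : ι → ℝ} {P : ι → ι → ℝ}

theorem IsMultipodal.edgeDensity_eq (h : IsMultipodal g w P) :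
    g.edgeDensity = ∑ i, ∑ j, w i * w j * P i j :=
  h.integral_comp_eq id

theorem IsMultipodal.entropy_eq (h : IsMultipodal g w P) :
    g.entropy = 1 / 2 * ∑ i, ∑ j, w i * w j * binEntropy (P i j) := by
  have hneg : ∀ u : ℝ, u * log u + (1 - u) * log (1 - u) = -binEntropy u := fun u => by
    rw [Real.binEntropy_eq_negMulLog_add_negMulLog_one_sub, Real.negMulLog, Real.negMulLog]
    ring
  rw [entropy, ← h.integral_comp_eq]
  simp only [hneg, integral_neg]
  ring

theorem IsMultipodal.triangleDensity_eq (h : IsMultipodal g w P) :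
    g.triangleDensity = ∑ i, ∑ j, w i * w j * (P i j * ∑ k, w k * (P j k * P k i)) := by
  obtain ⟨κ, hκ, hw, hP⟩ := h
  have hrow : ∀ᵐ x : I, ∀ᵐ y : I, g.toFun x y = P (κ x) (κ y) := Measure.ae_ae_of_ae_prod hP
  have hcol : ∀ᵐ x : I, ∀ᵐ y : I, g.toFun y x = P (κ y) (κ x) :=
    Measure.ae_ae_of_ae_prod (Measure.measurePreserving_swap.quasiMeasurePreserving.ae hP)
  have inner : ∀ᵐ x : I, ∀ᵐ y : I, ∫ z, g.toFun x y * g.toFun y z * g.toFun z x =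
      P (κ x) (κ y) * ∑ k, w k * (P (κ y) k * P k (κ x)) := by
    filter_upwards [hrow, hcol] with x hx hx'
    filter_upwards [hx, hrow] with y hxy hy
    simp only [hxy, mul_assoc, ← hw, integral_const_mul,
      ← integral_comp_pode hκ fun k => P (κ y) k * P k (κ x)]
    congr 1
    refine integral_congr_ae ?_
    filter_upwards [hy, hx'] with z hyz hzx
    rw [hyz, hzx]
  have middle : ∀ᵐ x : I, ∫ y, ∫ z, g.toFun x y * g.toFun y z * g.toFun z x =
      ∑ j, w j * (P (κ x) j * ∑ k, w k * (P j k * P k (κ x))) := by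
    filter_upwards [inner] with x hx
    rw [integral_congr_ae hx,
      integral_comp_pode hκ fun j => P (κ x) j * ∑ k, w k * (P j k * P k (κ x))]
    simp only [hw]
  rw [triangleDensity, integral_congr_ae middle, integral_comp_pode hκ fun i =>
    ∑ j, w j * (P i j * ∑ k, w k * (P j k * P k i))]
  simp only [hw]
  exact Finset.sum_congr rfl fun i _ => by rw [Finset.mul_sum]; simp only [mul_assoc]

end Integrals

section Podes

variable {ι : Type} {g : Graphon} {w : ι → ℝ} {P : ι → ι → ℝ}

theorem IsMultipodal.value_mem (h : IsMultipodal g w P) {i j : ι} (hi : 0 < w i) (hj : 0 < w j) :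
    P i j ∈ Icc (0 : ℝ) 1 := by
  obtain ⟨κ, -, hw, hP⟩ := h
  have hfreq : ∀ i, 0 < w i → ∃ᵐ x : I, κ x = i := fun i hi => by
    have hvol : volume (κ ⁻¹' {i}) ≠ 0 := fun h0 => by
      rw [← hw, measureReal_def, h0, ENNReal.toReal_zero] at hi
      exact hi.false
    exact frequently_ae_mem_iff.2 hvol
  obtain ⟨x, rfl, hx⟩ := ((hfreq i hi).and_eventually (Measure.ae_ae_of_ae_prod hP)).exists
  obtain ⟨y, rfl, hxy⟩ := ((hfreq j hj).and_eventually hx).exists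
  rw [← hxy]
  exact ⟨g.nonneg' x y, g.le_one' x y⟩

theorem IsMultipodal.reindex {ι' : Type} (h : IsMultipodal g w P) (e : ι' ≃ ι) :
    IsMultipodal g (w ∘ e) fun i j => P (e i) (e j) := by
  obtain ⟨κ, hκ, hw, hP⟩ := h
  have hpre : ∀ i, (e.symm ∘ κ) ⁻¹' {i} = κ ⁻¹' {e i} := fun i => by
    ext x
    simp only [mem_preimage, Function.comp_apply, mem_singleton_iff, Equiv.symm_apply_eq]
  refine ⟨e.symm ∘ κ, fun i => hpre i ▸ hκ _, fun i => hpre i ▸ hw _, hP.mono fun z hz => ?_⟩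
  simpa only [Function.comp_apply, Equiv.apply_symm_apply] using hz

theorem exists_podes [Fintype ι] (hw : ∀ i, 0 ≤ w i) (hsum : ∑ i, w i = 1) :
    ∃ κ : I → ι, (∀ i, MeasurableSet (κ ⁻¹' {i})) ∧
      ∀ i, (volume : Measure I).real (κ ⁻¹' {i}) = w i := by
  let _ : MeasurableSpace ι := ⊤
  have : DiscreteMeasurableSpace ι := ⟨fun _ => trivial⟩
  have hsum' : ∑ i, ENNReal.ofReal (w i) = 1 := by
    rw [← ENNReal.ofReal_sum_of_nonneg fun i _ => hw i, hsum, ENNReal.ofReal_one]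
  have : Nonempty ι := (Finset.nonempty_of_sum_ne_zero (hsum ▸ one_ne_zero)).to_type
  obtain ⟨κ, hκ, hmap⟩ := (PMF.ofFintype _ hsum').toMeasure.exists_measurable_map_eq
  refine ⟨κ, fun i => hκ (MeasurableSet.singleton i), fun i => ?_⟩
  rw [← map_measureReal_apply hκ (MeasurableSet.singleton i), hmap, measureReal_def,
    PMF.toMeasure_apply_singleton _ _ (MeasurableSet.singleton i), PMF.ofFintype_apply,
    ENNReal.toReal_ofReal (hw i)]

theorem exists_isMultipodal [Fintype ι] (hw : ∀ i, 0 ≤ w i) (hsum : ∑ i, w i = 1)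
    (hP : ∀ i j, P i j ∈ Icc (0 : ℝ) 1) (hsymm : ∀ i j, P i j = P j i) :
    ∃ g : Graphon, IsMultipodal g w P := by
  obtain ⟨κ, hκ, hvol⟩ := exists_podes hw hsum
  let _ : MeasurableSpace ι := ⊤
  have hκm : Measurable κ := measurable_to_countable' hκ
  have : DiscreteMeasurableSpace ι := ⟨fun _ => trivial⟩
  have hPm : Measurable (Function.uncurry P) := Measurable.of_discrete
  exact ⟨⟨fun x y => P (κ x) (κ y),
    hPm.comp ((hκm.comp measurable_fst).prodMk (hκm.comp measurable_snd)),
    fun x y => hsymm _ _, fun x y => (hP _ _).1, fun x y => (hP _ _).2⟩, κ, hκ, hvol,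
    Eventually.of_forall fun z => rfl⟩

variable {r m : ℕ} {c : ℝ}

theorem podeSize_pos (hr : 1 ≤ r) (hm : 1 ≤ m) (hc : c ∈ Ioo (0 : ℝ) 1) (i : Fin r ⊕ Fin m) :
    0 < podeSize r m c i := by
  have hc0 : 0 < c := hc.1
  have hc1 : 0 < 1 - c := sub_pos.2 hc.2
  rcases i with i | i <;> simp only [podeSize] <;> positivity

theorem podeSize_nonneg (hc : c ∈ Icc (0 : ℝ) 1) (i : Fin r ⊕ Fin m) : 0 ≤ podeSize r m c i := by
  have hc0 : 0 ≤ c := hc.1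
  have hc1 : 0 ≤ 1 - c := sub_nonneg.2 hc.2
  rcases i with i | i <;> simp only [podeSize] <;> positivity

theorem sum_podeSize (hr : 1 ≤ r) (hm : 1 ≤ m) (c : ℝ) : ∑ i, podeSize r m c i = 1 := by
  have hm0 : (m : ℝ) ≠ 0 := by positivity
  have hr0 : (r : ℝ) ≠ 0 := by positivity
  simp only [Fintype.sum_sum_type, podeSize, Finset.sum_const, Finset.card_univ, Fintype.card_fin,
    nsmul_eq_mul, mul_div_cancel₀ _ hm0, mul_div_cancel₀ _ hr0, add_sub_cancel]

theorem continuous_podeSize (i : Fin r ⊕ Fin m) : Continuous fun c => podeSize r m c i := by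
  rcases i with i | i <;> simp only [podeSize, div_eq_mul_inv] <;> fun_prop

end Podes

section Shapes

variable {m : ℕ} {g : Graphon} {θ : Shape}

/-- The index in `Shape.val` of the block between two podes. -/
def podeBlock {r m : ℕ} : Fin r ⊕ Fin m → Fin r ⊕ Fin m → Fin 5
  | Sum.inl i, Sum.inl j => if i = j then 0 else 1
  | Sum.inl _, Sum.inr _ => 2
  | Sum.inr _, Sum.inl _ => 2
  | Sum.inr i, Sum.inr j => if i = j then 3 else 4

theorem podeBlock_comm {r m : ℕ} (i j : Fin r ⊕ Fin m) : podeBlock i j = podeBlock j i := by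
  rcases i with i | i <;> rcases j with j | j <;> simp only [podeBlock, eq_comm]

theorem podeValue_eq_podeBlock {r m : ℕ} (a₁ a₂ d b p : ℝ) (i j : Fin r ⊕ Fin m) :
    podeValue r m a₁ a₂ d b p i j = ![a₁, a₂, d, b, p] (podeBlock i j) := by
  rcases i with i | i <;> rcases j with j | j <;> simp only [podeBlock, podeValue] <;>
    (try split_ifs) <;> rfl

/-- The matrix of values between the podes of a graphon with parameters `θ`, for `r` podes in the
first group; `val 1` does not occur in it when `r = 1`. -/
def podeMatrix (r m : ℕ) (θ : Shape) (i j : Fin r ⊕ Fin m) : ℝ := θ.val (podeBlock i j)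

/-- The graphon `g` has a pair of interchangeable podes and `m` other interchangeable podes, with
parameters `θ`. -/
def HasShape (m : ℕ) (g : Graphon) (θ : Shape) : Prop :=
  IsMultipodal g (podeSize 2 m θ.c) (podeMatrix 2 m θ)

theorem sum_ite_eq_fin (i : Fin m) (x y : ℝ) :
    ∑ k, (if i = k then x else y) = x + (m - 1) * y := by
  have hsplit : ∀ k : Fin m, (if i = k then x else y) = y + if i = k then x - y else 0 :=
    fun k => by split_ifs <;> ring
  simp only [hsplit, Finset.sum_add_distrib, Finset.sum_const, Finset.card_univ, Fintype.card_fin,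
    nsmul_eq_mul, Finset.sum_ite_eq, Finset.mem_univ, if_true]
  ring

theorem sum_ite_eq_fin' (i : Fin m) (x y : ℝ) :
    ∑ k, (if k = i then x else y) = x + (m - 1) * y := by
  simp only [eq_comm (b := i), sum_ite_eq_fin]

theorem sum_ite_eq_mul_ite_eq_fin (i j : Fin m) (x y : ℝ) :
    ∑ k, (if i = k then x else y) * (if k = j then x else y) =
      if i = j then x ^ 2 + (m - 1) * y ^ 2 else 2 * x * y + (m - 2) * y ^ 2 := by
  have hsplit : ∀ k : Fin m, (if i = k then x else y) * (if k = j then x else y) =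
      y * (if i = k then x else y) + if k = j then (x - y) * (if i = k then x else y) else 0 :=
    fun k => by split_ifs <;> ring
  simp only [hsplit, Finset.sum_add_distrib, ← Finset.mul_sum, sum_ite_eq_fin, Finset.sum_ite_eq',
    Finset.mem_univ, if_true]
  split_ifs <;> ring

theorem sum_podeBlock (hm : 1 ≤ m) (c : ℝ) (f : Fin 5 → ℝ) :
    ∑ i, ∑ j, podeSize 2 m c i * podeSize 2 m c j * f (podeBlock i j) =
      ∑ j, Shape.weight m c j * f j := by
  have hm0 : (m : ℝ) ≠ 0 := by positivity
  simp only [Fintype.sum_sum_type, Fin.sum_univ_two, podeSize, podeBlock, ← Finset.mul_sum,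
    apply_ite f, sum_ite_eq_fin, Finset.sum_const, Finset.card_univ, Fintype.card_fin,
    nsmul_eq_mul, Fin.sum_univ_five, Shape.weight, Matrix.cons_val, zero_ne_one, one_ne_zero,
    if_true, if_false, Nat.cast_ofNat]
  field_simp
  ring

theorem sum_podeSize_mul_podeMatrix (hm : 1 ≤ m) (θ : Shape) (i j : Fin 2 ⊕ Fin m) :
    ∑ k, podeSize 2 m θ.c k * (podeMatrix 2 m θ j k * podeMatrix 2 m θ k i) =
      θ.codegree m (podeBlock i j) := by
  have hm0 : (m : ℝ) ≠ 0 := by positivity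
  rw [podeBlock_comm i j]
  rcases i with i | i <;> rcases j with j | j <;>
    simp only [Fintype.sum_sum_type, podeSize, podeMatrix, podeBlock, apply_ite θ.val,
      ← Finset.mul_sum, ← Finset.sum_mul, sum_ite_eq_mul_ite_eq_fin, sum_ite_eq_fin,
      sum_ite_eq_fin', Finset.sum_const, Finset.card_univ, Fintype.card_fin, nsmul_eq_mul,
      Nat.cast_ofNat] <;>
    (try split_ifs) <;> simp only [Shape.codegree, Matrix.cons_val] <;> field_simp <;> ring

theorem HasShape.edgeDensity_eq (hm : 1 ≤ m) (h : HasShape m g θ) : g.edgeDensity = θ.edge m :=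
  (IsMultipodal.edgeDensity_eq h).trans (sum_podeBlock hm θ.c θ.val)

theorem HasShape.entropy_eq (hm : 1 ≤ m) (h : HasShape m g θ) : g.entropy = θ.ent m :=
  (IsMultipodal.entropy_eq h).trans <| congrArg (1 / 2 * ·) <|
    sum_podeBlock hm θ.c fun j => binEntropy (θ.val j)

theorem HasShape.triangleDensity_eq (hm : 1 ≤ m) (h : HasShape m g θ) :
    g.triangleDensity = θ.tri m := by
  rw [IsMultipodal.triangleDensity_eq h]
  simp only [sum_podeSize_mul_podeMatrix hm]
  exact sum_podeBlock hm θ.c fun j => θ.val j * θ.codegree m j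

theorem exists_hasShape (hm : 1 ≤ m) (hθ : θ ∈ Icc (0 : Shape) 1) :
    ∃ g : Graphon, HasShape m g θ :=
  exists_isMultipodal (podeSize_nonneg (Shape.c_mem hθ)) (sum_podeSize one_le_two hm θ.c)
    (fun _ _ => Shape.val_mem hθ _) fun i j => congrArg θ.val (podeBlock_comm i j)

end Shapes

/-! ### Couplings and the cut metric -/

theorem le_cutMetric {f g : I → I → ℝ} {C : ℝ} (hfg : ∀ x y, |f x y - g x y| ≤ C) {S T : Set I}
    (hS : MeasurableSet S) (hT : MeasurableSet T) :
    |∫ x in S, ∫ y in T, (f x y - g x y)| ≤ cutMetric f g := by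
  refine le_csSup ⟨C, ?_⟩ ⟨S, T, hS, hT, rfl⟩
  have hC : 0 ≤ C := (abs_nonneg _).trans (hfg 0 0)
  have hbound : ∀ {u : I → ℝ} (R : Set I), (∀ x, |u x| ≤ C) → |∫ x in R, u x| ≤ C := fun {u} R hu =>
    (norm_setIntegral_le_of_norm_le_const (f := u) (measure_lt_top volume R) fun x _ => hu x).trans
      (mul_le_of_le_one_right hC measureReal_le_one)
  rintro _ ⟨S, T, -, -, rfl⟩
  exact hbound S fun x => hbound T (hfg x)

theorem abs_toFun_sub_le_one (f g : Graphon) (x y z t : I) : |f.toFun x y - g.toFun z t| ≤ 1 :=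
  abs_sub_le_iff.2 ⟨by linarith [f.le_one' x y, g.nonneg' z t],
    by linarith [f.nonneg' x y, g.le_one' z t]⟩

/-- The representative `g(φ x, φ y)` of the reduced graphon of `g`. -/
def comp (g : Graphon) (φ : I → I) (hφ : Measurable φ) : Graphon where
  toFun x y := g.toFun (φ x) (φ y)
  measurable' := g.measurable'.comp ((hφ.comp measurable_fst).prodMk (hφ.comp measurable_snd))
  symm' _ _ := g.symm' _ _
  nonneg' _ _ := g.nonneg' _ _
  le_one' _ _ := g.le_one' _ _

theorem IsMultipodal.comp {ι : Type} {g : Graphon} {w : ι → ℝ} {P : ι → ι → ℝ}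
    (h : IsMultipodal g w P) {φ : I → I} (hφ : MeasurePreserving φ volume volume) :
    IsMultipodal (g.comp φ hφ.measurable) w P := by
  obtain ⟨κ, hκ, hw, hP⟩ := h
  refine ⟨κ ∘ φ, fun i => hφ.measurable (hκ i), fun i => ?_,
    (hφ.prod hφ).quasiMeasurePreserving.ae hP⟩
  rw [preimage_comp, hφ.measureReal_preimage (hκ i).nullMeasurableSet, hw]

/-- A coupling `M` of the pode sizes `w` and `w'` under which the values `P` and `P'` between
coupled podes differ by at most `η`, in the cut-norm sense: the difference is weighted by the
masses. -/
structure IsCoupling {ι ι' : Type} [Fintype ι] [Fintype ι'] (η : ℝ) (w : ι → ℝ) (P : ι → ι → ℝ)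
    (w' : ι' → ℝ) (P' : ι' → ι' → ℝ) (M : ι → ι' → ℝ) : Prop where
  nonneg : ∀ i j, 0 ≤ M i j
  row : ∀ i, ∑ j, M i j = w i
  col : ∀ j, ∑ i, M i j = w' j
  val : ∀ i j k l, M i j * M k l * |P i k - P' j l| ≤ η

/-- A map `π` on podes which glues podes with the same values. -/
structure IsMerging {ι ι' : Type} [Fintype ι] [DecidableEq ι'] (w : ι → ℝ) (P : ι → ι → ℝ)
    (w' : ι' → ℝ) (P' : ι' → ι' → ℝ) (π : ι → ι') : Prop where
  surjective : Function.Surjective π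
  val : ∀ i k, P i k = P' (π i) (π k)
  size : ∀ j, w' j = ∑ i, if π i = j then w i else 0

theorem IsMerging.eq_iff {ι ι' : Type} [Fintype ι] [DecidableEq ι'] {w : ι → ℝ} {P : ι → ι → ℝ}
    {w' : ι' → ℝ} {P' : ι' → ι' → ℝ} {π : ι → ι'} (h : IsMerging w P w' P' π)
    (hinj : Function.Injective P') {i k : ι} : π i = π k ↔ P i = P k := by
  refine ⟨fun hik => funext fun l => by rw [h.val, h.val, hik], fun hik => hinj ?_⟩
  funext j
  obtain ⟨l, rfl⟩ := h.surjective j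
  rw [← h.val, ← h.val, hik]

section Coupling

variable {ι ι' : Type} [Fintype ι] [Fintype ι'] {f g : Graphon} {w : ι → ℝ} {P : ι → ι → ℝ}
  {w' : ι' → ℝ} {P' : ι' → ι' → ℝ} {M : ι → ι' → ℝ} {η : ℝ}

theorem sum_measureReal_inter_pode {κ : I → ι} (hκ : ∀ i, MeasurableSet (κ ⁻¹' {i})) (s : Set I) :
    ∑ i, (volume : Measure I).real (κ ⁻¹' {i} ∩ s) = (volume : Measure I).real s := by
  have hsum := sum_measureReal_preimage_singleton (μ := volume.restrict s) Finset.univ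
    (f := κ) fun i _ => hκ i
  simpa only [Finset.coe_univ, preimage_univ, measureReal_restrict_apply_univ,
    measureReal_restrict_apply (hκ _)] using hsum

theorem setIntegral_setIntegral_const {u : I → I → ℝ} {A B : Set I} (hA : MeasurableSet A)
    (hB : MeasurableSet B) {v : ℝ} (h : ∀ᵐ x : I, ∀ᵐ y : I, x ∈ A → y ∈ B → u x y = v) :
    ∫ x in A, ∫ y in B, u x y =
      (volume : Measure I).real A * (volume : Measure I).real B * v := by
  have inner : ∀ᵐ x : I, x ∈ A → ∫ y in B, u x y = (volume : Measure I).real B * v := by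
    filter_upwards [h] with x hx hxA
    rw [setIntegral_congr_ae hB (hx.mono fun y hy => hy hxA), setIntegral_const, smul_eq_mul]
  rw [setIntegral_congr_ae hA inner, setIntegral_const, smul_eq_mul, mul_assoc]

theorem exists_isCoupling_cutMetric (hf : IsMultipodal f w P) (hg : IsMultipodal g w' P') :
    ∃ M, IsCoupling (cutMetric f.toFun g.toFun) w P w' P' M := by
  obtain ⟨κ, hκ, hw, hP⟩ := hf
  obtain ⟨κ', hκ', hw', hP'⟩ := hg
  have hK : ∀ i j, MeasurableSet (κ ⁻¹' {i} ∩ κ' ⁻¹' {j}) := fun i j => (hκ i).inter (hκ' j)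
  refine ⟨fun i j => (volume : Measure I).real (κ ⁻¹' {i} ∩ κ' ⁻¹' {j}),
    fun _ _ => measureReal_nonneg, fun i => ?_, fun j => ?_, fun i j k l => ?_⟩
  · simp only [inter_comm (κ ⁻¹' {i}), sum_measureReal_inter_pode hκ', hw]
  · rw [sum_measureReal_inter_pode hκ, hw']
  · have hval : ∀ᵐ x : I, ∀ᵐ y : I, x ∈ κ ⁻¹' {i} ∩ κ' ⁻¹' {j} → y ∈ κ ⁻¹' {k} ∩ κ' ⁻¹' {l} →
        f.toFun x y - g.toFun x y = P i k - P' j l := by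
      filter_upwards [Measure.ae_ae_of_ae_prod hP, Measure.ae_ae_of_ae_prod hP'] with x hx hx'
      filter_upwards [hx, hx'] with y hy hy'
      rintro ⟨rfl, rfl⟩ ⟨rfl, rfl⟩
      rw [hy, hy']
    have hcut := le_cutMetric (fun x y => abs_toFun_sub_le_one f g x y x y) (hK i j) (hK k l)
    rwa [setIntegral_setIntegral_const (hK i j) (hK k l) hval, abs_mul,
      abs_of_nonneg (mul_nonneg measureReal_nonneg measureReal_nonneg)] at hcut

theorem exists_isCoupling (hf : IsMultipodal f w P) (hg : IsMultipodal g w' P')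
    (h : cutDist f g < η) : ∃ M, IsCoupling η w P w' P' M := by
  obtain ⟨_, ⟨φ, ψ, hφ, hψ, rfl⟩, hlt⟩ := exists_lt_of_csInf_lt (by
    exact ⟨_, id, id, MeasurePreserving.id _, MeasurePreserving.id _, rfl⟩) h
  obtain ⟨M, hM⟩ := exists_isCoupling_cutMetric (hf.comp hφ) (hg.comp hψ)
  exact ⟨M, hM.nonneg, hM.row, hM.col, fun i j k l => (hM.val i j k l).trans hlt.le⟩

namespace IsCoupling

theorem val_eq (h : IsCoupling 0 w P w' P' M) {i j k l} (hij : 0 < M i j) (hkl : 0 < M k l) :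
    P i k = P' j l :=
  sub_eq_zero.1 <| abs_nonpos_iff.1 <| nonpos_of_mul_nonpos_right (h.val i j k l) (mul_pos hij hkl)

theorem exists_row_pos (h : IsCoupling η w P w' P' M) {j} (hj : 0 < w' j) : ∃ i, 0 < M i j := by
  by_contra! hM
  exact hj.not_ge (h.col j ▸ Finset.sum_nonpos fun i _ => hM i)

theorem exists_col_pos (h : IsCoupling η w P w' P' M) {i} (hi : 0 < w i) : ∃ j, 0 < M i j := by
  by_contra! hM
  exact hi.not_ge (h.row i ▸ Finset.sum_nonpos fun j _ => hM j)

theorem eq_zero (h : IsCoupling η w P w' P' M) {i} (hi : w i = 0) (j) : M i j = 0 :=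
  (Finset.sum_eq_zero_iff_of_nonneg fun j _ => h.nonneg i j).1 ((h.row i).trans hi) j
    (Finset.mem_univ j)

theorem comp_injective {ι₀ : Type} [Fintype ι₀] (h : IsCoupling η w P w' P' M) {e : ι₀ → ι}
    (he : Function.Injective e) (hw : ∀ i ∉ range e, w i = 0) :
    IsCoupling η (w ∘ e) (fun i k => P (e i) (e k)) w' P' (M ∘ e) :=
  ⟨fun i j => h.nonneg (e i) j, fun i => h.row (e i), fun j => (h.col j) ▸
    Fintype.sum_of_injective e he _ _ (fun i hi => h.eq_zero (hw i hi) j) fun _ => rfl,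
    fun i j k l => h.val (e i) j (e k) l⟩

theorem col_unique (h : IsCoupling 0 w P w' P' M) (hw' : ∀ j, 0 < w' j)
    (hinj : Function.Injective P') {i j j'} (hj : 0 < M i j) (hj' : 0 < M i j') : j = j' := by
  refine hinj (funext fun l => ?_)
  obtain ⟨k, hk⟩ := h.exists_row_pos (hw' l)
  rw [← h.val_eq hj hk, ← h.val_eq hj' hk]

theorem exists_isMerging [DecidableEq ι'] (h : IsCoupling 0 w P w' P' M) (hw : ∀ i, 0 < w i)
    (hw' : ∀ j, 0 < w' j) (hinj : Function.Injective P') : ∃ π, IsMerging w P w' P' π := by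
  choose π hπ using fun i => h.exists_col_pos (hw i)
  have hunique : ∀ i j, 0 < M i j → π i = j := fun i j => h.col_unique hw' hinj (hπ i)
  have hM : ∀ i j, M i j = if π i = j then w i else 0 := by
    have hzero : ∀ i j, π i ≠ j → M i j = 0 := fun i j hne =>
      ((h.nonneg i j).eq_or_lt.resolve_right fun hpos => hne (hunique i j hpos)).symm
    intro i j
    split_ifs with hij
    · subst hij
      rw [← h.row i, Finset.sum_eq_single_of_mem (π i) (Finset.mem_univ _)
        fun j _ hj => hzero i j hj.symm]
    · exact hzero i j hij
  refine ⟨π, fun j => ?_, fun i k => h.val_eq (hπ i) (hπ k), fun j => ?_⟩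
  · exact (h.exists_row_pos (hw' j)).imp fun i => hunique i j
  · simp only [← h.col j, hM]

end IsCoupling

end Coupling

section Merging

variable {ι ι' ι'' : Type} [Fintype ι] [DecidableEq ι'] [DecidableEq ι'']
  {w : ι → ℝ} {P : ι → ι → ℝ} {w' : ι' → ℝ} {P' : ι' → ι' → ℝ} {w'' : ι'' → ℝ}
  {P'' : ι'' → ι'' → ℝ}

theorem IsMerging.of_comp [Fintype ι'] {q : ι → ι'} {ρ : ι' → ι''}
    (h : IsMerging w P w'' P'' (ρ ∘ q)) (hq : IsMerging w P w' P' q) :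
    IsMerging w' P' w'' P'' ρ := by
  refine ⟨h.surjective.of_comp, fun i k => ?_, fun j => ?_⟩
  · obtain ⟨i, rfl⟩ := hq.surjective i
    obtain ⟨k, rfl⟩ := hq.surjective k
    rw [← hq.val, h.val, Function.comp_apply, Function.comp_apply]
  · have hfibre : ∀ k, (if ρ k = j then ∑ i, if q i = k then w i else 0 else 0) =
        ∑ i, if q i = k then if ρ k = j then w i else 0 else 0 := fun k => by
      split_ifs <;> simp only [ite_self, Finset.sum_const_zero]
    simp only [h.size, hq.size, hfibre, Function.comp_apply]
    rw [Finset.sum_comm]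
    simp only [Finset.sum_ite_eq, Finset.mem_univ, if_true]

theorem IsMerging.injective {π : ι → ι'} (h : IsMerging w P w' P' π)
    (hinj : Function.Injective P') (hπ : Function.Injective π) : Function.Injective P :=
  fun _ _ hik => hπ ((h.eq_iff hinj).2 hik)

theorem IsMerging.isMultipodal {g : Graphon} {π : ι → ι'} (h : IsMerging w P w' P' π)
    (hπ : Function.Injective π) (hg : IsMultipodal g w' P') : IsMultipodal g w P := by
  have hw : w' ∘ π = w := funext fun i => by
    classical
    simp only [Function.comp_apply, h.size, hπ.eq_iff, Finset.sum_ite_eq', Finset.mem_univ, if_true]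
  have hP : (fun i k => P' (π i) (π k)) = P := funext₂ fun i k => (h.val i k).symm
  exact hw ▸ hP ▸ hg.reindex (Equiv.ofBijective π ⟨hπ, h.surjective⟩)

theorem IsMultipodal.isTypeA {κ : Type} [Fintype κ] [DecidableEq κ] {g : Graphon} {n : ℕ}
    {u v : ℝ} (hcard : Fintype.card κ = n)
    (h : IsMultipodal g (fun _ : κ => 1 / (n : ℝ)) fun i j => if i = j then u else v) :
    IsTypeA n g := by
  refine ⟨u, v, ?_⟩
  simpa only [Function.comp_def, EmbeddingLike.apply_eq_iff_eq] using
    h.reindex (Fintype.equivFinOfCardEq hcard).symm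

end Merging

section Rows

variable {r m : ℕ} {θ : Shape}

theorem podeMatrix_inl_eq_iff {i j : Fin r} (hij : i ≠ j) :
    podeMatrix r m θ (Sum.inl i) = podeMatrix r m θ (Sum.inl j) ↔ θ.val 0 = θ.val 1 := by
  refine ⟨fun h => ?_, fun h => funext ?_⟩
  · simpa only [podeMatrix, podeBlock, if_true, if_neg hij.symm] using congrFun h (Sum.inl i)
  · rintro (_ | _) <;> simp only [podeMatrix, podeBlock, apply_ite θ.val, h, ite_self]

theorem podeMatrix_inr_eq_iff {i j : Fin m} (hij : i ≠ j) :
    podeMatrix r m θ (Sum.inr i) = podeMatrix r m θ (Sum.inr j) ↔ θ.val 3 = θ.val 4 := by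
  refine ⟨fun h => ?_, fun h => funext ?_⟩
  · simpa only [podeMatrix, podeBlock, if_true, if_neg hij.symm] using congrFun h (Sum.inr i)
  · rintro (_ | _) <;> simp only [podeMatrix, podeBlock, apply_ite θ.val, h, ite_self]

theorem val_zero_eq_val_one_of_inl_eq_inr {i i' : Fin r} (hi : i ≠ i') {j : Fin m}
    (h : podeMatrix r m θ (Sum.inl i) = podeMatrix r m θ (Sum.inr j)) : θ.val 0 = θ.val 1 := by
  have h0 : θ.val 0 = θ.val 2 := by
    simpa only [podeMatrix, podeBlock, if_true] using congrFun h (Sum.inl i)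
  have h1 : θ.val 1 = θ.val 2 := by
    simpa only [podeMatrix, podeBlock, if_neg hi] using congrFun h (Sum.inl i')
  rw [h0, h1]

theorem val_zero_ne_val_one (hinj : Function.Injective (podeMatrix 2 m θ)) : θ.val 0 ≠ θ.val 1 :=
  fun h => zero_ne_one (Sum.inl_injective (hinj ((podeMatrix_inl_eq_iff zero_ne_one).2 h)))

theorem val_three_ne_val_four (hinj : Function.Injective (podeMatrix r m θ)) (hm : 2 ≤ m) :
    θ.val 3 ≠ θ.val 4 := fun h => by
  have hne : (⟨0, by omega⟩ : Fin m) ≠ ⟨1, hm⟩ := by simp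
  exact hne (Sum.inr_injective (hinj ((podeMatrix_inr_eq_iff hne).2 h)))

theorem not_val_eq_val_two (hinj : Function.Injective (podeMatrix 1 1 θ)) :
    ¬(θ.val 0 = θ.val 2 ∧ θ.val 3 = θ.val 2) := fun h => by
  refine Sum.inl_ne_inr (a := 0) (b := 0) (hinj (funext ?_))
  rintro (j | j) <;>
    simp only [podeMatrix, podeBlock, Subsingleton.elim 0 j, if_true, h]

end Rows

section Limit

variable {m : ℕ} {g₀ : Graphon} {c₀ : ℝ} {P₀ : Fin 1 ⊕ Fin m → Fin 1 ⊕ Fin m → ℝ} {θ : Shape}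

theorem IsCoupling.c_ne_zero (hm : 1 ≤ m) (hc₀ : c₀ ∈ Ioo (0 : ℝ) 1)
    (hinj : Function.Injective P₀) {M : Fin 2 ⊕ Fin m → Fin 1 ⊕ Fin m → ℝ}
    (h : IsCoupling 0 (podeSize 2 m θ.c) (podeMatrix 2 m θ) (podeSize 1 m c₀) P₀ M) :
    θ.c ≠ 0 := by
  intro hc
  have hinl : ∀ i ∉ range (Sum.inr : Fin m → Fin 2 ⊕ Fin m), podeSize 2 m θ.c i = 0 := by
    rintro (i | i) hi
    · rw [podeSize, hc, zero_div]
    · exact absurd (mem_range_self i) hi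
  have hinr : ∀ i, 0 < (podeSize 2 m θ.c ∘ Sum.inr) i := fun i => by
    rw [Function.comp_apply, podeSize, hc, sub_zero]
    exact one_div_pos.2 (by exact_mod_cast hm)
  obtain ⟨π, hπ⟩ := (h.comp_injective Sum.inr_injective hinl).exists_isMerging hinr
    (podeSize_pos le_rfl hm hc₀) hinj
  have hcard := Fintype.card_le_of_surjective π hπ.surjective
  simp only [Fintype.card_sum, Fintype.card_fin] at hcard
  omega

theorem IsCoupling.c_ne_one (hm : 1 ≤ m) (hc₀ : c₀ ∈ Ioo (0 : ℝ) 1)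
    (hinj : Function.Injective P₀) (hg : IsMultipodal g₀ (podeSize 1 m c₀) P₀)
    (hA : ¬IsTypeA (m + 1) g₀) {M : Fin 2 ⊕ Fin m → Fin 1 ⊕ Fin m → ℝ}
    (h : IsCoupling 0 (podeSize 2 m θ.c) (podeMatrix 2 m θ) (podeSize 1 m c₀) P₀ M) :
    θ.c ≠ 1 := by
  intro hc
  have hinr : ∀ i ∉ range (Sum.inl : Fin 2 → Fin 2 ⊕ Fin m), podeSize 2 m θ.c i = 0 := by
    rintro (i | i) hi
    · exact absurd (mem_range_self i) hi
    · rw [podeSize, hc, sub_self, zero_div]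
  have hinl : ∀ i, (podeSize 2 m θ.c ∘ Sum.inl) i = 1 / 2 := fun i => by
    rw [Function.comp_apply, podeSize, hc, Nat.cast_ofNat]
  obtain ⟨π, hπ⟩ := (h.comp_injective Sum.inl_injective hinr).exists_isMerging
    (fun i => by rw [hinl]; exact one_half_pos) (podeSize_pos le_rfl hm hc₀) hinj
  have hcard := Fintype.card_le_of_surjective π hπ.surjective
  simp only [Fintype.card_sum, Fintype.card_fin] at hcard
  obtain rfl : m = 1 := by omega
  have hbij : Function.Bijective π :=
    (Fintype.bijective_iff_surjective_and_card π).2 ⟨hπ.surjective, rfl⟩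
  have hmulti := hπ.isMultipodal hbij.1 hg
  simp only [funext hinl, podeMatrix, podeBlock, apply_ite θ.val] at hmulti
  exact hA (IsMultipodal.isTypeA (Fintype.card_fin 2) (by exact_mod_cast hmulti))

theorem IsMerging.pair_merged_or (hinj : Function.Injective P₀)
    {π : Fin 2 ⊕ Fin m → Fin 1 ⊕ Fin m}
    (h : IsMerging (podeSize 2 m θ.c) (podeMatrix 2 m θ) (podeSize 1 m c₀) P₀ π) :
    π (Sum.inl 0) = π (Sum.inl 1) ∨ m = 2 ∧ ∀ i j, π (Sum.inr i) = π (Sum.inr j) := by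
  refine or_iff_not_imp_left.2 fun h01 => ?_
  have hv : θ.val 0 ≠ θ.val 1 := fun hv =>
    h01 ((h.eq_iff hinj).2 ((podeMatrix_inl_eq_iff zero_ne_one).2 hv))
  have hinl : ∀ x y, π (Sum.inl x) = π (Sum.inl y) → x = y := fun x y hxy => by
    by_contra hne
    exact hv ((podeMatrix_inl_eq_iff hne).1 ((h.eq_iff hinj).1 hxy))
  have hmixed : ∀ x j, π (Sum.inl x) ≠ π (Sum.inr j) := fun x j hxj => by
    obtain ⟨y, hy⟩ := exists_ne x
    exact hv (val_zero_eq_val_one_of_inl_eq_inr hy.symm ((h.eq_iff hinj).1 hxj))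
  obtain ⟨i, j, hij, hne⟩ : ∃ i j, π (Sum.inr i) = π (Sum.inr j) ∧ i ≠ j := by
    by_contra! hinr
    have hcard := Fintype.card_le_of_injective π <| Sum.forall.2
      ⟨fun x => Sum.forall.2 ⟨fun y hxy => congrArg _ (hinl x y hxy),
        fun j hxj => (hmixed x j hxj).elim⟩,
      fun i => Sum.forall.2 ⟨fun x hxi => (hmixed x i hxi.symm).elim,
        fun j hij => congrArg _ (hinr i j hij)⟩⟩
    simp only [Fintype.card_sum, Fintype.card_fin] at hcard
    omega
  have hall : ∀ k l, π (Sum.inr k) = π (Sum.inr l) := fun k l => by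
    obtain rfl | hkl := eq_or_ne k l
    · rfl
    · exact (h.eq_iff hinj).2 ((podeMatrix_inr_eq_iff hkl).2
        ((podeMatrix_inr_eq_iff hne).1 ((h.eq_iff hinj).1 hij)))
  refine ⟨?_, hall⟩
  have hsurj : Function.Surjective (π ∘ Sum.map id fun _ : Fin 1 => i) := fun j => by
    obtain ⟨x | k, rfl⟩ := h.surjective j
    exacts [⟨Sum.inl x, rfl⟩, ⟨Sum.inr 0, hall i k⟩]
  have hcard := Fintype.card_le_of_surjective _ hsurj
  simp only [Fintype.card_sum, Fintype.card_fin] at hcard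
  omega

/-- The map gluing the two podes of the pair. -/
def mergePair (m : ℕ) : Fin 2 ⊕ Fin m → Fin 1 ⊕ Fin m := Sum.map (fun _ => 0) id

theorem isMerging_mergePair (h01 : θ.val 0 = θ.val 1) :
    IsMerging (podeSize 2 m θ.c) (podeMatrix 2 m θ) (podeSize 1 m θ.c) (podeMatrix 1 m θ)
      (mergePair m) := by
  refine ⟨Sum.map_surjective.2
    ⟨fun i => ⟨0, Subsingleton.elim _ _⟩, Function.surjective_id⟩, ?_, ?_⟩
  · rintro (i | i) (k | k) <;>
      simp only [podeMatrix, podeBlock, mergePair, Sum.map_inl, Sum.map_inr, id_eq,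
        apply_ite θ.val, h01, ite_self]
  · rintro (j | j)
    · have hj : ∀ i : Fin 1, i = j := fun i => Subsingleton.elim i j
      simp only [podeSize, mergePair, Fintype.sum_sum_type, Fin.sum_univ_two, Sum.map_inl,
        Sum.map_inr, id_eq, reduceCtorEq, if_false, hj, if_true, Finset.sum_const_zero, add_zero,
        Nat.cast_one, div_one, Nat.cast_ofNat, add_halves]
    · simp only [podeSize, mergePair, Fintype.sum_sum_type, Sum.map_inl, Sum.map_inr, id_eq,
        Sum.inr.injEq, reduceCtorEq, if_false, Finset.sum_const_zero, zero_add,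
        Finset.sum_ite_eq', Finset.mem_univ, if_true]

theorem IsMerging.of_pair_merged (hinj : Function.Injective P₀)
    {π : Fin 2 ⊕ Fin m → Fin 1 ⊕ Fin m}
    (h : IsMerging (podeSize 2 m θ.c) (podeMatrix 2 m θ) (podeSize 1 m c₀) P₀ π)
    (h01 : π (Sum.inl 0) = π (Sum.inl 1)) :
    θ.val 0 = θ.val 1 ∧ ∃ ρ, Function.Injective ρ ∧
      IsMerging (podeSize 1 m θ.c) (podeMatrix 1 m θ) (podeSize 1 m c₀) P₀ ρ := by
  have hv : θ.val 0 = θ.val 1 :=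
    (podeMatrix_inl_eq_iff zero_ne_one).1 ((h.eq_iff hinj).1 h01)
  set ρ : Fin 1 ⊕ Fin m → Fin 1 ⊕ Fin m := Sum.elim (fun _ => π (Sum.inl 0)) (π ∘ Sum.inr)
  have hρ : ρ ∘ mergePair m = π := by
    ext1 (i | i)
    · fin_cases i
      exacts [rfl, h01]
    · rfl
  have hmerging : IsMerging _ _ (podeSize 1 m c₀) P₀ ρ :=
    IsMerging.of_comp (hρ ▸ h) (isMerging_mergePair hv)
  exact ⟨hv, ρ, Finite.injective_iff_surjective.2 hmerging.surjective, hmerging⟩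

theorem IsMultipodal.isTypeA_of_balanced (hm : 1 ≤ m)
    (h : IsMultipodal g₀ (podeSize 1 m θ.c) (podeMatrix 1 m θ)) (hc : θ.c = (1 - θ.c) / m)
    (h03 : θ.val 0 = θ.val 3) (h24 : 2 ≤ m → θ.val 2 = θ.val 4) : IsTypeA (m + 1) g₀ := by
  have hsize : podeSize 1 m θ.c = fun _ => 1 / ((m + 1 : ℕ) : ℝ) := by
    have hm0 : (m : ℝ) ≠ 0 := by positivity
    have hc' : θ.c = 1 / ((m + 1 : ℕ) : ℝ) := by
      rw [eq_div_iff hm0] at hc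
      rw [eq_div_iff (by positivity)]
      push_cast
      linarith
    ext (i | i)
    · rw [podeSize, Nat.cast_one, div_one, hc']
    · rw [podeSize, ← hc, hc']
  have hvalue : podeMatrix 1 m θ = fun i j => if i = j then θ.val 3 else θ.val 2 := by
    ext (i | i) (j | j)
    · simp only [podeMatrix, podeBlock, Subsingleton.elim i j, if_true, h03]
    · rfl
    · rfl
    · obtain rfl | hij := eq_or_ne i j
      · simp only [podeMatrix, podeBlock, if_true]
      · have : Nontrivial (Fin m) := ⟨i, j, hij⟩
        simp only [podeMatrix, podeBlock, Sum.inr.injEq, if_neg hij,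
          h24 (Fin.nontrivial_iff_two_le.1 this)]
  rw [hsize, hvalue] at h
  exact h.isTypeA (by rw [Fintype.card_sum, Fintype.card_fin, Fintype.card_fin, add_comm])

end Limit

end Graphon

/-! ### Differentiability of the maximal entropy -/

theorem exists_differentiableAt_of_monotoneOn {s : ℝ → ℝ} {J : Set ℝ} (hs : MonotoneOn s J)
    (hJ : IsOpen J) (hne : J.Nonempty) : ∃ t ∈ J, DifferentiableAt ℝ s t := by
  obtain ⟨t, ht, hd⟩ := ((frequently_ae_mem_iff.2 (hJ.measure_pos volume hne).ne').and_eventually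
    hs.ae_differentiableWithinAt_of_mem).exists
  exact ⟨t, ht, (hd ht).differentiableAt (hJ.mem_nhds ht)⟩

namespace Shape

variable {m : ℕ} {θ : Shape}

theorem Extremal.of_monotoneOn {s : ℝ → ℝ} {J : Set ℝ} {ε τ : ℝ} (hs : MonotoneOn s J)
    (hJ : J ∈ 𝓝 τ) (hd : DifferentiableAt ℝ s τ)
    (hle : ∀ t ∈ J, ∀ θ ∈ Icc (0 : Shape) 1, θ.edge m = ε → θ.tri m ≤ t → θ.ent m ≤ s t) :
    Extremal m ε τ (s τ) := by
  refine ⟨hle τ (mem_of_mem_nhds hJ), s, deriv s τ, ?_, hd.hasDerivAt, rfl, ?_⟩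
  · rw [← derivWithin_of_mem_nhds hJ]
    exact hs.derivWithin_nonneg
  · filter_upwards [hJ] with t ht θ hθ hedge htri
    exact hle t ht θ hθ hedge htri.le

theorem edge_mem_Ioo (hm : 1 ≤ m) (hθ : θ ∈ Icc (0 : Shape) 1) (hc : θ.c ∈ Ioo 0 1)
    (h01 : θ.val 0 ≠ θ.val 1) (htri : θ.tri m < θ.edge m ^ 3) : θ.edge m ∈ Ioo 0 1 := by
  have hw : ∀ j, 0 ≤ weight m θ.c j := weight_nonneg hm (c_mem hθ)
  refine ⟨(Odd.pow_pos_iff (by decide)).1 ((tri_nonneg hm hθ).trans_lt htri), ?_⟩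
  obtain ⟨j, hj, hlt⟩ : ∃ j : Fin 5, j ≠ 4 ∧ θ.val j < 1 := by
    obtain h0 | h0 := (val_mem hθ 0).2.lt_or_eq
    · exact ⟨0, by decide, h0⟩
    · exact ⟨1, by decide, (val_mem hθ 1).2.lt_of_ne (h0 ▸ h01.symm)⟩
  rw [← sum_weight hm θ.c]
  exact Finset.sum_lt_sum (fun i _ => mul_le_of_le_one_right (hw i) (val_mem hθ i).2)
    ⟨j, Finset.mem_univ j, mul_lt_of_lt_one_right (weight_pos hm hc (Or.inl hj)) hlt⟩

end Shape

namespace Graphon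

section Optimizers

variable {m : ℕ} {g : Graphon} {x : ℝ × ℝ} {θ : Shape}

theorem podeBlock_ne_four_or {r m : ℕ} (i k : Fin r ⊕ Fin m) : podeBlock i k ≠ 4 ∨ 2 ≤ m := by
  rcases i with i | i <;> rcases k with k | k <;> simp only [podeBlock]
  · split_ifs <;> simp
  · simp
  · simp
  · obtain rfl | hik := eq_or_ne i k
    · simp
    · have : Nontrivial (Fin m) := ⟨i, k, hik⟩
      exact Or.inr (Fin.nontrivial_iff_two_le.1 this)

theorem exists_podeBlock_eq (hm : 1 ≤ m) {j : Fin 5} (hj : j ≠ 4 ∨ 2 ≤ m) :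
    ∃ i k : Fin 2 ⊕ Fin m, podeBlock i k = j := by
  have i₀ : Fin m := ⟨0, hm⟩
  fin_cases j
  · exact ⟨Sum.inl 0, Sum.inl 0, rfl⟩
  · exact ⟨Sum.inl 0, Sum.inl 1, rfl⟩
  · exact ⟨Sum.inl 0, Sum.inr i₀, rfl⟩
  · exact ⟨Sum.inr i₀, Sum.inr i₀, if_pos rfl⟩
  · obtain ⟨i, k, hik⟩ := Fin.nontrivial_iff_two_le.2 (hj.resolve_left (not_not_intro rfl))
    exact ⟨Sum.inr i, Sum.inr k, if_neg hik⟩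

/-- For `m = 1` the value `val 4` between different podes of the second group has no meaning; it is
normalized to `1 / 2`. -/
theorem IsTypeC.exists_hasShape (hm : 1 ≤ m) (h : IsTypeC m g) :
    ∃ θ ∈ Icc (0 : Shape) 1, HasShape m g θ ∧ θ.c ∈ Ioo 0 1 ∧
      Function.Injective (podeMatrix 2 m θ) ∧ (¬(2 ≤ m) → θ.val 4 = 1 / 2) := by
  obtain ⟨c, a₁, a₂, d, b, p, hc0, hc1, hinj, hg, -⟩ := h
  let θ : Shape := (c, fun j => if j ≠ 4 ∨ 2 ≤ m then ![a₁, a₂, d, b, p] j else 1 / 2)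
  have hP : podeValue 2 m a₁ a₂ d b p = podeMatrix 2 m θ := by
    ext i k
    rw [podeValue_eq_podeBlock]
    exact (if_pos (podeBlock_ne_four_or i k)).symm
  rw [hP] at hinj hg
  have hpos : ∀ i, 0 < podeSize 2 m c i := podeSize_pos one_le_two hm ⟨hc0, hc1⟩
  have hval : ∀ j, θ.val j ∈ Icc (0 : ℝ) 1 := fun j => by
    by_cases hj : j ≠ 4 ∨ 2 ≤ m
    · obtain ⟨i, k, rfl⟩ := exists_podeBlock_eq hm hj
      exact hg.value_mem (hpos i) (hpos k)
    · simp only [θ, Shape.val, if_neg hj]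
      norm_num
  exact ⟨θ, Shape.mem_Icc (θ := θ) ⟨hc0.le, hc1.le⟩ hval, hg, ⟨hc0, hc1⟩, hinj,
    fun hm2 => if_neg fun h => h.elim (fun h4 => h4 rfl) hm2⟩

theorem IsOptimizer.ent_le (hm : 1 ≤ m) (h : IsOptimizer g x) (hx : x.2 < x.1 ^ 3)
    (hθ : θ ∈ Icc (0 : Shape) 1) (hedge : θ.edge m = x.1) (htri : θ.tri m ≤ x.2) :
    θ.ent m ≤ g.entropy := by
  obtain ⟨θ', hθ', hedge', htri', hent⟩ := Shape.exists_tri_eq hm hθ htri (hedge ▸ hx.le)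
  obtain ⟨g', hg'⟩ := Graphon.exists_hasShape hm hθ'
  rw [← hg'.entropy_eq hm] at hent
  exact hent.trans (h.2.2 g' (by rw [hg'.edgeDensity_eq hm, hedge', hedge])
    (by rw [hg'.triangleDensity_eq hm, htri']))

/-- The parameters of an optimizer with pairwise distinct podes, at a point where the maximal
entropy is differentiable in the triangle density. -/
structure IsOptimal (m : ℕ) (θ : Shape) : Prop where
  c_mem : θ.c ∈ Ioo 0 1
  val_mem : ∀ j, θ.val j ∈ Ioo 0 1
  injective : Function.Injective (podeMatrix 2 m θ)
  extremal : Shape.Extremal m (θ.edge m) (θ.tri m) (θ.ent m)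

theorem isOptimal_of_extremal (hm : 1 ≤ m) (hθ : θ ∈ Icc (0 : Shape) 1) (hc : θ.c ∈ Ioo 0 1)
    (hinj : Function.Injective (podeMatrix 2 m θ)) (hval4 : ¬(2 ≤ m) → θ.val 4 = 1 / 2)
    (htri : θ.tri m < θ.edge m ^ 3)
    (hE : Shape.Extremal m (θ.edge m) (θ.tri m) (θ.ent m)) : IsOptimal m θ := by
  have hedge : θ.edge m ∈ Ioo 0 1 :=
    Shape.edge_mem_Ioo hm hθ hc (val_zero_ne_val_one hinj) htri
  refine ⟨hc, fun j => ?_, hinj, hE⟩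
  by_cases hj : j ≠ 4 ∨ 2 ≤ m
  · exact hE.val_mem_Ioo hm hθ hc hedge hj
  · rw [not_or, not_ne_iff] at hj
    rw [hj.1, hval4 hj.2]
    norm_num

theorem IsOptimal.mem_Icc (h : IsOptimal m θ) : θ ∈ Icc (0 : Shape) 1 :=
  Shape.mem_Icc (Ioo_subset_Icc_self h.c_mem) fun j => Ioo_subset_Icc_self (h.val_mem j)

theorem exists_isOptimal (hm : 1 ≤ m) {W : Set (ℝ × ℝ)} (hW : IsOpen W) (hne : W.Nonempty)
    (hlt : ∀ x ∈ W, x.2 < x.1 ^ 3) (hC : ∀ x ∈ W, ∃ g, IsOptimizer g x ∧ IsTypeC m g) :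
    ∃ x ∈ W, ∃ g θ, IsOptimizer g x ∧ HasShape m g θ ∧ IsOptimal m θ := by
  have : Nonempty Graphon := (hC _ hne.some_mem).nonempty
  choose! G hopt htype using hC
  have hshape := fun x hx => (htype x hx).exists_hasShape hm
  choose! θ hθ hGθ hc hinj hval4 using hshape
  have hedge : ∀ x ∈ W, (θ x).edge m = x.1 := fun x hx =>
    ((hGθ x hx).edgeDensity_eq hm).symm.trans (hopt x hx).1
  have htri : ∀ x ∈ W, (θ x).tri m = x.2 := fun x hx =>
    ((hGθ x hx).triangleDensity_eq hm).symm.trans (hopt x hx).2.1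
  obtain ⟨⟨ε, τ⟩, hετ⟩ := hne
  have hJ : IsOpen (Prod.mk ε ⁻¹' W) := hW.preimage (by fun_prop)
  have hmono : MonotoneOn (fun t => (G (ε, t)).entropy) (Prod.mk ε ⁻¹' W) :=
    fun t ht t' ht' htt' => ((hGθ _ ht).entropy_eq hm).trans_le <|
      (hopt _ ht').ent_le hm (hlt _ ht') (hθ _ ht) (hedge _ ht) ((htri _ ht).trans_le htt')
  obtain ⟨t, ht, hd⟩ := exists_differentiableAt_of_monotoneOn hmono hJ ⟨τ, hετ⟩
  have hE : Shape.Extremal m ε t (G (ε, t)).entropy :=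
    Shape.Extremal.of_monotoneOn (m := m) hmono (hJ.mem_nhds ht) hd fun u hu _ hθ' =>
      (hopt _ hu).ent_le hm (hlt _ hu) hθ'
  have hlt' := hlt _ ht
  rw [← hedge _ ht, ← htri _ ht] at hlt'
  refine ⟨(ε, t), ht, G (ε, t), θ (ε, t), hopt _ ht, hGθ _ ht,
    isOptimal_of_extremal hm (hθ _ ht) (hc _ ht) (hinj _ ht) (hval4 _ ht) hlt' ?_⟩
  rwa [hedge _ ht, htri _ ht, ← (hGθ _ ht).entropy_eq hm]

end Optimizers

end Graphon

namespace Shape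

/-- For `m = 2`, the parameters after exchanging the two pairs of podes. -/
def exchange (θ : Shape) : Shape :=
  (1 - θ.c, ![θ.val 3, θ.val 4, θ.val 2, θ.val 0, θ.val 1])

theorem continuous_exchange : Continuous exchange := by
  refine (continuous_const.sub continuous_fst).prodMk (continuous_pi fun j => ?_)
  fin_cases j <;> simp only [val, Fin.reduceFinMk, Matrix.cons_val, Fin.zero_eta, Fin.mk_one] <;>
    fun_prop

theorem weight_exchange (f : Fin 5 → ℝ) (θ : Shape) :
    ∑ j, weight 2 θ.exchange.c j * ![f 3, f 4, f 2, f 0, f 1] j = ∑ j, weight 2 θ.c j * f j := by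
  simp only [Fin.sum_univ_five, weight, exchange, c, Matrix.cons_val, Nat.cast_ofNat]
  ring

theorem edge_exchange (θ : Shape) : θ.exchange.edge 2 = θ.edge 2 :=
  weight_exchange θ.val θ

theorem tri_exchange (θ : Shape) : θ.exchange.tri 2 = θ.tri 2 := by
  simp only [tri, Fin.sum_univ_five, weight, codegree, exchange, c, val, Matrix.cons_val,
    Nat.cast_ofNat]
  ring

theorem ent_exchange (θ : Shape) : θ.exchange.ent 2 = θ.ent 2 := by
  simp only [ent, Fin.sum_univ_five, weight, exchange, c, val, Matrix.cons_val, Nat.cast_ofNat]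
  ring

end Shape

namespace Graphon

section Limits

variable {ι ι' α : Type} [Fintype ι] [Fintype ι'] {l : Filter α} [l.NeBot]

theorem IsCoupling.mem_Icc {η : ℝ} {w : ι → ℝ} {P : ι → ι → ℝ} {w' : ι' → ℝ} {P' : ι' → ι' → ℝ}
    {M : ι → ι' → ℝ} (h : IsCoupling η w P w' P' M) :
    M ∈ Icc (0 : ι → ι' → ℝ) fun _ => w' :=
  ⟨h.nonneg, fun i j => (Finset.single_le_sum (f := fun i => M i j) (fun i _ => h.nonneg i j)
    (Finset.mem_univ i)).trans_eq (h.col j)⟩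

theorem IsCoupling.of_tendsto {η : α → ℝ} {w : α → ι → ℝ} {P : α → ι → ι → ℝ} {w' : ι' → ℝ}
    {P' : ι' → ι' → ℝ} {M : α → ι → ι' → ℝ} {η₀ : ℝ} {w₀ : ι → ℝ} {P₀ : ι → ι → ℝ}
    {M₀ : ι → ι' → ℝ} (h : ∀ n, IsCoupling (η n) (w n) (P n) w' P' (M n))
    (hη : Tendsto η l (𝓝 η₀)) (hw : Tendsto w l (𝓝 w₀)) (hP : Tendsto P l (𝓝 P₀))
    (hM : Tendsto M l (𝓝 M₀)) : IsCoupling η₀ w₀ P₀ w' P' M₀ := by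
  have hM' : ∀ i j, Tendsto (fun n => M n i j) l (𝓝 (M₀ i j)) := fun i j =>
    tendsto_pi_nhds.1 (tendsto_pi_nhds.1 hM i) j
  refine ⟨fun i j => ge_of_tendsto' (hM' i j) fun n => (h n).nonneg i j, fun i => ?_, fun j => ?_,
    fun i j k l => ?_⟩
  · refine tendsto_nhds_unique (tendsto_finsetSum _ fun j _ => hM' i j) ?_
    simpa only [(h _).row] using tendsto_pi_nhds.1 hw i
  · refine tendsto_nhds_unique (tendsto_finsetSum _ fun i _ => hM' i j) ?_
    simpa only [(h _).col] using tendsto_const_nhds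
  · have hP' := tendsto_pi_nhds.1 (tendsto_pi_nhds.1 hP i) k
    exact le_of_tendsto_of_tendsto' (((hM' i j).mul (hM' k l)).mul (hP'.sub_const (P' j l)).abs) hη
      fun n => (h n).val i j k l

end Limits

section Optimal

variable {m : ℕ} {θ : Shape}

theorem podeMatrix_exchange (i k : Fin 2 ⊕ Fin 2) :
    podeMatrix 2 2 θ.exchange i k = podeMatrix 2 2 θ i.swap k.swap := by
  rcases i with i | i <;> rcases k with k | k <;>
    simp only [podeMatrix, podeBlock, Sum.swap_inl, Sum.swap_inr, apply_ite θ.exchange.val,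
      apply_ite θ.val] <;>
    rfl

theorem podeSize_exchange (i : Fin 2 ⊕ Fin 2) :
    podeSize 2 2 θ.exchange.c i = podeSize 2 2 θ.c i.swap := by
  obtain _ | _ := i
  · rfl
  · exact congrArg (· / _) (sub_sub_cancel 1 θ.c)

theorem IsOptimal.exchange (h : IsOptimal 2 θ) : IsOptimal 2 θ.exchange where
  c_mem := ⟨sub_pos.2 h.c_mem.2, sub_lt_self 1 h.c_mem.1⟩
  val_mem j := by
    fin_cases j
    exacts [h.val_mem 3, h.val_mem 4, h.val_mem 2, h.val_mem 0, h.val_mem 1]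
  injective i k hik := Sum.swap_leftInverse.injective <| h.injective <| funext fun l => by
    simpa only [podeMatrix_exchange, Sum.swap_swap] using congrFun hik l.swap
  extremal := by
    rw [Shape.edge_exchange, Shape.tri_exchange, Shape.ent_exchange]
    exact h.extremal

theorem IsMerging.exchange {ι' : Type} [DecidableEq ι'] {w' : ι' → ℝ} {P' : ι' → ι' → ℝ}
    {π : Fin 2 ⊕ Fin 2 → ι'}
    (h : IsMerging (podeSize 2 2 θ.c) (podeMatrix 2 2 θ) w' P' π) :
    IsMerging (podeSize 2 2 θ.exchange.c) (podeMatrix 2 2 θ.exchange) w' P' (π ∘ Sum.swap) where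
  surjective := h.surjective.comp Sum.swap_leftInverse.surjective
  val i k := (podeMatrix_exchange i k).trans (h.val _ _)
  size j := by
    rw [h.size, ← (Equiv.sumComm (Fin 2) (Fin 2)).sum_comp]
    simp only [podeSize_exchange, Equiv.sumComm_apply, Function.comp_apply]

variable {g₀ : Graphon} {c₀ : ℝ} {P₀ : Fin 1 ⊕ Fin m → Fin 1 ⊕ Fin m → ℝ}
  {α : Type} {l : Filter α} [l.NeBot] {θs : α → Shape}

theorem IsMerging.false_of_pair_merged (hm : 1 ≤ m) (hinj : Function.Injective P₀)
    (hg : IsMultipodal g₀ (podeSize 1 m c₀) P₀) (hA : ¬IsTypeA (m + 1) g₀)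
    (hlim : Tendsto θs l (𝓝 θ)) (hθs : ∀ n, IsOptimal m (θs n)) (hc : θ.c ∈ Ioo 0 1)
    {π : Fin 2 ⊕ Fin m → Fin 1 ⊕ Fin m}
    (h : IsMerging (podeSize 2 m θ.c) (podeMatrix 2 m θ) (podeSize 1 m c₀) P₀ π)
    (h01 : π (Sum.inl 0) = π (Sum.inl 1)) : False := by
  obtain ⟨hv, ρ, hρ, hmerging⟩ := h.of_pair_merged hinj h01
  have hinj₁ : Function.Injective (podeMatrix 1 m θ) := hmerging.injective hinj hρ
  refine Shape.false_of_merging hm hlim (fun n => (hθs n).c_mem) (fun n => (hθs n).val_mem)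
    (fun n => val_zero_ne_val_one (hθs n).injective) (fun n => (hθs n).extremal) hc hv
    (val_three_ne_val_four hinj₁) ?_ fun ⟨hsize, h03, h24⟩ =>
      hA ((hmerging.isMultipodal hρ hg).isTypeA_of_balanced hm hsize h03 h24)
  rintro rfl
  exact not_val_eq_val_two hinj₁

theorem IsCoupling.false_of_tendsto (hm : 1 ≤ m) (hc₀ : c₀ ∈ Ioo 0 1)
    (hinj : Function.Injective P₀) (hg : IsMultipodal g₀ (podeSize 1 m c₀) P₀)
    (hA : ¬IsTypeA (m + 1) g₀) (hlim : Tendsto θs l (𝓝 θ)) (hθs : ∀ n, IsOptimal m (θs n))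
    {M : Fin 2 ⊕ Fin m → Fin 1 ⊕ Fin m → ℝ}
    (h : IsCoupling 0 (podeSize 2 m θ.c) (podeMatrix 2 m θ) (podeSize 1 m c₀) P₀ M) : False := by
  have hθ : θ ∈ Icc (0 : Shape) 1 :=
    isClosed_Icc.mem_of_tendsto hlim (Eventually.of_forall fun n => (hθs n).mem_Icc)
  have hc : θ.c ∈ Ioo 0 1 := ⟨(Shape.c_mem hθ).1.lt_of_ne' (h.c_ne_zero hm hc₀ hinj),
    (Shape.c_mem hθ).2.lt_of_ne (h.c_ne_one hm hc₀ hinj hg hA)⟩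
  obtain ⟨π, hπ⟩ := h.exists_isMerging (podeSize_pos one_le_two hm hc)
    (podeSize_pos le_rfl hm hc₀) hinj
  obtain h01 | ⟨rfl, h01⟩ := hπ.pair_merged_or hinj
  · exact hπ.false_of_pair_merged hm hinj hg hA hlim hθs hc h01
  · exact hπ.exchange.false_of_pair_merged hm hinj hg hA
      ((Shape.continuous_exchange.tendsto θ).comp hlim) (fun n => (hθs n).exchange)
      ⟨sub_pos.2 hc.2, sub_lt_self 1 hc.1⟩ (h01 0 1)

theorem exists_forall_pos_not_isCoupling (hm : 1 ≤ m) (hc₀ : c₀ ∈ Ioo 0 1)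
    (hinj : Function.Injective P₀) (hg : IsMultipodal g₀ (podeSize 1 m c₀) P₀)
    (hA : ¬IsTypeA (m + 1) g₀) : ∃ η > 0, ∀ θ, IsOptimal m θ → ∀ M,
      ¬IsCoupling η (podeSize 2 m θ.c) (podeMatrix 2 m θ) (podeSize 1 m c₀) P₀ M := by
  by_contra! hcon
  choose θ hθ M hM using fun n : ℕ => hcon (1 / ((n : ℝ) + 1)) Nat.one_div_pos_of_nat
  obtain ⟨⟨θ₀, M₀⟩, -, φ, hφ, hlim⟩ := (isCompact_Icc.prod isCompact_Icc).tendsto_subseq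
    fun n => (⟨(hθ n).mem_Icc, (hM n).mem_Icc⟩ : (θ n, M n) ∈ _ ×ˢ _)
  have hθlim : Tendsto (θ ∘ φ) atTop (𝓝 θ₀) := (continuous_fst.tendsto _).comp hlim
  have hw : Continuous fun θ : Shape => podeSize 2 m θ.c :=
    continuous_pi fun i => (continuous_podeSize i).comp continuous_fst
  have hP : Continuous (podeMatrix 2 m) :=
    continuous_pi fun i => continuous_pi fun k => (continuous_apply _).comp continuous_snd
  have hM₀ : IsCoupling 0 (podeSize 2 m θ₀.c) (podeMatrix 2 m θ₀) (podeSize 1 m c₀) P₀ M₀ :=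
    IsCoupling.of_tendsto (fun n => hM (φ n))
      (tendsto_one_div_add_atTop_nhds_zero_nat.comp hφ.tendsto_atTop)
      ((hw.tendsto θ₀).comp hθlim) ((hP.tendsto θ₀).comp hθlim)
      ((continuous_snd.tendsto _).comp hlim)
  exact hM₀.false_of_tendsto hm hc₀ hinj hg hA hθlim fun n => hθ (φ n)

end Optimal

end Graphon

end

theorem mainTheorem2_general {m : ℕ} (hm : 1 ≤ m) {V : Set (ℝ × ℝ)} (hV : IsOpen V)
    (hlt : ∀ x ∈ V, x.2 < x.1 ^ 3)
    (hC : ∀ x ∈ V, ∃ g, Graphon.IsOptimizer g x ∧ Graphon.IsTypeC m g)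
    {g₀ : Graphon} (hg₀ : Graphon.IsTypeB m g₀) {x₀ : ℝ × ℝ} (hx₀ : x₀ ∈ closure V) :
    ¬∀ η > 0, ∀ᶠ x in 𝓝[V] x₀, ∀ g, Graphon.IsOptimizer g x → Graphon.cutDist g g₀ < η := by
  intro hlim
  obtain ⟨c₀, a₁, a₂, d, b, p, hc0, hc1, hinj, hg, hA⟩ := hg₀
  obtain ⟨η, hη, hnot⟩ := Graphon.exists_forall_pos_not_isCoupling hm ⟨hc0, hc1⟩ hinj hg hA
  obtain ⟨N, hN, hx₀N, hnear⟩ := mem_nhdsWithin.1 (hlim η hη)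
  obtain ⟨x, ⟨hxN, hxV⟩, g, θ, hopt, hgθ, hθ⟩ := Graphon.exists_isOptimal hm (hN.inter hV)
    (mem_closure_iff.1 hx₀ N hN hx₀N) (fun x hx => hlt x hx.2) fun x hx => hC x hx.2
  obtain ⟨M, hM⟩ := Graphon.exists_isCoupling hgθ hg (hnear ⟨hxN, hxV⟩ g hopt)
  exact hnot θ hθ M hM

theorem mainTheorem2 (m : ℕ) (hm : 1 ≤ m) :
    ∃ F : Set ℝ, F.Finite ∧
      ∀ ε₀ τ₀ : ℝ, ε₀ ∉ F →
        ¬ ∃ (U V : Set (ℝ × ℝ)) (g₀ : Graphon),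
          Graphon.IsPhaseB m U ∧ Graphon.IsPhaseC m V ∧ Graphon.IsTypeB m g₀ ∧
          Graphon.IsContinuousTransition U V (ε₀, τ₀) g₀ := by
  refine ⟨∅, finite_empty, fun ε₀ τ₀ _ => ?_⟩
  rintro ⟨U, V, g₀, -, ⟨⟨hV, -, G, hG, -⟩, hlt, hC⟩, hg₀, -, hx₀, hlim⟩
  exact mainTheorem2_general hm hV hlt (fun x hx => ⟨G x, (hG x hx).1, hC x hx _ (hG x hx).1⟩) hg₀
    (frontier_subset_closure hx₀) fun η hη =>
      (hlim η hη).filter_mono (nhdsWithin_mono _ subset_union_right)
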